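/- Let $r\ge 1$ and $m\ge 0$ be integers and let $a:\mathbb Z\to\mathbb C^{r\times r}$ be finitely supported. For a finitely supported sequence $c$ write $\widehat c(\xi):=\sum_{k\in\mathbb Z}c(k)e^{-ik\xi}$, and write $f(\xi)=g(\xi)+O(|\xi|^k)$ if $f^{(j)}(0)=g^{(j)}(0)$ for $0\le j<k$. Suppose that $1$ is a simple eigenvalue of $\widehat a(0)$ and that none of the numbers $2^k$, $k=1,2,3,\dots$, is an eigenvalue of $\widehat a(0)$. Let $\phi=(\phi_1,\dots,\phi_r)^{\mathsf T}$ be a vector of compactly supported distributions on $\mathbb R$ whose Fourier transform (normalized by $\widehat f(\xi)=\int f(x)e^{-ix\xi}\,dx$) satisfies $\widehat\phi(2\xi)=\widehat a(\xi)\widehat\phi(\xi)$ for all $\xi\in\mathbb R$ and $\widehat\phi(0)\neq 0$. The subdivision operator is $(S_a w)(j):=2\sum_{k\in\mathbb Z}w(k)a(j-2k)$. The Lagrange subdivision scheme with mask $a$ is called convergent with limiting functions in $C^m(\mathbb R)$ if for every $w_0:\mathbb Z\to\mathbb C^{1\times r}$ there are $\eta_1,\dots,\eta_r\in C^m(\mathbb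 R)$ such that for all $K>0$ and $\ell=1,\dots,r$, $$\lim_{n\to\infty}\ \sup_{k\in\mathbb Z\cap[-2^nK,2^nK]}\bigl|(S_a^nw_0)(k)e_\ell-\eta_\ell(2^{-n}k)\bigr|=0 .$$ The mask $a$ has order $k$ sum rules with a finitely supported $v:\mathbb Z\to\mathbb C^{1\times r}$ if $\widehat v(0)\ne0$, $\widehat v(2\xi)\widehat a(\xi)=\widehat v(\xi)+O(|\xi|^k)$ and $\widehat v(2\xi)\widehat a(\xi+\pi)=O(|\xi|^k)$. Let $\operatorname{sr}(a)$ be the largest $k\ge 0$ for which such a $v$ exists, and let $v$ be any such sequence for $k=\operatorname{sr}(a)$. Define $\operatorname{sm}_\infty(a):=-\log_2\rho$ (with $-\log_2 0=+\infty$), where $$\rho:=\sup_u\ \limsup_{n\to\infty}\bigl\|(S_a^n(\boldsymbol\delta I_r))*u\bigr\|_{\ell_\infty}^{1/n},$$ the supremum being over all finitely supported $u:\mathbb Z\to\mathbb C^{r}$ with $\widehat v(\xi)\widehat u(\xi)=O(|\xi|^{\operatorname{sr}(a)})$; here $\boldsymbol\delta(0)=1$ and $\boldsymbol\delta(k)=0$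 for $k\ne0$. For $f\in L_\infty(\mathbb R)$ let $\operatorname{sm}_\infty(f)$ be the supremum of all $n+\tau$ with $n\in\{0,1,2,\dots\}$ and $0\le\tau<1$ such that $f,\dots,f^{(n-1)}$ are absolutely continuous functions in $L_\infty(\mathbb R)$, $f^{(n)}\in L_\infty(\mathbb R)$, and $\|f^{(n)}-f^{(n)}(\cdot-t)\|_{L_\infty}\le C|t|^\tau$ for all $t\in\mathbb R$ and some constant $C>0$. For a distribution that is not given by a function in $L_\infty(\mathbb R)$ put $\operatorname{sm}_\infty:=-\infty$, and let $\operatorname{sm}_\infty(\phi):=\min_{1\le\ell\le r}\operatorname{sm}_\infty(\phi_\ell)$. Then the Lagrange subdivision scheme with mask $a$ is convergent with limiting functions in $C^m(\mathbb R)$ if and only if $\operatorname{sm}_\infty(a)>0$ and $\operatorname{sm}_\infty(\phi)>m$. -/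

import Mathlib

open scoped SchwartzMap ENNReal Matrix

noncomputable section

namespace VectorSubdivision

/-! ### Sequences, symbols and the subdivision operator -/

/-- The symbol `∑ₖ c(k) e^{-ikξ}` of a finitely supported sequence `c`. -/
def symbol {E : Type*} [AddCommMonoid E] [Module ℂ E] (c : ℤ →₀ E) (ξ : ℝ) : E :=
  c.sum fun k x => Complex.exp (-(Complex.I * (k : ℂ) * (ξ : ℂ))) • x

/-- The vector subdivision operator `(S_a v)(j) = 2 ∑ₖ v(k) a(j - 2k)`. The sum has only finitely
many nonzero terms because the mask `a` is finitely supported. -/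
def subdivisionOp {ι : Type*} {r : ℕ} (a : ℤ →₀ Matrix (Fin r) (Fin r) ℂ)
    (v : ℤ → Matrix ι (Fin r) ℂ) : ℤ → Matrix ι (Fin r) ℂ :=
  fun j => (2 : ℂ) • ∑ᶠ k : ℤ, v k * a (j - 2 * k)

/-- The sequence `δ I_r`. -/
def diracId (r : ℕ) : ℤ → Matrix (Fin r) (Fin r) ℂ := Pi.single 0 1

/-- The convolution `(w * u)(j) = ∑ₖ w(j - k) u(k)` of a sequence of `r × r` matrices with a
finitely supported sequence of column vectors. -/
def conv {r : ℕ} (w : ℤ → Matrix (Fin r) (Fin r) ℂ) (u : ℤ →₀ (Fin r → ℂ)) : ℤ → (Fin r → ℂ) :=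
  fun j => u.sum fun k x => w (j - k) *ᵥ x

/-- The `ℓ_∞` norm of a sequence of vectors, as an extended nonnegative real. -/
def supNorm {r : ℕ} (w : ℤ → (Fin r → ℂ)) : ℝ≥0∞ := ⨆ (k : ℤ) (i : Fin r), ‖w k i‖ₑ

/-! ### Sum rules and the smoothness quantity of a mask -/

/-- `f(ξ) = g(ξ) + O(|ξ|^k)` as `ξ → 0`, in the sense that the derivatives of orders
`0, …, k - 1` of `f` and `g` agree at `0`. -/
def AgreeToOrder {E : Type*} [NormedAddCommGroup E] [NormedSpace ℝ E] (k : ℕ) (f g : ℝ → E) :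
    Prop :=
  ∀ j < k, iteratedDeriv j f 0 = iteratedDeriv j g 0

/-- The mask `a` has order `k` sum rules with the (order `k`) matching filter `v`, a finitely
supported sequence of row vectors. -/
structure HasSumRules {r : ℕ} (a : ℤ →₀ Matrix (Fin r) (Fin r) ℂ) (k : ℕ)
    (v : ℤ →₀ (Fin r → ℂ)) : Prop where
  ne_zero : symbol v 0 ≠ 0
  at_zero : AgreeToOrder k (fun ξ : ℝ => symbol v (2 * ξ) ᵥ* symbol a ξ) (fun ξ => symbol v ξ)
  at_pi : AgreeToOrder k (fun ξ : ℝ => symbol v (2 * ξ) ᵥ* symbol a (ξ + Real.pi)) (fun _ => 0)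

/-- `sr(a)`: the largest `k` such that `a` has order `k` sum rules with some matching filter. -/
def sumRuleOrder {r : ℕ} (a : ℤ →₀ Matrix (Fin r) (Fin r) ℂ) : ℕ :=
  sSup {k : ℕ | ∃ v, HasSumRules a k v}

/-- There always is a matching filter for the order `sr(a)`. -/
theorem exists_hasSumRules {r : ℕ} (hr : 0 < r) (a : ℤ →₀ Matrix (Fin r) (Fin r) ℂ) :
    ∃ v, HasSumRules a (sumRuleOrder a) v := by
  have h0 : ∃ v, HasSumRules a 0 v := by
    refine ⟨Finsupp.single 0 1, ?_, fun j hj => absurd hj (Nat.not_lt_zero j),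
      fun j hj => absurd hj (Nat.not_lt_zero j)⟩
    intro h
    have := congrFun h ⟨0, hr⟩
    simp [symbol] at this
  by_cases hb : BddAbove {k : ℕ | ∃ v, HasSumRules a k v}
  · exact Nat.sSup_mem ⟨0, h0⟩ hb
  · have : sumRuleOrder a = 0 := Nat.sSup_of_not_bddAbove hb
    rw [this]
    exact h0

/-- The space of finitely supported `u` with `v̂(ξ) û(ξ) = O(|ξ|^j)` as `ξ → 0`. -/
def moments {r : ℕ} (j : ℕ) (v : ℤ →₀ (Fin r → ℂ)) : Set (ℤ →₀ (Fin r → ℂ)) :=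
  {u | AgreeToOrder j (fun ξ : ℝ => symbol v ξ ⬝ᵥ symbol u ξ) (fun _ => 0)}

/-- `ρ_j(a, v)_∞`: the supremum over `u ∈ moments j v` of
`limsup_{n → ∞} ‖(S_aⁿ (δ I_r)) * u‖_∞^{1/n}`. -/
def rho {r : ℕ} (a : ℤ →₀ Matrix (Fin r) (Fin r) ℂ) (j : ℕ) (v : ℤ →₀ (Fin r → ℂ)) : ℝ≥0∞ :=
  ⨆ u ∈ moments j v, Filter.limsup
    (fun n : ℕ => supNorm (conv ((subdivisionOp a)^[n] (diracId r)) u) ^ ((1 : ℝ) / n))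
    Filter.atTop

/-- `sm_∞(a) = -log₂ ρ_{sr(a)}(a, v)_∞`, computed with the matching filter `v` of `a`. -/
def smMask {r : ℕ} (a : ℤ →₀ Matrix (Fin r) (Fin r) ℂ) (v : ℤ →₀ (Fin r → ℂ)) : EReal :=
  -(ENNReal.log (rho a (sumRuleOrder a) v) / ((Real.log 2 : ℝ) : EReal))

/-! ### The smoothness quantity of a function and of a vector of distributions -/

/-- `f` belongs to the Sobolev space `W^m_∞(ℝ)`: `f, …, f^{(m-1)}` are absolutely continuous and
`f, …, f^{(m)}` belong to `L_∞(ℝ)`. -/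
def MemSobolev (m : ℕ) (f : ℝ → ℂ) : Prop :=
  (∀ j < m, ∀ x y : ℝ, AbsolutelyContinuousOnInterval (iteratedDeriv j f) x y) ∧
  ∀ j ≤ m, MeasureTheory.MemLp (iteratedDeriv j f) ∞ MeasureTheory.volume

/-- `f ∈ Lip(τ, L_∞)`: `‖f - f(· - t)‖_{L_∞} ≤ C |t|^τ` for all `t`. -/
def MemLip (τ : ℝ) (f : ℝ → ℂ) : Prop :=
  ∃ C : ℝ, 0 < C ∧ ∀ t : ℝ,
    MeasureTheory.eLpNorm (fun x => f x - f (x - t)) ∞ MeasureTheory.volume ≤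
      ENNReal.ofReal (C * |t| ^ τ)

/-- `sm_∞(f)`: the supremum of all `m + τ`, `m ∈ ℕ`, `0 ≤ τ < 1`, such that `f ∈ W^m_∞(ℝ)` and
`f^{(m)} ∈ Lip(τ, L_∞)`. -/
def smFun (f : ℝ → ℂ) : EReal :=
  sSup {s : EReal | ∃ (m : ℕ) (τ : ℝ), 0 ≤ τ ∧ τ < 1 ∧ MemSobolev m f ∧
    MemLip τ (iteratedDeriv m f) ∧ s = (((m : ℝ) + τ : ℝ) : EReal)}

/-- `sm_∞(T)` for a distribution `T`: the value of `smFun` at the function `f ∈ L_∞(ℝ)` that `T`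
is given by (the supremum chooses the smoothest representative of its almost-everywhere class),
and `-∞` if `T` is not given by a function in `L_∞(ℝ)`. -/
def smDist (T : 𝓢'(ℝ, ℂ)) : EReal :=
  ⨆ (f : ℝ → ℂ) (hf : MeasureTheory.MemLp f ∞ MeasureTheory.volume)
    (_ : MeasureTheory.Lp.toTemperedDistribution (hf.toLp f) = T), smFun f

/-- `sm_∞(φ)` for a vector `φ` of distributions: the smallest value among its entries. -/
def smVec {r : ℕ} (φ : Fin r → 𝓢'(ℝ, ℂ)) : EReal := ⨅ i, smDist (φ i)

/-! ### The Fourier transform of a compactly supported distribution -/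

/-- A smooth cutoff function that is `1` on `[-(n+1), n+1]` and `0` outside `(-(n+2), n+2)`. -/
def cutoff (n : ℕ) : ContDiffBump (0 : ℝ) :=
  ⟨n + 1, n + 2, by positivity, by linarith⟩

/-- The Schwartz function `x ↦ χₙ(x) e^{-ixξ}`, where `χₙ` is the cutoff function. -/
def cutoffExp (n : ℕ) (ξ : ℝ) : 𝓢(ℝ, ℂ) :=
  HasCompactSupport.toSchwartzMap
    (f := fun x : ℝ => ((cutoff n x : ℝ) : ℂ) * Complex.exp (-(Complex.I * (x : ℂ) * (ξ : ℂ))))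
    (by
      refine HasCompactSupport.mul_right ?_
      exact (cutoff n).hasCompactSupport.comp_left (g := fun t : ℝ => (t : ℂ)) rfl)
    (by
      refine ContDiff.mul ?_ ?_
      · exact Complex.ofRealCLM.contDiff.comp (cutoff n).contDiff
      · refine Complex.contDiff_exp.comp ?_
        refine ((contDiff_const.mul Complex.ofRealCLM.contDiff).mul contDiff_const).neg)

/-- The Fourier transform `T̂(ξ) = T(e^{-ixξ})` of a compactly supported distribution `T`. Since
the support of `T` is compact, the sequence `T(χₙ(x) e^{-ixξ})` is constant for large `n`. -/
def distFourier (T : 𝓢'(ℝ, ℂ)) (ξ : ℝ) : ℂ :=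
  Filter.limUnder Filter.atTop fun n : ℕ => T (cutoffExp n ξ)

/-- The entrywise Fourier transform of a vector of compactly supported distributions. -/
def fourierVec {r : ℕ} (φ : Fin r → 𝓢'(ℝ, ℂ)) (ξ : ℝ) : Fin r → ℂ := fun i => distFourier (φ i) ξ

/-! ### Lagrange subdivision schemes -/

/-- `1` is a simple eigenvalue of `â(0)` and no `2^k` with `k ≥ 1` is an eigenvalue of `â(0)`. -/
def EigenvalueCondition {r : ℕ} (a : ℤ →₀ Matrix (Fin r) (Fin r) ℂ) : Prop :=
  (symbol a 0).charpoly.rootMultiplicity 1 = 1 ∧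
  ∀ k : ℕ, 1 ≤ k → ¬ Module.End.HasEigenvalue (Matrix.toLin' (symbol a 0)) ((2 : ℂ) ^ k)

/-- The Lagrange subdivision scheme with mask `a` is convergent with limiting functions in
`C^m(ℝ)`: for every input sequence `w₀` of row vectors there are `C^m` functions `η₁, …, η_r` with
`sup_{k ∈ ℤ ∩ [-2ⁿK, 2ⁿK]} |(S_aⁿ w₀)(k) e_ℓ - η_ℓ(2⁻ⁿk)| → 0` for every `K > 0` and every `ℓ`. -/
def LagrangeConvergent {r : ℕ} (a : ℤ →₀ Matrix (Fin r) (Fin r) ℂ) (m : ℕ) : Prop :=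
  ∀ w₀ : ℤ → Matrix (Fin 1) (Fin r) ℂ, ∃ η : Fin r → ℝ → ℂ,
    (∀ l, ContDiff ℝ m (η l)) ∧
    ∀ K : ℝ, 0 < K → ∀ l : Fin r,
      Filter.Tendsto
        (fun n : ℕ => ⨆ (k : ℤ) (_ : |(k : ℝ)| ≤ 2 ^ n * K),
          ‖((subdivisionOp a)^[n] w₀) k 0 l - η l ((k : ℝ) / 2 ^ n)‖ₑ)
        Filter.atTop (nhds 0)

end VectorSubdivision

end

noncomputable section

namespace VectorSubdivision

variable {r : ℕ}

/-! ### Iterates of the subdivision operator -/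

/-! Write B_n for S_aⁿ(δI) (`iterMask`). Everything rests on two transition operators T_0, T_1 on
finitely supported columns u: the even and odd entries of B_{n+1} * u are B_n * (T_0 u) and B_n *
(T_1 u) (`conv_iterMask_succ`). They shrink supports into a fixed window, and on an invariant space
of boundedly supported columns mere convergence B_n * u → 0 is automatically uniform and geometric
(`conv_iterMask_decay`). Sum rules of order k say that T_0 and T_1 preserve the spaces of u whose
moments (v̂û)^{(i)}(0), i < j, vanish (j ≤ k), and multiply the j-th moment by 2^{-j} there (j < k).

Sufficiency. If sm_∞(a) > 0, then B_n * u → 0 for every u with sr(a) vanishing moments. Since T_ε u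
- 2^{-j} u gains one moment and 2^{-j} ≤ 1/2 for j ≥ 1, the conclusion descends to all u with
v̂(0)û(0) = 0 (`decays_of_mem_moments`). If sm_∞(φ) > m, then φ is a compactly supported refinable
C^m function G, and subdivision reproduces it from its integer samples: (B_n * G|_ℤ)(p) =
G(2^{-n}p). As G ≠ 0, the samples do not decay, hence their moment c against v̂(0) is nonzero. Each
unit column δe_l differs from (v̂_l(0)/c) G|_ℤ by a sequence with vanishing moment, so B_n e_l
converges uniformly to the samples of G v̂_l(0)/c (`exists_uniform_limit`).

Necessity. Running the scheme on the data δe_i gives a compactly supported C^m matrix F to which B_n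
converges uniformly. Its rows are fixed by â(0) and annihilated by â(π), so sr(a) ≥ 1; as 1 is a
simple eigenvalue, they are all multiples of v̂(0). Hence B_n * u → 0 whenever v̂(0)û(0) = 0,
geometrically by finite dimensionality, and ρ < 1 (`IsUniformLimit.rho_lt_one`). Reading the
iterates as step functions and passing to the limit in the Fourier domain identifies φ with F φ̂(0)
(`IsUniformLimit.fourier_eq`), a C^m refinable function. Its m-th derivative is continuous and
refinable, so differences of its samples decay, again geometrically; this is Hölder continuity with
a positive exponent and makes sm_∞(φ) strictly larger than m (`Refinable.exists_holder`). -/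

theorem subdivisionOp_apply {ι : Type*} (a : ℤ →₀ Matrix (Fin r) (Fin r) ℂ)
    (v : ℤ → Matrix ι (Fin r) ℂ) (j : ℤ) :
    subdivisionOp a v j =
      (2 : ℂ) • ∑ i ∈ a.support, if 2 ∣ j - i then v ((j - i) / 2) * a i else 0 := by
  classical
  unfold subdivisionOp
  congr 1
  rw [← Finset.sum_filter, finsum_eq_sum_of_support_subset (s :=
    (a.support.filter (fun i => 2 ∣ j - i)).image (fun i => (j - i) / 2)), Finset.sum_image]
  · refine Finset.sum_congr rfl fun i hi => ?_
    rw [Finset.mem_filter] at hi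
    congr 2
    omega
  · intro x hx y hy h
    simp only [Finset.coe_filter, Set.mem_ofPred_eq] at hx hy h
    omega
  · intro k hk
    simp only [Finset.coe_image, Finset.coe_filter, Set.mem_image, Set.mem_ofPred_eq]
    refine ⟨j - 2 * k, ⟨?_, by omega⟩, by omega⟩
    rw [Finsupp.mem_support_iff]
    intro h
    exact hk (by simp [h])

/-- The `n`-th iterate `S_aⁿ (δ I_r)`. -/
abbrev iterMask (a : ℤ →₀ Matrix (Fin r) (Fin r) ℂ) (n : ℕ) : ℤ → Matrix (Fin r) (Fin r) ℂ :=
  (subdivisionOp a)^[n] (diracId r)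

theorem iterMask_succ (a : ℤ →₀ Matrix (Fin r) (Fin r) ℂ) (n : ℕ) :
    iterMask a (n + 1) = subdivisionOp a (iterMask a n) :=
  Function.iterate_succ_apply' _ _ _

/-- A bound for the support of a finitely supported sequence. -/
theorem exists_support_bound {E : Type*} [Zero E] (c : ℤ →₀ E) :
    ∃ N : ℕ, ∀ k, c k ≠ 0 → |k| ≤ N := by
  refine ⟨c.support.sup Int.natAbs, fun k hk => ?_⟩
  rw [Int.abs_eq_natAbs]
  exact_mod_cast Finset.le_sup (f := Int.natAbs) (Finsupp.mem_support_iff.2 hk)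

/-- One level doubles the old indices and adds an index of the mask, so the bounds obey b_{n+1} =
2b_n + N with b_0 = 0. -/
theorem iterMask_support {a : ℤ →₀ Matrix (Fin r) (Fin r) ℂ} {N : ℕ}
    (hN : ∀ k, a k ≠ 0 → |k| ≤ N) (n : ℕ) (k : ℤ) (hk : iterMask a n k ≠ 0) :
    |k| ≤ (2 ^ n - 1) * N := by
  induction n generalizing k with
  | zero =>
    by_cases h : k = 0
    · simp [h]
    · exact absurd (by simp [iterMask, diracId, h]) hk
  | succ n ih =>
    rw [iterMask_succ, subdivisionOp_apply] at hk
    obtain ⟨i, hi, h⟩ := Finset.exists_ne_zero_of_sum_ne_zero (fun h => hk (by rw [h, smul_zero]))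
    by_cases h2 : 2 ∣ k - i
    · rw [if_pos h2] at h
      have h1 := ih _ (left_ne_zero_of_mul h)
      have h3 := hN i (right_ne_zero_of_mul h)
      have : k = 2 * ((k - i) / 2) + i := by omega
      rw [this]
      calc _ ≤ |2 * ((k - i) / 2)| + |i| := abs_add_le _ _
        _ ≤ 2 * ((2 ^ n - 1) * N) + N := by rw [abs_mul]; simp only [abs_two]; linarith
        _ = _ := by ring
    · exact absurd (if_neg h2) h

theorem iterMask_support' {a : ℤ →₀ Matrix (Fin r) (Fin r) ℂ} {N : ℕ}
    (hN : ∀ k, a k ≠ 0 → |k| ≤ N) (n : ℕ) (k : ℤ) (hk : iterMask a n k ≠ 0) :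
    |(k : ℝ) / 2 ^ n| ≤ N := by
  have h1 := iterMask_support hN n k hk
  have h2 : |(k : ℝ)| ≤ (2 ^ n - 1) * N := by exact_mod_cast h1
  rw [abs_div, abs_of_pos (by positivity : (0 : ℝ) < 2 ^ n), div_le_iff₀ (by positivity)]
  have : (0 : ℝ) ≤ N := by positivity
  nlinarith

theorem subdivisionOp_eq_sum {ι : Type*} (a : ℤ →₀ Matrix (Fin r) (Fin r) ℂ)
    (v : ℤ → Matrix ι (Fin r) ℂ) (j : ℤ) (s : Finset ℤ) (hs : ∀ k, a (j - 2 * k) ≠ 0 → k ∈ s) :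
    subdivisionOp a v j = (2 : ℂ) • ∑ k ∈ s, v k * a (j - 2 * k) := by
  unfold subdivisionOp
  rw [finsum_eq_sum_of_support_subset]
  intro k hk
  refine hs k fun h => hk ?_
  simp [h]

/-- By linearity it suffices to know the iterates of δI, since shifting the data by k shifts the
n-th iterate by 2ⁿk. Any finite s containing the contributing indices is allowed, so that callers
can use one s for all n. -/
theorem iterate_subdivisionOp_eq_sum {ι : Type*} {a : ℤ →₀ Matrix (Fin r) (Fin r) ℂ} {N : ℕ}
    (hN : ∀ k, a k ≠ 0 → |k| ≤ N) (w : ℤ → Matrix ι (Fin r) ℂ) (n : ℕ) (j : ℤ) (s : Finset ℤ)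
    (hs : ∀ k, |j - 2 ^ n * k| ≤ (2 ^ n - 1) * N → k ∈ s) :
    (subdivisionOp a)^[n] w j = ∑ k ∈ s, w k * iterMask a n (j - 2 ^ n * k) := by
  induction n generalizing j s with
  | zero =>
    have hj : j ∈ s := hs j (by simp)
    rw [Finset.sum_eq_single_of_mem j hj]
    · simp [iterMask, diracId]
    · intro b _ hb
      have : j - b ≠ 0 := by omega
      simp [iterMask, diracId, this]
  | succ n ih =>
    rw [Function.iterate_succ_apply']
    set t := Finset.Icc (-(|j| + N)) (|j| + N) with ht
    have htm : ∀ k, a (j - 2 * k) ≠ 0 → k ∈ t := by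
      intro k hk
      have h1 := hN _ hk
      rw [ht, Finset.mem_Icc]
      rw [abs_le] at h1
      have := abs_nonneg j
      have := neg_abs_le j
      have := le_abs_self j
      constructor <;> omega
    rw [subdivisionOp_eq_sum a _ j t htm]
    have h1 : ∀ k ∈ t, (subdivisionOp a)^[n] w k * a (j - 2 * k) =
        ∑ l ∈ s, w l * (iterMask a n (k - 2 ^ n * l) * a (j - 2 * k)) := by
      intro k _
      by_cases hk : a (j - 2 * k) = 0
      · simp [hk]
      · rw [ih k s ?_, Matrix.sum_mul]
        · simp only [Matrix.mul_assoc]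
        · intro l hl
          apply hs
          have h3 := hN _ hk
          have : j - 2 ^ (n + 1) * l = (j - 2 * k) + 2 * (k - 2 ^ n * l) := by ring
          rw [this]
          calc _ ≤ |j - 2 * k| + |2 * (k - 2 ^ n * l)| := abs_add_le _ _
            _ ≤ N + 2 * ((2 ^ n - 1) * N) := by rw [abs_mul]; simp only [abs_two]; linarith
            _ = _ := by ring
    rw [Finset.sum_congr rfl h1, Finset.sum_comm, Finset.smul_sum]
    refine Finset.sum_congr rfl fun l _ => ?_
    rw [← Matrix.mul_sum, ← Matrix.mul_smul]
    congr 1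
    rw [iterMask_succ, subdivisionOp_eq_sum a _ _ (t.image (fun k => k - 2 ^ n * l)),
      Finset.sum_image]
    · congr 1
      refine Finset.sum_congr rfl fun k _ => ?_
      congr 2
      ring
    · intro x _ y _ h
      simpa using h
    · intro k hk
      rw [Finset.mem_image]
      refine ⟨k + 2 ^ n * l, htm _ ?_, by ring⟩
      convert hk using 2
      ring

/-- Splits off the innermost subdivision step instead of the outermost one, which puts the mask on
the left. In the limit this becomes the refinement equation, whereas the other splitting yields the
sum rules. -/
theorem iterMask_succ' (a : ℤ →₀ Matrix (Fin r) (Fin r) ℂ) (n : ℕ) (j : ℤ) :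
    iterMask a (n + 1) j = (2 : ℂ) • ∑ k ∈ a.support, a k * iterMask a n (j - 2 ^ n * k) := by
  classical
  obtain ⟨N, hN⟩ := exists_support_bound a
  have h1 : subdivisionOp a (diracId r) = fun k => (2 : ℂ) • a k := by
    ext1 k
    rw [subdivisionOp_eq_sum a _ k (insert 0 ((Finset.Icc (-(|k| + N)) (|k| + N))))]
    · rw [Finset.sum_eq_single_of_mem 0 (by simp)]
      · simp [diracId]
      · intro b _ hb
        simp [diracId, hb]
    · intro l hl
      have h1 := hN _ hl
      rw [Finset.mem_insert, Finset.mem_Icc]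
      right
      rw [abs_le] at h1
      have := abs_nonneg k
      have := neg_abs_le k
      have := le_abs_self k
      constructor <;> omega
  have hfin : ((Set.Icc (-(|j| + (2 ^ n - 1) * N)) (|j| + (2 ^ n - 1) * N) : Set ℤ)).Finite :=
    Set.finite_Icc _ _
  rw [iterMask, Function.iterate_succ_apply, h1,
    iterate_subdivisionOp_eq_sum hN _ n j (a.support ∪ hfin.toFinset)]
  · rw [Finset.smul_sum]
    symm
    apply Finset.sum_subset_zero_on_sdiff Finset.subset_union_left
    · intro x hx
      have : a x = 0 := by
        simp only [Finset.mem_sdiff, Finsupp.mem_support_iff, not_not] at hx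
        exact hx.2
      simp [this]
    · intro x _
      rw [Matrix.smul_mul]
  · intro k hk
    rw [Finset.mem_union]
    right
    rw [Set.Finite.mem_toFinset, Set.mem_Icc, ← abs_le]
    have h2 : |k| ≤ |2 ^ n * k| := by
      rw [abs_mul]
      have : (1 : ℤ) ≤ |2 ^ n| := by rw [abs_of_pos (by positivity)]; exact one_le_pow₀ (by norm_num)
      nlinarith [abs_nonneg k]
    have : |2 ^ n * k| ≤ |j| + |j - 2 ^ n * k| := by
      have := abs_sub_abs_le_abs_sub (2 ^ n * k) j
      rw [abs_sub_comm] at this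
      linarith
    linarith

/-! ### Linear structure of symbols and convolutions -/

/-- The symbol as a linear map. -/
def symbolL {E : Type*} [AddCommMonoid E] [Module ℂ E] (ξ : ℝ) : (ℤ →₀ E) →ₗ[ℂ] E :=
  Finsupp.lsum ℂ fun k => Complex.exp (-(Complex.I * (k : ℂ) * (ξ : ℂ))) • LinearMap.id

theorem symbolL_apply {E : Type*} [AddCommMonoid E] [Module ℂ E] (ξ : ℝ) (c : ℤ →₀ E) :
    symbolL ξ c = symbol c ξ := by
  rfl

@[simp] theorem symbol_single {E : Type*} [AddCommMonoid E] [Module ℂ E] (ξ : ℝ) (k : ℤ) (x : E) :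
    symbol (Finsupp.single k x) ξ = Complex.exp (-(Complex.I * (k : ℂ) * (ξ : ℂ))) • x := by
  rw [symbol, Finsupp.sum_single_index]
  simp

/-- The value at `j` of the convolution with `w`, as a linear map. -/
def convL (w : ℤ → Matrix (Fin r) (Fin r) ℂ) (j : ℤ) : (ℤ →₀ (Fin r → ℂ)) →ₗ[ℂ] (Fin r → ℂ) :=
  Finsupp.lsum ℂ fun k => (w (j - k)).mulVecLin

theorem convL_apply (w : ℤ → Matrix (Fin r) (Fin r) ℂ) (j : ℤ) (u : ℤ →₀ (Fin r → ℂ)) :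
    convL w j u = conv w u j := by
  rfl

@[simp] theorem conv_single (w : ℤ → Matrix (Fin r) (Fin r) ℂ) (j k : ℤ) (x : Fin r → ℂ) :
    conv w (Finsupp.single k x) j = w (j - k) *ᵥ x := by
  rw [conv, Finsupp.sum_single_index]
  simp

/-! ### Transition operators -/

/-- The transition operator `(T_ε u)(k) = 2 ∑ⱼ a(j) u(2k + ε - j)`. -/
def transition (a : ℤ →₀ Matrix (Fin r) (Fin r) ℂ) (ε : ℤ) :
    (ℤ →₀ (Fin r → ℂ)) →ₗ[ℂ] (ℤ →₀ (Fin r → ℂ)) :=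
  Finsupp.lsum ℂ fun l => ∑ j ∈ a.support,
    if 2 ∣ j + l - ε then Finsupp.lsingle ((j + l - ε) / 2) ∘ₗ ((2 : ℂ) • (a j).mulVecLin) else 0

theorem transition_single (a : ℤ →₀ Matrix (Fin r) (Fin r) ℂ) (ε l : ℤ) (x : Fin r → ℂ) :
    transition a ε (Finsupp.single l x) = ∑ j ∈ a.support,
      if 2 ∣ j + l - ε then Finsupp.single ((j + l - ε) / 2) ((2 : ℂ) • (a j *ᵥ x)) else 0 := by
  simp only [transition, Finsupp.lsum_single, LinearMap.sum_apply]
  refine Finset.sum_congr rfl fun j _ => ?_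
  split_ifs <;> simp

theorem transition_apply (a : ℤ →₀ Matrix (Fin r) (Fin r) ℂ) (ε : ℤ) (u : ℤ →₀ (Fin r → ℂ))
    (k : ℤ) :
    transition a ε u k = (2 : ℂ) • ∑ j ∈ a.support, a j *ᵥ u (2 * k + ε - j) := by
  induction u using Finsupp.induction_linear with
  | zero => simp
  | add f g hf hg =>
    simp [hf, hg, Matrix.mulVec_add, Finset.sum_add_distrib]
  | single l x =>
    rw [transition_single, Finsupp.finsetSum_apply, Finset.smul_sum]
    refine Finset.sum_congr rfl fun j _ => ?_
    by_cases h : l = 2 * k + ε - j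
    · have h1 : 2 ∣ j + l - ε := by omega
      have h2 : (j + l - ε) / 2 = k := by omega
      rw [if_pos h1, h2, ← h]
      simp
    · rw [Finsupp.single_eq_of_ne (by omega)]
      split_ifs with h1
      · rw [Finsupp.single_eq_of_ne (by omega)]
        simp
      · simp

/-- This is duality: refining the output once is the same as coarsening the filter `u` once, and the
parity of the position selects the transition operator. Statements about iterates thereby become
statements about products of two operators. -/
theorem conv_iterMask_succ (a : ℤ →₀ Matrix (Fin r) (Fin r) ℂ) (n : ℕ) (u : ℤ →₀ (Fin r → ℂ))
    (p ε : ℤ) :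
    conv (iterMask a (n + 1)) u (2 * p + ε) = conv (iterMask a n) (transition a ε u) p := by
  rw [← convL_apply, ← convL_apply]
  induction u using Finsupp.induction_linear with
  | zero => simp
  | add f g hf hg => simp only [map_add, hf, hg]
  | single l x =>
    rw [convL_apply, conv_single, transition_single, map_sum, iterMask_succ, subdivisionOp_apply,
      Matrix.smul_mulVec, Matrix.sum_mulVec, Finset.smul_sum]
    refine Finset.sum_congr rfl fun j _ => ?_
    by_cases h : 2 ∣ j + l - ε
    · have h1 : 2 ∣ 2 * p + ε - l - j := by omega
      have h2 : (2 * p + ε - l - j) / 2 = p - (j + l - ε) / 2 := by omega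
      rw [if_pos h, if_pos h1, convL_apply, conv_single, h2, Matrix.mulVec_smul, Matrix.mulVec_mulVec]
    · have h1 : ¬ 2 ∣ 2 * p + ε - l - j := by omega
      rw [if_neg h, if_neg h1]
      simp

@[simp] theorem conv_iterMask_zero (a : ℤ →₀ Matrix (Fin r) (Fin r) ℂ) (u : ℤ →₀ (Fin r → ℂ))
    (p : ℤ) : conv (iterMask a 0) u p = u p := by
  rw [← convL_apply]
  induction u using Finsupp.induction_linear with
  | zero => simp
  | add f g hf hg => simp only [map_add, hf, hg, Finsupp.add_apply]
  | single l x =>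
    rw [convL_apply, conv_single, Finsupp.single_apply]
    split_ifs with h
    · simp [h, iterMask, diracId]
    · have : p - l ≠ 0 := by omega
      simp [iterMask, diracId, this]

theorem symbol_eq_sum {E : Type*} [AddCommMonoid E] [Module ℂ E] (c : ℤ →₀ E) (ξ : ℝ) :
    symbol c ξ = ∑ k ∈ c.support, Complex.exp (-(Complex.I * (k : ℂ) * (ξ : ℂ))) • c k := rfl

theorem symbol_zero {E : Type*} [AddCommMonoid E] [Module ℂ E] (c : ℤ →₀ E) :
    symbol c 0 = ∑ k ∈ c.support, c k := by
  simp [symbol_eq_sum]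

theorem exp_neg_pi (k : ℤ) : Complex.exp (-(Complex.I * (k : ℂ) * (Real.pi : ℂ))) = (-1) ^ k := by
  rw [show -(Complex.I * (k : ℂ) * (Real.pi : ℂ)) = ((-k : ℤ) : ℂ) * (Real.pi * Complex.I) by
    push_cast; ring, Complex.exp_int_mul, Complex.exp_pi_mul_I, zpow_neg, ← inv_zpow]
  norm_num

/-- Keeping one residue class modulo 2 averages the values at ξ and ξ + π; the factor 2 in the
transition operator cancels the 1/2 of the average. -/
theorem symbol_transition (a : ℤ →₀ Matrix (Fin r) (Fin r) ℂ) (ε : ℤ) (u : ℤ →₀ (Fin r → ℂ))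
    (ξ : ℝ) :
    symbol (transition a ε u) (2 * ξ) = Complex.exp (Complex.I * ε * ξ) •
      (symbol a ξ *ᵥ symbol u ξ + (-1 : ℂ) ^ ε • (symbol a (ξ + Real.pi) *ᵥ symbol u (ξ + Real.pi))) := by
  simp only [← symbolL_apply]
  induction u using Finsupp.induction_linear with
  | zero => simp
  | add f g hf hg =>
    simp only [map_add, hf, hg, Matrix.mulVec_add, smul_add]
    abel
  | single l x =>
    rw [transition_single, map_sum]
    simp only [symbolL_apply, symbol_single]
    rw [symbol_eq_sum, symbol_eq_sum, Matrix.sum_mulVec, Matrix.sum_mulVec, Finset.smul_sum,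
      ← Finset.sum_add_distrib, Finset.smul_sum]
    refine Finset.sum_congr rfl fun j _ => ?_
    simp only [Matrix.mulVec_smul, Matrix.smul_mulVec, smul_smul, ← add_smul]
    have key : ∀ k : ℤ, Complex.exp (-(Complex.I * (k : ℂ) * ((ξ + Real.pi : ℝ) : ℂ))) =
        Complex.exp (-(Complex.I * (k : ℂ) * (ξ : ℂ))) * (-1) ^ k := by
      intro k
      rw [← exp_neg_pi, ← Complex.exp_add]
      congr 1
      push_cast
      ring
    rw [key, key]
    have h3 : (-1 : ℂ) ^ ε * (Complex.exp (-(Complex.I * ↑l * ↑ξ)) * (-1) ^ l *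
        (Complex.exp (-(Complex.I * ↑j * ↑ξ)) * (-1) ^ j)) =
        Complex.exp (-(Complex.I * ↑l * ↑ξ)) * Complex.exp (-(Complex.I * ↑j * ↑ξ)) *
          (-1) ^ (j + l - ε) := by
      rw [zpow_sub₀ (by norm_num), zpow_add₀ (by norm_num)]
      rcases Int.even_or_odd ε with h | h
      · rw [h.neg_one_zpow]; ring
      · rw [h.neg_one_zpow]; ring
    rw [h3]
    have h4 : Complex.exp (Complex.I * ε * ξ) * (Complex.exp (-(Complex.I * ↑l * ↑ξ)) *
        Complex.exp (-(Complex.I * ↑j * ↑ξ))) = Complex.exp (-(Complex.I * (j + l - ε) * ξ)) := by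
      rw [← Complex.exp_add, ← Complex.exp_add]
      congr 1
      ring
    by_cases h : 2 ∣ j + l - ε
    · have h5 : Even (j + l - ε) := even_iff_two_dvd.2 h
      rw [if_pos h, symbol_single, smul_smul, h5.neg_one_zpow]
      congr 1
      obtain ⟨q, hq⟩ := h
      have h6 : (j + l - ε) / 2 = q := by omega
      have h7 : ((j : ℂ) + l - ε) = 2 * q := by exact_mod_cast hq
      have h8 : ∀ z w : ℂ, z * (w + w * 1) = z * w * 2 := fun z w => by ring
      rw [h8, h4, h6, h7]
      congr 2
      push_cast
      ring
    · have h5 : Odd (j + l - ε) := by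
        rw [← Int.not_even_iff_odd, even_iff_two_dvd]; exact h
      rw [if_neg h, h5.neg_one_zpow, ← symbolL_apply, map_zero]
      simp

/-! ### Uniform exponential decay on finite-dimensional invariant spaces -/

/-- `W` embeds into a finite-dimensional normed space, so its coordinate functionals factor through
a left inverse defined on all of `F` and are therefore bounded. No norm on `E` is needed. -/
theorem exists_coordinates_of_injOn {E F : Type*} [AddCommGroup E] [Module ℂ E]
    [NormedAddCommGroup F] [NormedSpace ℂ F] [FiniteDimensional ℂ F] (W : Submodule ℂ E)
    (res : E →ₗ[ℂ] F) (hinj : ∀ u ∈ W, res u = 0 → u = 0) :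
    ∃ (d : ℕ) (b : Fin d → E) (co : Fin d → E → ℂ) (K : Fin d → ℝ), (∀ i, b i ∈ W) ∧
      (∀ i, 0 ≤ K i) ∧ ∀ u ∈ W, u = ∑ i, co i u • b i ∧ ∀ i, ‖co i u‖ ≤ K i * ‖res u‖ := by
  classical
  set res' : W →ₗ[ℂ] F := res ∘ₗ W.subtype with hres'
  have hker : LinearMap.ker res' = ⊥ := by
    rw [LinearMap.ker_eq_bot']
    intro u hu
    ext1
    exact hinj u.1 u.2 hu
  have : FiniteDimensional ℂ W := FiniteDimensional.of_injective res' (LinearMap.ker_eq_bot.1 hker)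
  let b := Module.finBasis ℂ W
  obtain ⟨g, hg⟩ := LinearMap.exists_leftInverse_of_injective res' hker
  let G : Fin (Module.finrank ℂ W) → F →L[ℂ] ℂ :=
    fun i => LinearMap.toContinuousLinearMap (b.coord i ∘ₗ g)
  refine ⟨_, fun i => (b i).1, fun i u => G i (res u), fun i => ‖G i‖, fun i => Subtype.property _,
    fun i => norm_nonneg _, fun u hu => ⟨?_, fun i => (G i).le_opNorm _⟩⟩
  have h1 : ∀ i, G i (res u) = b.repr ⟨u, hu⟩ i := by
    intro i
    have := LinearMap.congr_fun hg ⟨u, hu⟩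
    simp only [LinearMap.comp_apply, LinearMap.id_apply, hres', Submodule.subtype_apply] at this
    simp [G, this]
  simp only [h1]
  have := congrArg W.subtype (b.sum_repr ⟨u, hu⟩)
  rw [map_sum] at this
  exact this.symm

theorem exists_coordinates {W : Submodule ℂ (ℤ →₀ (Fin r → ℂ))} {R : ℕ}
    (hR : ∀ u ∈ W, ∀ k, u k ≠ 0 → |k| ≤ R) :
    ∃ (d : ℕ) (b : Fin d → ℤ →₀ (Fin r → ℂ)) (co : Fin d → (ℤ →₀ (Fin r → ℂ)) → ℂ) (K : Fin d → ℝ),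
      (∀ i, b i ∈ W) ∧ (∀ i, 0 ≤ K i) ∧ ∀ u ∈ W, u = ∑ i, co i u • b i ∧
        ∀ M : ℝ, (∀ k, ‖u k‖ ≤ M) → ∀ i, ‖co i u‖ ≤ K i * M := by
  classical
  let s := Finset.Icc (-(R : ℤ)) R
  let res : (ℤ →₀ (Fin r → ℂ)) →ₗ[ℂ] (s → Fin r → ℂ) := LinearMap.pi fun k => Finsupp.lapply k.1
  obtain ⟨d, b, co, K, hb, hK, h⟩ := exists_coordinates_of_injOn W res (by
    intro u hu hu0
    ext1 k
    by_contra h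
    have hk := hR u hu k h
    exact h (congrFun hu0 ⟨k, by simpa [s, Finset.mem_Icc, abs_le] using hk⟩))
  refine ⟨d, b, co, K, hb, hK, fun u hu => ⟨(h u hu).1, fun M hM i => ((h u hu).2 i).trans ?_⟩⟩
  have h0 : 0 ≤ M := (norm_nonneg _).trans (hM 0)
  exact mul_le_mul_of_nonneg_left ((pi_norm_le_iff_of_nonneg h0).2 fun k => hM k) (hK i)

theorem conv_iterMask_bounded (a : ℤ →₀ Matrix (Fin r) (Fin r) ℂ) (n : ℕ)
    (u : ℤ →₀ (Fin r → ℂ)) : ∃ D : ℝ, 0 ≤ D ∧ ∀ k, ‖conv (iterMask a n) u k‖ ≤ D := by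
  induction n generalizing u with
  | zero =>
    refine ⟨∑ k ∈ u.support, ‖u k‖, by positivity, fun k => ?_⟩
    rw [conv_iterMask_zero]
    by_cases h : u k = 0
    · rw [h, norm_zero]; positivity
    · exact Finset.single_le_sum (f := fun k => ‖u k‖) (fun _ _ => norm_nonneg _)
        (Finsupp.mem_support_iff.2 h)
  | succ n ih =>
    obtain ⟨D0, h0, hD0⟩ := ih (transition a 0 u)
    obtain ⟨D1, h1, hD1⟩ := ih (transition a 1 u)
    refine ⟨max D0 D1, le_max_of_le_left h0, fun k => ?_⟩
    rcases Int.even_or_odd' k with ⟨p, rfl | rfl⟩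
    · rw [← add_zero (2 * p), conv_iterMask_succ]
      exact (hD0 p).trans (le_max_left _ _)
    · rw [conv_iterMask_succ]
      exact (hD1 p).trans (le_max_right _ _)

/-- Pointwise decay on a finite-dimensional invariant space is uniform and exponential. -/
theorem conv_iterMask_decay (a : ℤ →₀ Matrix (Fin r) (Fin r) ℂ)
    (W : Submodule ℂ (ℤ →₀ (Fin r → ℂ))) (R : ℕ) (hR : ∀ u ∈ W, ∀ k, u k ≠ 0 → |k| ≤ R)
    (hT0 : ∀ u ∈ W, transition a 0 u ∈ W) (hT1 : ∀ u ∈ W, transition a 1 u ∈ W)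
    (c : ℝ) (hc : 0 < c)
    (hlim : ∀ u ∈ W, ∀ ε > 0, ∃ n₀ : ℕ, ∀ n ≥ n₀, ∀ k,
      c ^ n * ‖conv (iterMask a n) u k‖ ≤ ε) :
    ∃ C θ : ℝ, 0 ≤ C ∧ 1 / 2 < θ ∧ θ < 1 ∧ ∀ u ∈ W, ∀ M : ℝ, (∀ k, ‖u k‖ ≤ M) → ∀ n k,
      c ^ n * ‖conv (iterMask a n) u k‖ ≤ C * θ ^ n * M := by
  classical
  obtain ⟨d, b, co, K, hbW, hK0, hbK⟩ := exists_coordinates hR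
  -- Expanding in the basis turns a bound for finitely many basis sequences into one for all of `W`,
  -- at the cost of the factor κ.
  have hexp : ∀ (n : ℕ) (k : ℤ), ∀ u ∈ W, ∀ (M D : ℝ), (∀ k, ‖u k‖ ≤ M) →
      (∀ i, c ^ n * ‖conv (iterMask a n) (b i) k‖ ≤ D) →
      c ^ n * ‖conv (iterMask a n) u k‖ ≤ (∑ i, K i) * D * M := by
    intro n k u hu M D hM hD
    have hM0 : 0 ≤ M := (norm_nonneg _).trans (hM 0)
    have h1 : conv (iterMask a n) u k = ∑ i, co i u • conv (iterMask a n) (b i) k := by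
      conv_lhs => rw [(hbK u hu).1]
      rw [← convL_apply, map_sum]
      simp only [map_smul, convL_apply]
    rw [h1]
    calc c ^ n * ‖∑ i, co i u • conv (iterMask a n) (b i) k‖
        ≤ c ^ n * ∑ i, ‖co i u‖ * ‖conv (iterMask a n) (b i) k‖ := by
          gcongr
          refine (norm_sum_le _ _).trans (Finset.sum_le_sum fun i _ => ?_)
          rw [norm_smul]
      _ = ∑ i, ‖co i u‖ * (c ^ n * ‖conv (iterMask a n) (b i) k‖) := by
          rw [Finset.mul_sum]
          exact Finset.sum_congr rfl fun i _ => by ring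
      _ ≤ ∑ i, K i * M * D := by
          refine Finset.sum_le_sum fun i _ => mul_le_mul ((hbK u hu).2 M hM i) (hD i) (by positivity) ?_
          exact mul_nonneg (hK0 i) hM0
      _ = _ := by rw [Finset.sum_mul, Finset.sum_mul]; exact Finset.sum_congr rfl fun i _ => by ring
  set κ := ∑ i, K i with hκ
  have hκ0 : 0 ≤ κ := Finset.sum_nonneg fun i _ => hK0 i
  -- The tolerance is chosen so that κ times it is at most 1/2. The summand 2 in n₀ keeps n₀
  -- positive and will push θ above 1/2.
  choose n₁ hn₁ using fun i => hlim (b i) (hbW i) (1 / (2 * (κ + 1))) (by positivity)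
  set n₀ := 2 + ∑ i, n₁ i with hn₀
  have hhalf0 : ∀ u ∈ W, ∀ M : ℝ, (∀ k, ‖u k‖ ≤ M) → ∀ k,
      c ^ n₀ * ‖conv (iterMask a n₀) u k‖ ≤ M / 2 := by
    intro u hu M hM k
    have hM0 : 0 ≤ M := (norm_nonneg _).trans (hM 0)
    refine (hexp n₀ k u hu M _ hM fun i => hn₁ i n₀ ?_ k).trans ?_
    · have := Finset.single_le_sum (f := n₁) (fun _ _ => Nat.zero_le _) (Finset.mem_univ i)
      omega
    · have : κ * (1 / (2 * (κ + 1))) ≤ 1 / 2 := by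
        rw [mul_one_div, div_le_div_iff₀ (by positivity) (by norm_num)]
        linarith
      nlinarith
  -- The last m levels can be traded for m transitions, which stay in `W`; hence the weighted sup
  -- norm halves whenever the level grows by n₀, wherever one starts.
  have hhalf : ∀ m : ℕ, ∀ u ∈ W, ∀ M : ℝ, (∀ k, c ^ m * ‖conv (iterMask a m) u k‖ ≤ M) → ∀ k,
      c ^ (n₀ + m) * ‖conv (iterMask a (n₀ + m)) u k‖ ≤ M / 2 := by
    intro m
    induction m with
    | zero =>
      intro u hu M hM k
      exact hhalf0 u hu M (fun k => by simpa using hM k) k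
    | succ m ih =>
      intro u hu M hM k
      have hstep : ∀ ε : ℤ, transition a ε u ∈ W → ∀ p : ℤ,
          c ^ (n₀ + (m + 1)) * ‖conv (iterMask a (n₀ + (m + 1))) u (2 * p + ε)‖ ≤ M / 2 := by
        intro ε hε p
        have h1 := ih (transition a ε u) hε (M / c) (fun k => by
          rw [← conv_iterMask_succ, le_div_iff₀ hc]
          calc _ = c ^ (m + 1) * ‖conv (iterMask a (m + 1)) u (2 * k + ε)‖ := by ring
            _ ≤ M := hM _) p
        rw [← conv_iterMask_succ] at h1
        calc _ = c * (c ^ (n₀ + m) * ‖conv (iterMask a (n₀ + m + 1)) u (2 * p + ε)‖) := by ring_nf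
          _ ≤ c * (M / c / 2) := by gcongr
          _ = M / 2 := by field_simp
      rcases Int.even_or_odd' k with ⟨p, rfl | rfl⟩
      · rw [← add_zero (2 * p)]
        exact hstep 0 (hT0 u hu) p
      · exact hstep 1 (hT1 u hu) p
  choose D hD0 hD using fun (p : ℕ × Fin d) =>
    conv_iterMask_bounded a p.1 (b p.2)
  set E := ∑ n ∈ Finset.range n₀, ∑ i, c ^ n * D (n, i) with hE
  have hE0 : 0 ≤ E := Finset.sum_nonneg fun n _ => Finset.sum_nonneg fun i _ =>
    mul_nonneg (by positivity) (hD0 _)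
  have hn2 : (2 : ℝ) ≤ n₀ := by
    have : 2 ≤ n₀ := by omega
    exact_mod_cast this
  set θ : ℝ := 1 - 1 / (2 * n₀) with hθ
  have hq : 1 / (2 * (n₀ : ℝ)) ≤ 1 / 4 := by
    rw [div_le_div_iff₀ (by positivity) (by norm_num)]
    linarith
  have hq0 : 0 < 1 / (2 * (n₀ : ℝ)) := by positivity
  -- Bernoulli's inequality for θ = 1 - 1/(2n₀) gives θ^{n₀} ≥ 1/2, so halving every n₀ levels is no
  -- slower than θⁿ. The factor 2 in the constant below absorbs θⁿ ≥ 1/2 for n < n₀.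
  have hθ1 : θ < 1 := by linarith
  have hθ0 : 1 / 2 < θ := by linarith
  have hθn : 1 / 2 ≤ θ ^ n₀ := by
    have := one_add_mul_le_pow (a := -(1 / (2 * (n₀ : ℝ)))) (by linarith) n₀
    have h3 : (n₀ : ℝ) * -(1 / (2 * (n₀ : ℝ))) = -(1 / 2) := by field_simp
    rw [h3] at this
    calc (1 / 2 : ℝ) = 1 + -(1 / 2) := by norm_num
      _ ≤ _ := this
      _ = θ ^ n₀ := by rw [hθ, sub_eq_add_neg]
  refine ⟨2 * (κ * E), θ, by positivity, hθ0, hθ1, fun u hu M hM n => ?_⟩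
  have hM0 : 0 ≤ M := (norm_nonneg _).trans (hM 0)
  induction n using Nat.strong_induction_on with
  | _ n ih =>
    intro k
    rcases lt_or_ge n n₀ with h | h
    · have h1 : c ^ n * ‖conv (iterMask a n) u k‖ ≤ κ * E * M := by
        refine hexp n k u hu M _ hM fun i => ?_
        calc c ^ n * ‖conv (iterMask a n) (b i) k‖ ≤ c ^ n * D (n, i) := by
              gcongr; exact hD (n, i) k
          _ ≤ ∑ i, c ^ n * D (n, i) := Finset.single_le_sum (f := fun i => c ^ n * D (n, i))
              (fun i _ => mul_nonneg (by positivity) (hD0 _)) (Finset.mem_univ i)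
          _ ≤ E := Finset.single_le_sum (f := fun n => ∑ i, c ^ n * D (n, i))
              (fun n _ => Finset.sum_nonneg fun i _ => mul_nonneg (by positivity) (hD0 _))
              (Finset.mem_range.2 h)
      have h2 : 1 / 2 ≤ θ ^ n :=
        hθn.trans (pow_le_pow_of_le_one (by linarith) hθ1.le h.le)
      have h3 : 0 ≤ κ * E * M := by positivity
      nlinarith
    · obtain ⟨m, rfl⟩ := Nat.exists_eq_add_of_le h
      have h1 := hhalf m u hu _ (fun k => ih m (by omega) k) k
      have h3 : 0 ≤ κ * E * θ ^ m * M := by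
        have : 0 ≤ θ := by linarith
        positivity
      rw [pow_add θ]
      nlinarith

open scoped ContDiff

/-! ### Tempered distributions on the line: seminorm bounds and supports -/

theorem exists_seminorm_bound (T : 𝓢'(ℝ, ℂ)) : ∃ (s : Finset (ℕ × ℕ)) (C : ℝ), 0 ≤ C ∧
    ∀ (F : 𝓢(ℝ, ℂ)) (B : ℝ), (∀ p ∈ s, ∀ x, |x| ^ p.1 * ‖iteratedDeriv p.2 F x‖ ≤ B) →
      ‖T F‖ ≤ C * B := by
  let q : Seminorm ℂ 𝓢(ℝ, ℂ) := (normSeminorm ℂ ℂ).comp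
    ((T : 𝓢(ℝ, ℂ) →L[ℂ] ℂ) : 𝓢(ℝ, ℂ) →ₗ[ℂ] ℂ)
  have hq : Continuous q := by
    have : (q : 𝓢(ℝ, ℂ) → ℝ) = fun F => ‖(T : 𝓢(ℝ, ℂ) →L[ℂ] ℂ) F‖ := rfl
    rw [this]
    exact ((T : 𝓢(ℝ, ℂ) →L[ℂ] ℂ).continuous).norm
  obtain ⟨s, C, -, hC⟩ := Seminorm.bound_of_continuous (schwartz_withSeminorms ℂ ℝ ℂ) q hq
  -- The index (0, 0) is added so that the assumed bounds force B ≥ 0 even when s is empty.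
  classical
  refine ⟨insert (0, 0) s, C, C.2, fun F B hB => ?_⟩
  have hB0 : 0 ≤ B := le_trans (by positivity) (hB (0, 0) (Finset.mem_insert_self _ _) 0)
  refine (hC F).trans ?_
  rw [smul_apply, NNReal.smul_def, smul_eq_mul]
  refine mul_le_mul_of_nonneg_left ?_ C.2
  refine Seminorm.finset_sup_apply_le hB0 fun p hp => ?_
  exact SchwartzMap.seminorm_le_bound' ℂ p.1 p.2 F hB0 (hB p (Finset.mem_insert_of_mem hp))

theorem norm_iteratedDeriv_mul_le {f g : ℝ → ℂ} (hf : ContDiff ℝ ∞ f) (hg : ContDiff ℝ ∞ g)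
    (n : ℕ) (x : ℝ) : ‖iteratedDeriv n (fun y => f y * g y) x‖ ≤
      ∑ i ∈ Finset.range (n + 1), n.choose i * ‖iteratedDeriv i f x‖ * ‖iteratedDeriv (n - i) g x‖ := by
  have := iteratedDeriv_mul (n := n) (x := x) (f := f) (g := g)
    ((hf.of_le (by exact_mod_cast le_top)).contDiffAt) ((hg.of_le (by exact_mod_cast le_top)).contDiffAt)
  rw [show (fun y => f y * g y) = f * g from rfl, this]
  refine (norm_sum_le _ _).trans (Finset.sum_le_sum fun i _ => ?_)
  simp [mul_assoc]

/-- The complex-valued cutoff function. -/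
abbrev ccutoff (n : ℕ) (x : ℝ) : ℂ := ((cutoff n x : ℝ) : ℂ)

theorem ccutoff_contDiff (n : ℕ) : ContDiff ℝ ∞ (ccutoff n) :=
  Complex.ofRealCLM.contDiff.comp (cutoff n).contDiff

theorem ccutoff_hasCompactSupport (n : ℕ) : HasCompactSupport (ccutoff n) :=
  (cutoff n).hasCompactSupport.comp_left (g := fun t : ℝ => (t : ℂ)) rfl

theorem ccutoff_eq_one {n : ℕ} {x : ℝ} (hx : |x| ≤ n + 1) : ccutoff n x = 1 := by
  have : cutoff n x = 1 := (cutoff n).one_of_mem_closedBall (by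
    rw [mem_closedBall_zero_iff, Real.norm_eq_abs]; exact hx)
  simp [ccutoff, this]

theorem ccutoff_eq_zero {n : ℕ} {x : ℝ} (hx : n + 2 ≤ |x|) : ccutoff n x = 0 := by
  have : cutoff n x = 0 := (cutoff n).zero_of_le_dist (by
    rw [dist_zero_right, Real.norm_eq_abs]; exact hx)
  simp [ccutoff, this]

theorem tsupport_ccutoff_subset (n : ℕ) : tsupport (ccutoff n) ⊆ Metric.closedBall 0 (n + 2) := by
  refine (tsupport_comp_subset (g := fun t : ℝ => (t : ℂ)) rfl _).trans ?_
  rw [(cutoff n).tsupport_eq]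
  exact le_rfl

theorem exists_ccutoff_deriv_bound (n i : ℕ) : ∃ D : ℝ, 0 ≤ D ∧
    (∀ x, ‖iteratedDeriv i (ccutoff n) x‖ ≤ D) ∧
    ∀ x : ℝ, n + 2 < |x| → iteratedDeriv i (ccutoff n) x = 0 := by
  have h1 : Continuous fun x => iteratedDeriv i (ccutoff n) x :=
    (ccutoff_contDiff n).continuous_iteratedDeriv i (by exact_mod_cast le_top)
  have h0 : ∀ x : ℝ, n + 2 < |x| → iteratedDeriv i (ccutoff n) x = 0 := by
    intro x hx
    have : iteratedFDeriv ℝ i (ccutoff n) x = 0 := by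
      by_contra h
      have := tsupport_ccutoff_subset n (support_iteratedFDeriv_subset (𝕜 := ℝ) i h)
      rw [mem_closedBall_zero_iff, Real.norm_eq_abs] at this
      linarith
    rw [← norm_eq_zero, ← norm_iteratedFDeriv_eq_norm_iteratedDeriv, this, norm_zero]
  have h2 : HasCompactSupport fun x => iteratedDeriv i (ccutoff n) x :=
    HasCompactSupport.of_support_subset_isCompact (isCompact_closedBall (0 : ℝ) (n + 2)) (by
      intro x hx
      rw [mem_closedBall_zero_iff, Real.norm_eq_abs]
      by_contra h
      exact hx (h0 x (not_le.1 h)))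
  obtain ⟨D, hD⟩ := h2.exists_bound_of_continuous h1
  exact ⟨D, (norm_nonneg _).trans (hD 0), hD, h0⟩

/-- A distribution applied to `χₙ h` is controlled by finitely many derivatives of `h` on the
support of `χₙ`. -/
theorem exists_cutoff_bound (T : 𝓢'(ℝ, ℂ)) (n : ℕ) : ∃ (N : ℕ) (C : ℝ), 0 ≤ C ∧
    ∀ (h : ℝ → ℂ), ContDiff ℝ ∞ h → ∀ F : 𝓢(ℝ, ℂ), (∀ x, F x = ccutoff n x * h x) → ∀ B : ℝ,
      (∀ j ≤ N, ∀ x : ℝ, |x| ≤ n + 2 → ‖iteratedDeriv j h x‖ ≤ B) → ‖T F‖ ≤ C * B := by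
  obtain ⟨s, C, hC0, hC⟩ := exists_seminorm_bound T
  choose D hD0 hD hD' using exists_ccutoff_deriv_bound n
  set E := ∑ p ∈ s, ((n : ℝ) + 2) ^ p.1 * ∑ i ∈ Finset.range (p.2 + 1), p.2.choose i * D i with hE
  have hterm : ∀ p : ℕ × ℕ,
      0 ≤ ((n : ℝ) + 2) ^ p.1 * ∑ i ∈ Finset.range (p.2 + 1), p.2.choose i * D i := fun p =>
    mul_nonneg (by positivity) (Finset.sum_nonneg fun i _ => mul_nonneg (by positivity) (hD0 i))
  refine ⟨s.sup Prod.snd, C * E, mul_nonneg hC0 (Finset.sum_nonneg fun p _ => hterm p),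
    fun h hh F hF B hB => ?_⟩
  have hB0 : 0 ≤ B := (norm_nonneg _).trans (hB 0 (Nat.zero_le _) 0 (by simp; positivity))
  rw [mul_assoc]
  refine hC F (E * B) fun p hp x => ?_
  have hFe : (F : ℝ → ℂ) = fun y => ccutoff n y * h y := funext hF
  rw [hFe]
  have h1 := norm_iteratedDeriv_mul_le (ccutoff_contDiff n) hh p.2 x
  by_cases hx : |x| ≤ n + 2
  · calc |x| ^ p.1 * ‖iteratedDeriv p.2 (fun y => ccutoff n y * h y) x‖
        ≤ ((n : ℝ) + 2) ^ p.1 * ∑ i ∈ Finset.range (p.2 + 1), p.2.choose i * D i * B := by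
          refine mul_le_mul (pow_le_pow_left₀ (abs_nonneg _) hx _) (h1.trans ?_) (norm_nonneg _)
            (by positivity)
          refine Finset.sum_le_sum fun i _ => ?_
          refine mul_le_mul (mul_le_mul_of_nonneg_left (hD i x) (by positivity)) ?_ (norm_nonneg _)
            (mul_nonneg (by positivity) (hD0 i))
          exact hB _ ((Nat.sub_le _ _).trans (Finset.le_sup (f := Prod.snd) hp)) x hx
      _ = (((n : ℝ) + 2) ^ p.1 * ∑ i ∈ Finset.range (p.2 + 1), p.2.choose i * D i) * B := by
          rw [← Finset.sum_mul, mul_assoc]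
      _ ≤ E * B := mul_le_mul_of_nonneg_right (Finset.single_le_sum
          (f := fun p : ℕ × ℕ => ((n : ℝ) + 2) ^ p.1 *
            ∑ i ∈ Finset.range (p.2 + 1), p.2.choose i * D i) (fun p _ => hterm p) hp) hB0
  · have h2 : ‖iteratedDeriv p.2 (fun y => ccutoff n y * h y) x‖ ≤ 0 := by
      refine h1.trans (le_of_eq (Finset.sum_eq_zero fun i _ => ?_))
      rw [hD' i x (not_le.1 hx)]
      simp
    have h3 := le_antisymm h2 (norm_nonneg _)
    rw [h3, mul_zero]
    exact mul_nonneg (Finset.sum_nonneg fun p _ => hterm p) hB0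

/-- A tempered distribution vanishes at a Schwartz function if it vanishes at all its compactly
supported truncations. -/
theorem eq_zero_of_compactSupport (T : 𝓢'(ℝ, ℂ)) (F : 𝓢(ℝ, ℂ))
    (h : ∀ G : 𝓢(ℝ, ℂ), HasCompactSupport G → tsupport G ⊆ tsupport F → T G = 0) : T F = 0 := by
  obtain ⟨s, C, hC0, hC⟩ := exists_seminorm_bound T
  choose D hD0 hD hD' using exists_ccutoff_deriv_bound 0
  set E : ℕ × ℕ → ℝ := fun p => SchwartzMap.seminorm ℂ (p.1 + 1) p.2 F +
    ∑ i ∈ Finset.range p.2, p.2.choose (i + 1) * D (i + 1) * SchwartzMap.seminorm ℂ p.1 (p.2 - (i + 1)) F with hE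
  have hE0 : ∀ p, 0 ≤ E p := fun p => add_nonneg (apply_nonneg _ _)
    (Finset.sum_nonneg fun i _ => mul_nonneg (mul_nonneg (by positivity) (hD0 _)) (apply_nonneg _ _))
  -- Truncation at scale R costs O(1/R) in every seminorm: 1 - χ(x/R) is at most |x|/R, paid for by
  -- one more power of x, and each derivative of the cutoff brings at least one factor 1/R.
  have key : ∀ R : ℝ, 1 ≤ R → ‖T F‖ ≤ C * ((∑ p ∈ s, E p) / R) := by
    intro R hR
    have hR0 : 0 < R := by linarith
    have hcd : ContDiff ℝ ∞ fun x : ℝ => ccutoff 0 (R⁻¹ * x) :=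
      (ccutoff_contDiff 0).comp (contDiff_const.mul contDiff_id)
    have hGs : HasCompactSupport fun x : ℝ => ccutoff 0 (R⁻¹ * x) * F x := by
      refine HasCompactSupport.mul_right ?_
      exact (ccutoff_hasCompactSupport 0).comp_homeomorph (Homeomorph.mulLeft₀ R⁻¹ (by positivity))
    set G := HasCompactSupport.toSchwartzMap hGs (hcd.mul (F.smooth ⊤)) with hG
    have hTG : T G = 0 := h G hGs (tsupport_mul_subset_right (f := fun x : ℝ => ccutoff 0 (R⁻¹ * x)))
    have h1 : T F = T (F - G) := by rw [map_sub, hTG, sub_zero]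
    rw [h1]
    refine hC _ _ fun p hp x => ?_
    set g : ℝ → ℂ := fun x => 1 - ccutoff 0 x with hg
    have hgd : ContDiff ℝ ∞ g := contDiff_const.sub (ccutoff_contDiff 0)
    have hFG : ((F - G : 𝓢(ℝ, ℂ)) : ℝ → ℂ) = fun y => g (R⁻¹ • y) * F y := by
      ext1 y
      change F y - ccutoff 0 (R⁻¹ * y) * F y = _
      simp only [hg, smul_eq_mul]
      ring
    have hgR : ContDiff ℝ ∞ fun y : ℝ => g (R⁻¹ • y) := hgd.comp (contDiff_const_smul R⁻¹)
    rw [hFG]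
    have h2 := norm_iteratedDeriv_mul_le hgR (F.smooth ⊤) p.2 x
    have h3 : ∀ i : ℕ, iteratedDeriv i (fun y : ℝ => g (R⁻¹ • y)) x =
        R⁻¹ ^ i • iteratedDeriv i g (R⁻¹ • x) := by
      intro i
      have := congrFun (iteratedDeriv_comp_const_smul (n := i) (hgd.of_le (by exact_mod_cast le_top))
        R⁻¹) x
      simpa only [smul_eq_mul] using this
    have h4 : ‖g (R⁻¹ • x)‖ ≤ |x| / R := by
      rw [hg]
      simp only [smul_eq_mul]
      by_cases hx : |R⁻¹ * x| ≤ 1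
      · rw [ccutoff_eq_one (by simpa using hx)]
        simp; positivity
      · have : ‖1 - ccutoff 0 (R⁻¹ * x)‖ ≤ 1 := by
          rw [← Complex.ofReal_one, ← Complex.ofReal_sub, Complex.norm_real, Real.norm_eq_abs, abs_le]
          have := (cutoff 0).nonneg (x := R⁻¹ * x)
          have := (cutoff 0).le_one (x := R⁻¹ * x)
          constructor <;> linarith
        rw [abs_mul, abs_of_pos (by positivity : 0 < R⁻¹)] at hx
        rw [div_eq_inv_mul]
        linarith
    have h5 : ∀ i : ℕ, ‖iteratedDeriv (i + 1) (fun y : ℝ => g (R⁻¹ • y)) x‖ ≤ D (i + 1) / R := by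
      intro i
      have h6 : ‖iteratedDeriv (i + 1) g (R⁻¹ • x)‖ ≤ D (i + 1) := by
        rw [hg, iteratedDeriv_const_sub (Nat.succ_pos i), iteratedDeriv_neg, norm_neg]
        exact hD _ _
      rw [h3, norm_smul, norm_pow, Real.norm_of_nonneg (by positivity : 0 ≤ R⁻¹), div_eq_inv_mul]
      refine mul_le_mul ?_ h6 (norm_nonneg _) (by positivity)
      rw [pow_succ]
      exact mul_le_of_le_one_left (by positivity) (pow_le_one₀ (by positivity) (inv_le_one_of_one_le₀ hR))
    rw [Finset.sum_range_succ'] at h2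
    simp only [Nat.choose_zero_right, Nat.cast_one, one_mul, iteratedDeriv_zero, Nat.sub_zero] at h2
    calc |x| ^ p.1 * ‖iteratedDeriv p.2 (fun y => g (R⁻¹ • y) * F y) x‖
        ≤ |x| ^ p.1 * (∑ i ∈ Finset.range p.2, p.2.choose (i + 1) * (D (i + 1) / R) *
            ‖iteratedDeriv (p.2 - (i + 1)) F x‖ + |x| / R * ‖iteratedDeriv p.2 F x‖) := by
          refine mul_le_mul_of_nonneg_left (h2.trans ?_) (by positivity)
          refine add_le_add (Finset.sum_le_sum fun i _ => ?_) ?_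
          · exact mul_le_mul_of_nonneg_right (mul_le_mul_of_nonneg_left (h5 i) (by positivity))
              (norm_nonneg _)
          · exact mul_le_mul_of_nonneg_right h4 (norm_nonneg _)
      _ = (|x| ^ (p.1 + 1) * ‖iteratedDeriv p.2 F x‖ + ∑ i ∈ Finset.range p.2,
            p.2.choose (i + 1) * D (i + 1) * (|x| ^ p.1 * ‖iteratedDeriv (p.2 - (i + 1)) F x‖)) / R := by
          rw [mul_add, add_div, Finset.mul_sum, Finset.sum_div, add_comm]
          congr 1
          · ring
          · exact Finset.sum_congr rfl fun i _ => by ring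
      _ ≤ E p / R := by
          refine div_le_div_of_nonneg_right (add_le_add (F.le_seminorm' ℂ _ _ x) ?_) hR0.le
          refine Finset.sum_le_sum fun i _ => ?_
          exact mul_le_mul_of_nonneg_left (F.le_seminorm' ℂ _ _ x)
            (mul_nonneg (by positivity) (hD0 _))
      _ ≤ (∑ p ∈ s, E p) / R :=
          div_le_div_of_nonneg_right (Finset.single_le_sum (fun p _ => hE0 p) hp) hR0.le
  have hlim : Filter.Tendsto (fun R : ℝ => C * ((∑ p ∈ s, E p) / R)) Filter.atTop (nhds 0) := by
    have := (tendsto_const_nhds (x := ∑ p ∈ s, E p)).div_atTop Filter.tendsto_id (l := Filter.atTop)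
    simpa using this.const_mul C
  have := ge_of_tendsto hlim (Filter.eventually_atTop.2 ⟨1, fun R hR => key R hR⟩)
  exact norm_le_zero_iff.1 this

/-- The complement of the support is the union of the open sets on which `T` vanishes. Compactness
leaves finitely many of them, and a smooth partition of unity splits `F` into pieces that `T` kills.
-/
theorem eq_zero_of_tsupport_disjoint_dsupport (T : 𝓢'(ℝ, ℂ)) (F : 𝓢(ℝ, ℂ))
    (hFc : HasCompactSupport F) (hF : tsupport F ⊆ (Distribution.dsupport T)ᶜ) : T F = 0 := by
  classical
  rw [Distribution.dsupport_compl_eq, Set.sUnion_eq_iUnion] at hF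
  obtain ⟨t, ht⟩ := IsCompact.elim_finite_subcover hFc.isCompact
    (fun i : {s : Set ℝ | Distribution.IsVanishingOn T s ∧ IsOpen s} => i.1)
    (fun i => i.2.2) hF
  obtain ⟨f, hf⟩ := SmoothPartitionOfUnity.exists_isSubordinate (modelWithCornersSelf ℝ ℝ)
    (isClosed_tsupport F) (fun i : t => i.1.1) (fun i => i.1.2.2) (by
      exact ht.trans (Set.iUnion₂_subset fun i hi => Set.subset_iUnion (fun i : t => i.1.1) ⟨i, hi⟩))
  have hcd : ∀ i, ContDiff ℝ ∞ fun x => ((f i x : ℝ) : ℂ) := fun i =>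
    Complex.ofRealCLM.contDiff.comp (f i).contMDiff.contDiff
  let G : t → 𝓢(ℝ, ℂ) := fun i => HasCompactSupport.toSchwartzMap
    (f := fun x => ((f i x : ℝ) : ℂ) * F x) hFc.mul_left ((hcd i).mul (F.smooth ⊤))
  have hG : F = ∑ i, G i := by
    ext x
    have h1 : (∑ i, G i) x = ∑ i, ((f i x : ℝ) : ℂ) * F x := by
      rw [sum_apply]
      rfl
    rw [h1, ← Finset.sum_mul]
    by_cases hx : x ∈ tsupport F
    · have h2 := f.sum_eq_one hx
      rw [finsum_eq_sum_of_fintype] at h2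
      rw [← Complex.ofReal_sum, h2]
      simp
    · rw [image_eq_zero_of_notMem_tsupport hx, mul_zero]
  rw [hG, map_sum]
  refine Finset.sum_eq_zero fun i _ => i.1.2.1 _ ?_
  have h3 : tsupport (fun x => ((f i x : ℝ) : ℂ)) ⊆ i.1.1 :=
    (tsupport_comp_subset (g := fun t : ℝ => (t : ℂ)) rfl _).trans (hf i)
  exact (tsupport_mul_subset_left (f := fun x => ((f i x : ℝ) : ℂ)) (g := F)).trans h3

/-- `T` vanishes at all Schwartz functions that vanish on `(-(n + 1), n + 1)`. -/
def VanishesOff (T : 𝓢'(ℝ, ℂ)) (n : ℕ) : Prop :=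
  ∀ F : 𝓢(ℝ, ℂ), (∀ x : ℝ, |x| < n + 1 → F x = 0) → T F = 0

theorem VanishesOff.mono {T : 𝓢'(ℝ, ℂ)} {n m : ℕ} (h : VanishesOff T n) (hnm : n ≤ m) :
    VanishesOff T m := by
  intro F hF
  refine h F fun x hx => hF x (hx.trans_le ?_)
  have : (n : ℝ) ≤ m := by exact_mod_cast hnm
  linarith

theorem VanishesOff.sub {T S : 𝓢'(ℝ, ℂ)} {n : ℕ} (hT : VanishesOff T n) (hS : VanishesOff S n) :
    VanishesOff (T - S) n := by
  intro F hF
  change T F - S F = 0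
  rw [hT F hF, hS F hF, sub_zero]

/-- Turns compactness of the support into the working form used below. A function vanishing on a
larger interval has support disjoint from that of `T`, but need not have compact support, hence the
detour through truncations. -/
theorem exists_vanishesOff {T : 𝓢'(ℝ, ℂ)} (hT : IsCompact (Distribution.dsupport T)) :
    ∃ n, VanishesOff T n := by
  obtain ⟨R, hR⟩ := hT.isBounded.subset_closedBall 0
  obtain ⟨n, hn⟩ := exists_nat_gt R
  refine ⟨n, fun F hF => eq_zero_of_compactSupport T F fun G hG hGF =>
    eq_zero_of_tsupport_disjoint_dsupport T G hG (hGF.trans ?_)⟩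
  intro x hx hxT
  have h1 := hR hxT
  rw [mem_closedBall_zero_iff, Real.norm_eq_abs] at h1
  have h2 : tsupport F ⊆ {x : ℝ | |x| < n + 1}ᶜ := by
    refine closure_minimal ?_ (isOpen_lt continuous_abs continuous_const).isClosed_compl
    intro y hy hy'
    exact hy (hF y hy')
  exact h2 hx (by change |x| < n + 1; linarith)

/-! ### Fourier transforms of compactly supported distributions -/

theorem cutoffExp_apply (n : ℕ) (ξ x : ℝ) :
    cutoffExp n ξ x = ccutoff n x * Complex.exp (-(Complex.I * x * ξ)) := rfl

theorem VanishesOff.distFourier_eq {T : 𝓢'(ℝ, ℂ)} {n : ℕ} (hT : VanishesOff T n) (ξ : ℝ) :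
    distFourier T ξ = T (cutoffExp n ξ) := by
  refine Filter.Tendsto.limUnder_eq (tendsto_const_nhds.congr' ?_)
  filter_upwards [Filter.eventually_ge_atTop n] with m hm
  rw [← sub_eq_zero, ← map_sub]
  refine hT _ fun x hx => ?_
  change cutoffExp n ξ x - cutoffExp m ξ x = 0
  have : (n : ℝ) ≤ m := by exact_mod_cast hm
  rw [cutoffExp_apply, cutoffExp_apply, ccutoff_eq_one hx.le, ccutoff_eq_one (by linarith), sub_self]

theorem distFourier_sub {T S : 𝓢'(ℝ, ℂ)} {n : ℕ} (hT : VanishesOff T n) (hS : VanishesOff S n)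
    (ξ : ℝ) : distFourier (T - S) ξ = distFourier T ξ - distFourier S ξ := by
  rw [(hT.sub hS).distFourier_eq, hT.distFourier_eq, hS.distFourier_eq]
  rfl

theorem contDiff_cexp_mul (c : ℂ) : ContDiff ℝ ∞ fun x : ℝ => Complex.exp (c * x) :=
  Complex.contDiff_exp.comp (contDiff_const.mul Complex.ofRealCLM.contDiff)

theorem iteratedDeriv_cexp_mul (c : ℂ) (j : ℕ) :
    iteratedDeriv j (fun x : ℝ => Complex.exp (c * x)) = fun x : ℝ => c ^ j * Complex.exp (c * x) := by
  induction j with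
  | zero => simp
  | succ j ih =>
    rw [iteratedDeriv_succ, ih]
    ext1 x
    have h1 : HasDerivAt (fun x : ℝ => Complex.exp (c * x)) (Complex.exp (c * x) * (c * 1)) x :=
      ((Complex.ofRealCLM.hasDerivAt (x := x)).const_mul c).cexp
    rw [(h1.const_mul (c ^ j)).deriv]
    ring

/-- The Fourier transform of a compactly supported distribution is continuous at `0`. -/
theorem VanishesOff.tendsto_distFourier {T : 𝓢'(ℝ, ℂ)} {n : ℕ} (hT : VanishesOff T n) :
    Filter.Tendsto (distFourier T) (nhds 0) (nhds (distFourier T 0)) := by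
  obtain ⟨N, C, hC0, hC⟩ := exists_cutoff_bound T n
  rw [tendsto_iff_norm_sub_tendsto_zero]
  -- On |x| ≤ n + 2 and for |ξ| < 1, the function e^{-ixξ} - 1 is at most (n + 2)|ξ| and its
  -- derivatives are at most |ξ|; n + 3 covers both.
  have hb : ∀ᶠ ξ : ℝ in nhds 0, ‖distFourier T ξ - distFourier T 0‖ ≤ C * ((n + 3) * |ξ|) := by
    have : ∀ᶠ ξ : ℝ in nhds 0, |ξ| < 1 := by
      have := Metric.ball_mem_nhds (0 : ℝ) one_pos
      filter_upwards [this] with ξ hξ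
      simpa using hξ
    filter_upwards [this] with ξ hξ
    rw [hT.distFourier_eq, hT.distFourier_eq, ← map_sub]
    have hcd := contDiff_cexp_mul (-(Complex.I * ξ))
    refine hC (fun x : ℝ => Complex.exp (-(Complex.I * ξ) * x) - 1) (hcd.sub contDiff_const) _ ?_ _ ?_
    · intro x
      change cutoffExp n ξ x - cutoffExp n 0 x = _
      rw [cutoffExp_apply, cutoffExp_apply, mul_sub]
      simp only [Complex.ofReal_zero, mul_zero, neg_zero, Complex.exp_zero, mul_one]
      congr 3
      ring
    · intro j _ x hx
      have hn : (0 : ℝ) ≤ n := by positivity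
      rcases j with _ | j
      · rw [iteratedDeriv_zero]
        have h1 : -(Complex.I * ξ) * x = Complex.I * ((-(ξ * x) : ℝ) : ℂ) := by push_cast; ring
        rw [h1]
        refine (Real.norm_exp_I_mul_ofReal_sub_one_le).trans ?_
        rw [Real.norm_eq_abs, abs_neg, abs_mul]
        nlinarith [abs_nonneg ξ]
      · have h2 : iteratedDeriv (j + 1) (fun x : ℝ => Complex.exp (-(Complex.I * ξ) * x) - 1) x =
            iteratedDeriv (j + 1) (fun x : ℝ => Complex.exp (-(Complex.I * ξ) * x)) x := by
          rw [iteratedDeriv_succ', iteratedDeriv_succ']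
          congr 1
          ext1 y
          simp
        rw [h2, iteratedDeriv_cexp_mul, norm_mul, norm_pow, norm_neg, norm_mul, Complex.norm_I,
          one_mul, Complex.norm_real, Real.norm_eq_abs]
        have h3 : ‖Complex.exp (-(Complex.I * ξ) * x)‖ = 1 := by
          have h1 : -(Complex.I * ξ) * x = ((-(ξ * x) : ℝ) : ℂ) * Complex.I := by push_cast; ring
          rw [h1, Complex.norm_exp_ofReal_mul_I]
        rw [h3, mul_one, pow_succ]
        have := pow_le_one₀ (n := j) (abs_nonneg ξ) hξ.le
        nlinarith [abs_nonneg ξ, mul_nonneg hn (abs_nonneg ξ)]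
  refine squeeze_zero' (Filter.Eventually.of_forall fun _ => norm_nonneg _) hb ?_
  have : Continuous fun ξ : ℝ => C * ((n + 3) * |ξ|) := by fun_prop
  have := this.tendsto 0
  simpa using this

theorem norm_cexp_mul_I_mul (t x : ℝ) : ‖Complex.exp (t * Complex.I * x)‖ = 1 := by
  have h1 : (t * Complex.I * x : ℂ) = ((t * x : ℝ) : ℂ) * Complex.I := by push_cast; ring
  rw [h1, Complex.norm_exp_ofReal_mul_I]

/-- A compactly supported smooth function is, on a given interval, the sum of a rapidly convergent
Fourier series. -/
theorem exists_fourierSeries (f : 𝓢(ℝ, ℂ)) (n : ℕ) (hf : ∀ x : ℝ, (n : ℝ) ≤ |x| → f x = 0) :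
    ∃ (c : ℤ → ℂ) (t : ℤ → ℝ), (∀ j : ℕ, Summable fun k => ‖c k‖ * |t k| ^ j) ∧
      ∀ x : ℝ, |x| ≤ n + 1 → f x = ∑' k, c k * Complex.exp (t k * Complex.I * x) := by
  -- With this period, the translates of |x| ≤ n + 1 by nonzero multiples of L miss the interior of
  -- the support of f, so only one term of the periodisation survives in Poisson's formula.
  set L : ℝ := 2 * n + 2 with hL
  have hL1 : 1 ≤ L := by
    have : (0 : ℝ) ≤ n := by positivity
    linarith
  have hL0 : L ≠ 0 := by linarith
  set g : 𝓢(ℝ, ℂ) := SchwartzMap.compCLMOfContinuousLinearEquiv ℂ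
    (ContinuousLinearEquiv.unitsEquivAut ℝ (Units.mk0 L hL0)) f with hg
  have hgx : ∀ x, g x = f (x * L) := fun x => rfl
  refine ⟨fun k => FourierTransform.fourier g (k : ℝ), fun k => 2 * Real.pi * k / L, fun j => ?_, fun x hx => ?_⟩
  · set C := SchwartzMap.seminorm ℂ (j + 2) 0 (FourierTransform.fourier g) with hC
    have h1 : Summable fun k : ℤ => (2 * Real.pi) ^ j * C * (1 / (k : ℝ) ^ 2) :=
      (Real.summable_one_div_int_pow.2 one_lt_two).mul_left _
    refine Summable.of_norm_bounded_eventually h1 ?_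
    have h0 : ∀ᶠ k : ℤ in Filter.cofinite, k ≠ 0 := Filter.eventually_cofinite_ne 0
    filter_upwards [h0] with k hk
    have hk' : (0 : ℝ) < |(k : ℝ)| := abs_pos.2 (by exact_mod_cast hk)
    have h2 := SchwartzMap.le_seminorm' ℂ (j + 2) 0 (FourierTransform.fourier g) (k : ℝ)
    rw [iteratedDeriv_zero] at h2
    rw [Real.norm_of_nonneg (by positivity), abs_div, abs_mul, abs_of_pos Real.two_pi_pos,
      abs_of_pos (by linarith : 0 < L)]
    have h3 : (2 * Real.pi * |(k : ℝ)| / L) ^ j ≤ (2 * Real.pi * |(k : ℝ)|) ^ j :=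
      pow_le_pow_left₀ (by positivity) (div_le_self (by positivity) hL1) _
    rw [← sq_abs (k : ℝ), mul_one_div, le_div_iff₀ (by positivity)]
    calc ‖FourierTransform.fourier g (k : ℝ)‖ * (2 * Real.pi * |(k : ℝ)| / L) ^ j * |(k : ℝ)| ^ 2
        ≤ ‖FourierTransform.fourier g (k : ℝ)‖ * (2 * Real.pi * |(k : ℝ)|) ^ j * |(k : ℝ)| ^ 2 := by
          gcongr
      _ = (2 * Real.pi) ^ j * (|(k : ℝ)| ^ (j + 2) * ‖FourierTransform.fourier g (k : ℝ)‖) := by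
          rw [mul_pow]; ring
      _ ≤ _ := by gcongr
  · have h1 := SchwartzMap.tsum_eq_tsum_fourier g (x / L)
    rw [tsum_eq_single 0] at h1
    · rw [hgx, Int.cast_zero, add_zero, div_mul_cancel₀ _ hL0] at h1
      rw [h1]
      refine tsum_congr fun k => ?_
      rw [fourier_coe_apply]
      congr 2
      push_cast
      ring
    · intro k hk
      rw [hgx]
      refine hf _ ?_
      rw [add_mul, div_mul_cancel₀ _ hL0]
      have hk' : (1 : ℝ) ≤ |(k : ℝ)| := by exact_mod_cast Int.one_le_abs hk
      have h3 : L ≤ |(k : ℝ) * L| := by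
        rw [abs_mul, abs_of_pos (by linarith : 0 < L)]
        nlinarith
      have h4 := abs_sub_abs_le_abs_sub ((k : ℝ) * L) (-x)
      rw [abs_neg, sub_neg_eq_add, add_comm _ x] at h4
      linarith

/-- A compactly supported distribution is determined by its Fourier transform. -/
theorem VanishesOff.eq_zero {T : 𝓢'(ℝ, ℂ)} {n : ℕ} (hT : VanishesOff T n)
    (h : ∀ ξ, distFourier T ξ = 0) : T = 0 := by
  ext g
  change T g = 0
  set f : 𝓢(ℝ, ℂ) := HasCompactSupport.toSchwartzMap (f := fun x => ccutoff n x * g x)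
    (ccutoff_hasCompactSupport n).mul_right ((ccutoff_contDiff n).mul (g.smooth ⊤)) with hf
  have hfx : ∀ x, f x = ccutoff n x * g x := fun x => rfl
  have hTf : T g = T f := by
    rw [← sub_eq_zero, ← map_sub]
    refine hT _ fun x hx => ?_
    change g x - f x = 0
    rw [hfx, ccutoff_eq_one hx.le, one_mul, sub_self]
  rw [hTf]
  -- The series represents f on |x| ≤ n + 3, exactly where the cutoff of index n + 1 lives, and that
  -- cutoff equals 1 on the support |x| ≤ n + 2 of f.
  obtain ⟨c, t, hct, hfc⟩ := exists_fourierSeries f (n + 2) (fun x hx => by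
    rw [hfx, ccutoff_eq_zero (by exact_mod_cast hx), zero_mul])
  obtain ⟨N, C, hC0, hC⟩ := exists_cutoff_bound T (n + 1)
  have hc0 : Summable fun k => ‖c k‖ := by simpa using hct 0
  -- By hypothesis `T` kills every localized exponential, so any finite partial sum of the series
  -- may be subtracted; only the tail contributes, together with finitely many of its derivatives.
  have key : ∀ S : Finset ℤ, ‖T f‖ ≤
      C * ∑ j ∈ Finset.range (N + 1), ∑' k : {k // k ∉ S}, ‖c k‖ * |t k| ^ j := by
    intro S
    have hterm : ∀ (k : {k // k ∉ S}), ContDiff ℝ ∞ fun x : ℝ =>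
        c k * Complex.exp (t k * Complex.I * x) := fun k => contDiff_const.mul (contDiff_cexp_mul _)
    have hsum : ∀ j : ℕ, Summable fun k : {k // k ∉ S} => ‖c k‖ * |t k| ^ j := fun j =>
      (hct j).subtype _
    have hbound : ∀ (j : ℕ) (k : {k // k ∉ S}) (x : ℝ), (j : ℕ∞) ≤ ⊤ → ‖iteratedFDeriv ℝ j
        (fun x : ℝ => c k * Complex.exp (t k * Complex.I * x)) x‖ ≤ ‖c k‖ * |t k| ^ j := by
      intro j k x _
      rw [norm_iteratedFDeriv_eq_norm_iteratedDeriv, iteratedDeriv_const_mul_field,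
        iteratedDeriv_cexp_mul, norm_mul, norm_mul, norm_pow, norm_mul, Complex.norm_I, mul_one,
        norm_cexp_mul_I_mul, mul_one, Complex.norm_real, Real.norm_eq_abs]
    have hF := hC (fun x => ∑' k : {k // k ∉ S}, c k * Complex.exp (t k * Complex.I * x))
      (contDiff_tsum hterm (fun j _ => hsum j) hbound)
      (f - ∑ k ∈ S, c k • cutoffExp (n + 1) (-t k)) (fun x => ?_)
      (∑ j ∈ Finset.range (N + 1), ∑' k : {k // k ∉ S}, ‖c k‖ * |t k| ^ j) (fun j hj x _ => ?_)
    · have hz : T (∑ k ∈ S, c k • cutoffExp (n + 1) (-t k)) = 0 := by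
        rw [map_sum]
        refine Finset.sum_eq_zero fun k _ => ?_
        rw [map_smul, ← (hT.mono n.le_succ).distFourier_eq, h, smul_zero]
      rwa [map_sub, hz, sub_zero] at hF
    · have h1 : (f - ∑ k ∈ S, c k • cutoffExp (n + 1) (-t k)) x =
          f x - ∑ k ∈ S, c k * cutoffExp (n + 1) (-t k) x := by
        rw [sub_apply, sum_apply]
        rfl
      rw [h1]
      have h2 : ∀ k, cutoffExp (n + 1) (-t k) x =
          ccutoff (n + 1) x * Complex.exp (t k * Complex.I * x) := by
        intro k
        rw [cutoffExp_apply]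
        congr 2
        push_cast
        ring
      simp only [h2]
      by_cases hx : |x| ≤ (n + 2 : ℕ) + 1
      · have hs : Summable fun k => c k * Complex.exp (t k * Complex.I * x) := by
          refine Summable.of_norm_bounded hc0 fun k => ?_
          rw [norm_mul, norm_cexp_mul_I_mul, mul_one]
        have h3 : f x = ccutoff (n + 1) x * f x := by
          by_cases hx' : |x| ≤ n + 2
          · rw [ccutoff_eq_one (by push_cast; linarith), one_mul]
          · rw [hfx, ccutoff_eq_zero (n := n) (by linarith)]
            ring
        rw [h3, hfc x hx, ← hs.sum_add_tsum_compl (s := S), mul_add, Finset.mul_sum]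
        have h4 : ∑ k ∈ S, c k * (ccutoff (n + 1) x * Complex.exp (t k * Complex.I * x)) =
            ∑ k ∈ S, ccutoff (n + 1) x * (c k * Complex.exp (t k * Complex.I * x)) :=
          Finset.sum_congr rfl fun k _ => by ring
        rw [h4, add_sub_cancel_left]
        rfl
      · rw [ccutoff_eq_zero (n := n + 1) (by push_cast at hx ⊢; linarith), hfx,
          ccutoff_eq_zero (n := n) (by push_cast at hx; linarith)]
        simp
    · rw [← norm_iteratedFDeriv_eq_norm_iteratedDeriv,
        iteratedFDeriv_tsum_apply hterm (fun j _ => hsum j) hbound le_top]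
      have h5 : Summable fun k : {k // k ∉ S} => ‖iteratedFDeriv ℝ j
          (fun x : ℝ => c k * Complex.exp (t k * Complex.I * x)) x‖ :=
        Summable.of_nonneg_of_le (fun _ => norm_nonneg _) (fun k => hbound j k x le_top) (hsum j)
      refine (norm_tsum_le_tsum_norm h5).trans ?_
      refine (h5.tsum_le_tsum (fun k => hbound j k x le_top) (hsum j)).trans ?_
      exact Finset.single_le_sum (f := fun j => ∑' k : {k // k ∉ S}, ‖c k‖ * |t k| ^ j)
        (fun j _ => tsum_nonneg fun k => by positivity) (Finset.mem_range.2 (by omega))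
  have hlim : Filter.Tendsto (fun S : Finset ℤ =>
      C * ∑ j ∈ Finset.range (N + 1), ∑' k : {k // k ∉ S}, ‖c k‖ * |t k| ^ j) Filter.atTop
      (nhds (C * ∑ j ∈ Finset.range (N + 1), 0)) :=
    (tendsto_finsetSum _ fun j _ =>
      tendsto_tsum_compl_atTop_zero fun k => ‖c k‖ * |t k| ^ j).const_mul C
  have := ge_of_tendsto' hlim key
  simpa using this

/-! ### Bounded functions as distributions -/

open MeasureTheory

theorem toTemperedDistribution_toLp_apply {f : ℝ → ℂ} (hf : MemLp f ∞ volume) (g : 𝓢(ℝ, ℂ)) :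
    Lp.toTemperedDistribution (hf.toLp f) g = ∫ x, g x * f x := by
  rw [Lp.toTemperedDistribution_apply]
  refine integral_congr_ae ?_
  filter_upwards [hf.coeFn_toLp] with x hx
  rw [hx, smul_eq_mul]

theorem vanishesOff_toTemperedDistribution {f : ℝ → ℂ} (hf : MemLp f ∞ volume) {n : ℕ}
    (h : ∀ x : ℝ, n + 1 ≤ |x| → f x = 0) :
    VanishesOff (Lp.toTemperedDistribution (hf.toLp f)) n := by
  intro F hF
  rw [toTemperedDistribution_toLp_apply]
  refine integral_eq_zero_of_ae (Filter.Eventually.of_forall fun x => ?_)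
  change F x * f x = 0
  rcases lt_or_ge |x| (n + 1) with hx | hx
  · rw [hF x hx, zero_mul]
  · rw [h x hx, mul_zero]

theorem distFourier_toTemperedDistribution {f : ℝ → ℂ} (hf : MemLp f ∞ volume) {n : ℕ}
    (h : ∀ x : ℝ, n + 1 ≤ |x| → f x = 0) (ξ : ℝ) :
    distFourier (Lp.toTemperedDistribution (hf.toLp f)) ξ =
      ∫ x : ℝ, Complex.exp (-(Complex.I * x * ξ)) * f x := by
  rw [(vanishesOff_toTemperedDistribution hf h).distFourier_eq, toTemperedDistribution_toLp_apply]
  refine integral_congr_ae (Filter.Eventually.of_forall fun x => ?_)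
  change cutoffExp n ξ x * f x = _ * f x
  rcases lt_or_ge |x| (n + 1) with hx | hx
  · rw [cutoffExp_apply, ccutoff_eq_one hx.le, one_mul]
  · rw [h x hx, mul_zero, mul_zero]

/-- A continuous function that defines a compactly supported distribution has compact support. -/
theorem VanishesOff.eq_zero_of_continuous {f : ℝ → ℂ} (hf : MemLp f ∞ volume) (hfc : Continuous f)
    {n : ℕ} (h : VanishesOff (Lp.toTemperedDistribution (hf.toLp f)) n) {x : ℝ}
    (hx : n + 1 ≤ |x|) : f x = 0 := by
  set U : Set ℝ := {x : ℝ | (n : ℝ) + 1 < |x|} with hU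
  have hUo : IsOpen U := isOpen_lt continuous_const continuous_abs
  have h1 : ∀ᵐ x, x ∈ U → f x = 0 := by
    refine hUo.ae_eq_zero_of_integral_contDiff_smul_eq_zero
      (hfc.locallyIntegrable.locallyIntegrableOn U) fun g hg hgc hgU => ?_
    have h2 := h (HasCompactSupport.toSchwartzMap (f := fun x => (g x : ℂ))
      (hgc.comp_left (g := fun t : ℝ => (t : ℂ)) rfl) (Complex.ofRealCLM.contDiff.comp hg)) ?_
    · rw [toTemperedDistribution_toLp_apply] at h2
      rw [← h2]
      rfl
    · intro y hy
      change (g y : ℂ) = 0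
      have : y ∉ tsupport g := fun hy' => absurd (hgU hy') (not_lt.2 hy.le)
      rw [image_eq_zero_of_notMem_tsupport this, Complex.ofReal_zero]
  have h3 : Set.EqOn f 0 U := by
    have h4 : f =ᵐ[volume.restrict U] 0 := (ae_restrict_iff' hUo.measurableSet).2 h1
    exact Measure.eqOn_open_of_ae_eq h4 hUo hfc.continuousOn continuousOn_const
  have h5 : Set.EqOn f 0 (closure U) := h3.closure hfc continuous_const
  refine h5 ?_
  rcases le_total 0 x with h0 | h0
  · rw [abs_of_nonneg h0] at hx
    have : Set.Ioi ((n : ℝ) + 1) ⊆ U := fun y hy => lt_of_lt_of_le hy (le_abs_self y)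
    refine closure_mono this ?_
    rw [closure_Ioi]
    exact hx
  · rw [abs_of_nonpos h0] at hx
    have : Set.Iio (-((n : ℝ) + 1)) ⊆ U := fun y hy =>
      lt_of_lt_of_le (lt_neg_of_lt_neg hy) (neg_le_abs y)
    refine closure_mono this ?_
    rw [closure_Iio]
    exact le_neg_of_le_neg hx

/-- A compactly supported continuous function is determined by its Fourier transform. -/
theorem eq_zero_of_integral_cexp_eq_zero {f : ℝ → ℂ} (hf : Continuous f) (hc : HasCompactSupport f)
    (h : ∀ ξ : ℝ, ∫ x : ℝ, Complex.exp (-(Complex.I * x * ξ)) * f x = 0) : f = 0 := by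
  have h1 : FourierTransform.fourier f = 0 := by
    ext1 ξ
    rw [Real.fourier_real_eq_integral_exp_smul, Pi.zero_apply, ← h (2 * Real.pi * ξ)]
    refine integral_congr_ae (Filter.Eventually.of_forall fun x => ?_)
    simp only [smul_eq_mul]
    congr 2
    push_cast
    ring
  have h2 := hf.fourierInv_fourier_eq (hf.integrable_of_hasCompactSupport hc)
    (by rw [h1]; exact integrable_zero _ _ _)
  rw [← h2, h1]
  ext x
  simp [Real.fourierInv_eq]

/-! ### Regular representatives of Lipschitz and Sobolev functions -/

/-- A function in `Lip(τ, L_∞)` with `τ > 0` agrees almost everywhere with a continuous function. -/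
theorem MemLip.exists_continuous {f : ℝ → ℂ} (hf : AEStronglyMeasurable f volume) {τ : ℝ}
    (hτ : 0 < τ) (h : MemLip τ f) : ∃ g : ℝ → ℂ, Continuous g ∧ f =ᵐ[volume] g := by
  obtain ⟨C, hC0, hC⟩ := h
  set f₀ := hf.mk f with hf₀
  have hmeas : Measurable f₀ := hf.stronglyMeasurable_mk.measurable
  have hff : f =ᵐ[volume] f₀ := hf.ae_eq_mk
  have h1 : ∀ t : ℝ, ∀ᵐ x : ℝ, ‖f₀ x - f₀ (x - t)‖ ≤ C * |t| ^ τ := by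
    intro t
    have h2 : ∀ᵐ x : ℝ, f (x - t) = f₀ (x - t) :=
      (measurePreserving_sub_right volume t).quasiMeasurePreserving.ae hff
    have h3 := ae_le_eLpNormEssSup (f := fun x => f x - f (x - t)) (μ := volume)
    rw [← eLpNorm_exponent_top] at h3
    filter_upwards [hff, h2, h3] with x hx hx' hx''
    have h4 := hx''.trans (hC t)
    rw [hx, hx', ← ofReal_norm] at h4
    exact (ENNReal.ofReal_le_ofReal_iff (by positivity)).1 h4
  -- Fubini exchanges the quantifiers: almost every x satisfies the estimate for almost every t.
  -- These x form the dense set S.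
  have h2 : ∀ᵐ x : ℝ, ∀ᵐ t : ℝ, ‖f₀ x - f₀ (x - t)‖ ≤ C * |t| ^ τ := by
    refine (Measure.ae_ae_comm ?_).1 (Filter.Eventually.of_forall h1)
    refine measurableSet_le ?_ ?_
    · exact ((hmeas.comp measurable_snd).sub
        (hmeas.comp (measurable_snd.sub measurable_fst))).norm
    · have : Continuous fun p : ℝ × ℝ => C * |p.1| ^ τ :=
        continuous_const.mul (continuous_fst.abs.rpow_const fun _ => Or.inr hτ.le)
      exact this.measurable
  set S : Set ℝ := {x | ∀ᵐ t : ℝ, ‖f₀ x - f₀ (x - t)‖ ≤ C * |t| ^ τ} with hS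
  have hSd : Dense S := Measure.dense_of_ae h2
  have h3 : ∀ x ∈ S, ∀ᵐ y : ℝ, ‖f₀ x - f₀ y‖ ≤ C * |x - y| ^ τ := by
    intro x hx
    have := (Measure.measurePreserving_sub_left volume x).quasiMeasurePreserving.ae hx
    simpa only [sub_sub_cancel] using this
  have h4 : ∀ x ∈ S, ∀ y ∈ S, ‖f₀ x - f₀ y‖ ≤ C * |y - x| ^ τ := by
    intro x hx y hy
    -- Two points of S are compared through a common z. Almost every z is admissible and the
    -- condition on z is closed, so z = x is admissible too, where the first term vanishes because τ
    -- > 0.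
    have h5 : Dense {z : ℝ | ‖f₀ x - f₀ y‖ ≤ C * |x - z| ^ τ + C * |y - z| ^ τ} := by
      refine Measure.dense_of_ae (μ := volume) ?_
      filter_upwards [h3 x hx, h3 y hy] with z hz hz'
      have := norm_sub_le (f₀ x - f₀ z) (f₀ y - f₀ z)
      rw [sub_sub_sub_cancel_right] at this
      linarith
    have hcont : ∀ w : ℝ, Continuous fun z : ℝ => C * |w - z| ^ τ := fun w =>
      continuous_const.mul ((continuous_const.sub continuous_id).abs.rpow_const fun _ => Or.inr hτ.le)
    have h6 : IsClosed {z : ℝ | ‖f₀ x - f₀ y‖ ≤ C * |x - z| ^ τ + C * |y - z| ^ τ} :=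
      isClosed_le continuous_const ((hcont x).add (hcont y))
    have h7 : x ∈ closure {z : ℝ | ‖f₀ x - f₀ y‖ ≤ C * |x - z| ^ τ + C * |y - z| ^ τ} := h5 x
    rw [h6.closure_eq] at h7
    simpa [Real.zero_rpow hτ.ne'] using h7
  have h5 : UniformContinuous fun x : S => f₀ x := by
    rw [Metric.uniformContinuous_iff]
    intro ε hε
    have h6 : Filter.Tendsto (fun t : ℝ => C * |t| ^ τ) (nhds 0) (nhds 0) := by
      have : Continuous fun t : ℝ => C * |t| ^ τ :=
        continuous_const.mul (continuous_abs.rpow_const fun _ => Or.inr hτ.le)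
      simpa [Real.zero_rpow hτ.ne'] using this.tendsto 0
    obtain ⟨δ, hδ, hδ'⟩ := Metric.eventually_nhds_iff.1 (h6.eventually (gt_mem_nhds hε))
    refine ⟨δ, hδ, fun x y hxy => ?_⟩
    rw [dist_eq_norm]
    refine (h4 x x.2 y y.2).trans_lt (hδ' ?_)
    rw [Real.dist_eq, sub_zero, abs_sub_comm]
    exact hxy
  refine ⟨hSd.extend fun x : S => f₀ x, (hSd.uniformContinuous_extend h5).continuous, ?_⟩
  filter_upwards [hff, h2] with x hx hxS
  rw [hx]
  exact (hSd.extend_eq h5.continuous ⟨x, hxS⟩).symm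

/-- An absolutely continuous function whose derivative agrees almost everywhere with a continuous
function is continuously differentiable. -/
theorem hasDerivAt_of_absolutelyContinuous {u w : ℝ → ℂ}
    (hu : ∀ x y : ℝ, AbsolutelyContinuousOnInterval u x y) (hw : Continuous w)
    (h : deriv u =ᵐ[volume] w) (x : ℝ) : HasDerivAt u (w x) x := by
  set W : ℝ → ℂ := fun x => ∫ t in (0 : ℝ)..x, w t with hW
  have hWd : ∀ x, HasDerivAt W (w x) x := fun x => hw.integral_hasStrictDerivAt 0 x |>.hasDerivAt
  have hWc : ContDiff ℝ 1 W := by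
    rw [contDiff_one_iff_deriv]
    refine ⟨fun x => (hWd x).differentiableAt, ?_⟩
    have : deriv W = w := funext fun x => (hWd x).deriv
    rwa [this]
  have key : ∀ y : ℝ, u y - W y = u 0 := by
    intro y
    obtain ⟨c, hc⟩ := ((hu 0 y).sub
      hWc.contDiffOn.absolutelyContinuousOnInterval).const_of_ae_hasDerivAt_zero (by
        filter_upwards [(hu 0 y).boundedVariationOn.ae_differentiableAt_of_mem_uIcc, h]
          with z hz hz' hzm
        have := (hz hzm).hasDerivAt.sub (hWd z)
        rwa [hz', sub_self] at this)
    have h1 := hc y Set.right_mem_uIcc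
    have h2 := hc 0 Set.left_mem_uIcc
    simp only [Pi.sub_apply] at h1 h2
    rw [h1, ← h2]
    simp [hW]
  have : u = fun y => W y + u 0 := by
    funext y
    rw [← key y]
    ring
  rw [this]
  exact (hWd x).add_const _

theorem continuous_of_absolutelyContinuous {u : ℝ → ℂ}
    (hu : ∀ x y : ℝ, AbsolutelyContinuousOnInterval u x y) : Continuous u := by
  rw [continuous_iff_continuousAt]
  intro x
  have h := (hu (x - 1) (x + 1)).continuousOn
  rw [Set.uIcc_of_le (by linarith)] at h
  exact h.continuousAt (Icc_mem_nhds (by linarith) (by linarith))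

/-- Since τ < 1, the hypothesis forces m ≤ n, and τ > 0 when m = n, so the top derivative needed has
a continuous representative. For n ≥ 1 the function is already absolutely continuous and need not be
changed; only for n = 0 is it replaced. -/
theorem MemSobolev.exists_contDiff {f : ℝ → ℂ} {n m : ℕ} {τ : ℝ} (hf : MemSobolev n f)
    (hfτ : MemLip τ (iteratedDeriv n f)) (hτ1 : τ < 1) (hm : (m : ℝ) < n + τ) :
    ∃ g : ℝ → ℂ, ContDiff ℝ m g ∧ f =ᵐ[volume] g := by
  have hmn : m ≤ n := by
    have : (m : ℝ) < n + 1 := by linarith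
    exact Nat.lt_succ_iff.1 (by exact_mod_cast this)
  have hAC : ∀ j < n, Continuous (iteratedDeriv j f) := fun j hj =>
    continuous_of_absolutelyContinuous (hf.1 j hj)
  have hlast : m = n → ∃ w : ℝ → ℂ, Continuous w ∧ iteratedDeriv n f =ᵐ[volume] w := by
    rintro rfl
    exact hfτ.exists_continuous (hf.2 m le_rfl).1 (by linarith)
  rcases Nat.eq_zero_or_pos n with rfl | hn
  · obtain rfl : m = 0 := by omega
    obtain ⟨w, hw, hfw⟩ := hlast rfl
    exact ⟨w, by simpa [contDiff_zero] using hw, by simpa using hfw⟩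
  · refine ⟨f, ?_, Filter.EventuallyEq.rfl⟩
    have hcont : ∀ j ≤ m, Continuous (iteratedDeriv j f) := by
      intro j hj
      rcases lt_or_eq_of_le (hj.trans hmn) with h1 | h1
      · exact hAC j h1
      · obtain ⟨w, hw, hfw⟩ := hlast (by omega)
        obtain ⟨i, rfl⟩ : ∃ i, n = i + 1 := ⟨n - 1, by omega⟩
        rw [iteratedDeriv_succ] at hfw
        have h2 : iteratedDeriv (i + 1) f = w := by
          rw [iteratedDeriv_succ]
          exact funext fun x =>
            (hasDerivAt_of_absolutelyContinuous (hf.1 i (Nat.lt_succ_self i)) hw hfw x).deriv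
        rw [h1, h2]
        exact hw
    have := (contDiff_iff_iteratedDeriv (𝕜 := ℝ) (f := f) (n := (m : ℕ∞))).2
      ⟨fun j hj => hcont j (by exact_mod_cast hj), fun j hj => ?_⟩
    · simpa using this
    · have hj' : j < m := by exact_mod_cast hj
      have h3 := hcont (j + 1) hj'
      have h4 := hasDerivAt_of_absolutelyContinuous (hf.1 j (hj'.trans_le hmn)) h3
        (by rw [iteratedDeriv_succ])
      exact fun x => (h4 x).differentiableAt

theorem exists_contDiff_of_lt_smFun {f : ℝ → ℂ} {m : ℕ} (h : ((m : ℝ) : EReal) < smFun f) :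
    ∃ g : ℝ → ℂ, ContDiff ℝ m g ∧ f =ᵐ[volume] g := by
  obtain ⟨s, ⟨n, τ, -, h1, hS, hL, rfl⟩, hs⟩ := lt_sSup_iff.1 h
  exact hS.exists_contDiff hL h1 (by exact_mod_cast hs)

theorem exists_contDiff_of_lt_smDist {T : 𝓢'(ℝ, ℂ)} {m : ℕ} (h : ((m : ℝ) : EReal) < smDist T) :
    ∃ (g : ℝ → ℂ) (hg : MemLp g ∞ volume), ContDiff ℝ m g ∧
      Lp.toTemperedDistribution (hg.toLp g) = T := by
  simp only [smDist, lt_iSup_iff] at h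
  obtain ⟨f, hf, hfT, h⟩ := h
  obtain ⟨g, hg, hfg⟩ := exists_contDiff_of_lt_smFun h
  refine ⟨g, (memLp_congr_ae hfg).1 hf, hg, ?_⟩
  rw [← hfT]
  congr 1
  exact (MemLp.toLp_eq_toLp_iff _ _).2 hfg.symm

theorem memLp_top_of_hasCompactSupport {f : ℝ → ℂ} (hf : Continuous f) (hc : HasCompactSupport f) :
    MemLp f ∞ volume := by
  obtain ⟨C, hC⟩ := hf.bounded_above_of_compact_support hc
  exact memLp_top_of_bound hf.aestronglyMeasurable C (Filter.Eventually.of_forall hC)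

theorem hasCompactSupport_iteratedDeriv {f : ℝ → ℂ} (hc : HasCompactSupport f) (j : ℕ) :
    HasCompactSupport (iteratedDeriv j f) := by
  induction j with
  | zero => simpa using hc
  | succ j ih =>
    rw [iteratedDeriv_succ]
    exact ih.deriv

theorem lt_smDist_of_holder {f : ℝ → ℂ} {m : ℕ} (hf : ContDiff ℝ m f) (hc : HasCompactSupport f)
    {C τ : ℝ} (hτ0 : 0 < τ) (hτ1 : τ < 1) (hC : 0 ≤ C)
    (h : ∀ x y, ‖iteratedDeriv m f x - iteratedDeriv m f y‖ ≤ C * |x - y| ^ τ) :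
    ((m : ℝ) : EReal) < smDist
      (Lp.toTemperedDistribution ((memLp_top_of_hasCompactSupport hf.continuous hc).toLp f)) := by
  have h1 : (((m : ℝ) + τ : ℝ) : EReal) ≤ smFun f := by
    refine le_sSup ⟨m, τ, hτ0.le, hτ1, ⟨fun j hj x y => ?_, fun j hj => ?_⟩,
      ⟨C + 1, by linarith, fun t => ?_⟩, rfl⟩
    · refine ContDiffOn.absolutelyContinuousOnInterval (ContDiff.contDiffOn ?_)
      rw [contDiff_one_iff_deriv]
      refine ⟨hf.differentiable_iteratedDeriv j (by exact_mod_cast hj), ?_⟩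
      rw [← iteratedDeriv_succ]
      exact hf.continuous_iteratedDeriv (j + 1) (by exact_mod_cast hj)
    · exact memLp_top_of_hasCompactSupport (hf.continuous_iteratedDeriv j (by exact_mod_cast hj))
        (hasCompactSupport_iteratedDeriv hc j)
    · rw [eLpNorm_exponent_top]
      refine eLpNormEssSup_le_of_ae_bound (Filter.Eventually.of_forall fun x => ?_)
      refine (h x (x - t)).trans ?_
      rw [sub_sub_cancel]
      have : 0 ≤ |t| ^ τ := by positivity
      nlinarith
  refine lt_of_lt_of_le (lt_of_lt_of_le ?_ h1)
    (le_iSup_of_le f (le_iSup_of_le _ (le_iSup_of_le rfl le_rfl)))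
  exact_mod_cast (by linarith : (m : ℝ) < m + τ)

/-! ### Taylor agreement of symbols at the origin -/

theorem natCast_le_infty (j : ℕ) : (j : ℕ∞ω) ≤ ((⊤ : ℕ∞) : ℕ∞ω) := by exact_mod_cast le_top

theorem contDiff_cexp_neg (k : ℤ) (c : ℂ) :
    ContDiff ℝ ∞ fun ξ : ℝ => Complex.exp (-(Complex.I * (k : ℂ) * ((ξ : ℂ) + c))) :=
  Complex.contDiff_exp.comp
    (contDiff_const.mul (Complex.ofRealCLM.contDiff.add contDiff_const)).neg

theorem contDiff_symbol_apply (u : ℤ →₀ (Fin r → ℂ)) (i : Fin r) :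
    ContDiff ℝ ∞ fun ξ => symbol u ξ i := by
  have : (fun ξ => symbol u ξ i) = fun ξ : ℝ => ∑ k ∈ u.support,
      Complex.exp (-(Complex.I * (k : ℂ) * ((ξ : ℂ) + 0))) * u k i := by
    ext ξ
    simp [symbol_eq_sum, Finset.sum_apply]
  rw [this]
  exact ContDiff.sum fun k _ => (contDiff_cexp_neg k 0).mul contDiff_const

theorem contDiff_symbol_matrix_apply (a : ℤ →₀ Matrix (Fin r) (Fin r) ℂ) (i j : Fin r) :
    ContDiff ℝ ∞ fun ξ => symbol a ξ i j := by
  have : (fun ξ => symbol a ξ i j) = fun ξ : ℝ => ∑ k ∈ a.support,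
      Complex.exp (-(Complex.I * (k : ℂ) * ((ξ : ℂ) + 0))) * a k i j := by
    ext ξ
    simp [symbol_eq_sum, Matrix.sum_apply]
  rw [this]
  exact ContDiff.sum fun k _ => (contDiff_cexp_neg k 0).mul contDiff_const

theorem contDiff_two_mul {f : ℝ → ℂ} (hf : ContDiff ℝ ∞ f) : ContDiff ℝ ∞ fun ξ => f (2 * ξ) :=
  hf.comp (contDiff_const.mul contDiff_id)

theorem contDiff_add_const {f : ℝ → ℂ} (hf : ContDiff ℝ ∞ f) (c : ℝ) :
    ContDiff ℝ ∞ fun ξ => f (ξ + c) :=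
  hf.comp (contDiff_id.add contDiff_const)

theorem contDiff_dotProduct {f g : ℝ → Fin r → ℂ} (hf : ∀ i, ContDiff ℝ ∞ fun ξ => f ξ i)
    (hg : ∀ i, ContDiff ℝ ∞ fun ξ => g ξ i) : ContDiff ℝ ∞ fun ξ => f ξ ⬝ᵥ g ξ :=
  ContDiff.sum fun i _ => (hf i).mul (hg i)

theorem AgreeToOrder.mul {k : ℕ} {f g h : ℝ → ℂ} (hf : ContDiff ℝ ∞ f) (hg : ContDiff ℝ ∞ g)
    (hh : ContDiff ℝ ∞ h) (hfg : AgreeToOrder k f g) :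
    AgreeToOrder k (fun ξ => h ξ * f ξ) (fun ξ => h ξ * g ξ) := by
  intro j hj
  have hj' := natCast_le_infty j
  rw [iteratedDeriv_fun_mul (hh.of_le hj').contDiffAt (hf.of_le hj').contDiffAt,
    iteratedDeriv_fun_mul (hh.of_le hj').contDiffAt (hg.of_le hj').contDiffAt]
  refine Finset.sum_congr rfl fun i _ => ?_
  rw [hfg (j - i) (by omega)]

theorem AgreeToOrder.add {k : ℕ} {f g f' g' : ℝ → ℂ} (hf : ContDiff ℝ ∞ f) (hg : ContDiff ℝ ∞ g)
    (hf' : ContDiff ℝ ∞ f') (hg' : ContDiff ℝ ∞ g') (hfg : AgreeToOrder k f g)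
    (hfg' : AgreeToOrder k f' g') :
    AgreeToOrder k (fun ξ => f ξ + f' ξ) (fun ξ => g ξ + g' ξ) := by
  intro j hj
  have hj' := natCast_le_infty j
  rw [iteratedDeriv_fun_add (hf.of_le hj').contDiffAt (hf'.of_le hj').contDiffAt,
    iteratedDeriv_fun_add (hg.of_le hj').contDiffAt (hg'.of_le hj').contDiffAt, hfg j hj, hfg' j hj]

theorem iteratedDeriv_apply {f : ℝ → Fin r → ℂ} (hf : ∀ i, ContDiff ℝ ∞ fun ξ => f ξ i) (j : ℕ)
    (x : ℝ) (i : Fin r) : iteratedDeriv j f x i = iteratedDeriv j (fun ξ => f ξ i) x := by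
  induction j generalizing x with
  | zero => simp
  | succ j ih =>
    have h1 : ContDiff ℝ ∞ f := contDiff_pi.2 hf
    have h2 : DifferentiableAt ℝ (iteratedDeriv j f) x :=
      (h1.differentiable_iteratedDeriv j (by exact_mod_cast WithTop.coe_lt_top j)) x
    rw [iteratedDeriv_succ, iteratedDeriv_succ]
    have h3 : iteratedDeriv j (fun ξ => f ξ i) = fun y => iteratedDeriv j f y i :=
      funext fun y => (ih y).symm
    rw [h3]
    exact ((hasDerivAt_pi.1 h2.hasDerivAt i).deriv).symm

theorem AgreeToOrder.dotProduct {k : ℕ} {f g h : ℝ → Fin r → ℂ}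
    (hf : ∀ i, ContDiff ℝ ∞ fun ξ => f ξ i) (hg : ∀ i, ContDiff ℝ ∞ fun ξ => g ξ i)
    (hh : ∀ i, ContDiff ℝ ∞ fun ξ => h ξ i) (hfg : AgreeToOrder k f g) :
    AgreeToOrder k (fun ξ => f ξ ⬝ᵥ h ξ) (fun ξ => g ξ ⬝ᵥ h ξ) := by
  intro j hj
  have hj' := natCast_le_infty j
  unfold _root_.dotProduct
  rw [iteratedDeriv_fun_sum fun i _ => (((hf i).mul (hh i)).of_le hj').contDiffAt,
    iteratedDeriv_fun_sum fun i _ => (((hg i).mul (hh i)).of_le hj').contDiffAt]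
  refine Finset.sum_congr rfl fun i _ => ?_
  simp only [mul_comm _ (h _ i)]
  refine AgreeToOrder.mul (hf i) (hg i) (hh i) (fun l hl => ?_) j hj
  rw [← iteratedDeriv_apply hf, ← iteratedDeriv_apply hg, hfg l hl]

/-! ### Moments and sum rules -/

/-- The product `v̂ û` of the symbols of a sequence of rows and a sequence of columns. -/
def pairing (v u : ℤ →₀ (Fin r → ℂ)) (ξ : ℝ) : ℂ := symbol v ξ ⬝ᵥ symbol u ξ

theorem contDiff_pairing (v u : ℤ →₀ (Fin r → ℂ)) : ContDiff ℝ ∞ (pairing v u) :=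
  contDiff_dotProduct (contDiff_symbol_apply v) (contDiff_symbol_apply u)

/-- The linear functional `u ↦ (v̂ û)^{(j)}(0)`. -/
def momentL (v : ℤ →₀ (Fin r → ℂ)) (j : ℕ) : (ℤ →₀ (Fin r → ℂ)) →ₗ[ℂ] ℂ where
  toFun u := iteratedDeriv j (pairing v u) 0
  map_add' u w := by
    have hj' := natCast_le_infty j
    rw [← iteratedDeriv_add ((contDiff_pairing v u).of_le hj').contDiffAt
      ((contDiff_pairing v w).of_le hj').contDiffAt]
    congr 1
    ext ξ
    simp only [pairing, Pi.add_apply, ← symbolL_apply, map_add, dotProduct_add]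
  map_smul' c u := by
    rw [RingHom.id_apply, ← iteratedDeriv_const_smul_field]
    congr 1
    ext ξ
    simp only [pairing, Pi.smul_apply, ← symbolL_apply, map_smul, dotProduct_smul]

theorem momentL_apply (v u : ℤ →₀ (Fin r → ℂ)) (j : ℕ) :
    momentL v j u = iteratedDeriv j (pairing v u) 0 := rfl

theorem momentL_zero (v u : ℤ →₀ (Fin r → ℂ)) : momentL v 0 u = symbol v 0 ⬝ᵥ symbol u 0 := by
  rw [momentL_apply, iteratedDeriv_zero, pairing]

theorem mem_moments_iff {v u : ℤ →₀ (Fin r → ℂ)} {k : ℕ} :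
    u ∈ moments k v ↔ ∀ j < k, momentL v j u = 0 := by
  refine forall₂_congr fun j _ => ?_
  rw [iteratedDeriv_fun_const_zero]
  rfl

theorem pairing_transition (a : ℤ →₀ Matrix (Fin r) (Fin r) ℂ) (v u : ℤ →₀ (Fin r → ℂ)) (ε : ℤ)
    (ξ : ℝ) : pairing v (transition a ε u) (2 * ξ) = Complex.exp (Complex.I * ε * ξ) *
      ((symbol v (2 * ξ) ᵥ* symbol a ξ) ⬝ᵥ symbol u ξ + (-1 : ℂ) ^ ε *
        ((symbol v (2 * ξ) ᵥ* symbol a (ξ + Real.pi)) ⬝ᵥ symbol u (ξ + Real.pi))) := by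
  rw [pairing, symbol_transition, dotProduct_smul, dotProduct_add, dotProduct_smul,
    Matrix.dotProduct_mulVec, Matrix.dotProduct_mulVec, smul_eq_mul, smul_eq_mul]

theorem contDiff_cexp_I_mul (ε : ℤ) :
    ContDiff ℝ ∞ fun ξ : ℝ => Complex.exp (Complex.I * ε * ξ) := contDiff_cexp_mul _

/-- Sum rules of order `k` determine the moments of order less than `k` of `transition a ε u`. -/
theorem HasSumRules.momentL_transition {a : ℤ →₀ Matrix (Fin r) (Fin r) ℂ} {k : ℕ}
    {v : ℤ →₀ (Fin r → ℂ)} (h : HasSumRules a k v) (ε : ℤ) (u : ℤ →₀ (Fin r → ℂ)) {j : ℕ}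
    (hj : j < k) : 2 ^ j * momentL v j (transition a ε u) =
      iteratedDeriv j (fun ξ : ℝ => Complex.exp (Complex.I * ε * ξ) * pairing v u ξ) 0 := by
  have hj' := natCast_le_infty j
  -- The factor 2^j is the chain rule for ξ ↦ 2ξ, the frequency at which the transition identity is
  -- available.
  have h1 := congrFun (iteratedDeriv_comp_const_smul
    ((contDiff_pairing v (transition a ε u)).of_le hj') (2 : ℝ)) 0
  rw [mul_zero, Complex.real_smul] at h1
  push_cast at h1
  rw [momentL_apply, ← h1]
  have hv2 : ∀ i, ContDiff ℝ ∞ fun ξ => symbol v (2 * ξ) i := fun i =>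
    contDiff_two_mul (contDiff_symbol_apply v i)
  have hA0 : ∀ i, ContDiff ℝ ∞ fun ξ => (symbol v (2 * ξ) ᵥ* symbol a ξ) i := fun i =>
    contDiff_dotProduct hv2 fun l => contDiff_symbol_matrix_apply a l i
  have hA1 : ∀ i, ContDiff ℝ ∞ fun ξ => (symbol v (2 * ξ) ᵥ* symbol a (ξ + Real.pi)) i := fun i =>
    contDiff_dotProduct hv2 fun l => contDiff_add_const (contDiff_symbol_matrix_apply a l i) _
  have hu := contDiff_symbol_apply u
  have hu1 : ∀ i, ContDiff ℝ ∞ fun ξ => symbol u (ξ + Real.pi) i := fun i =>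
    contDiff_add_const (hu i) _
  have hz : ∀ i : Fin r, ContDiff ℝ ∞ fun _ : ℝ => (0 : Fin r → ℂ) i := fun i => contDiff_const
  have e0 := AgreeToOrder.dotProduct hA0 (contDiff_symbol_apply v) hu h.at_zero
  have e1 := AgreeToOrder.mul (contDiff_dotProduct hA1 hu1) (contDiff_dotProduct hz hu1)
    (contDiff_const (c := (-1 : ℂ) ^ ε)) (AgreeToOrder.dotProduct hA1 hz hu1 h.at_pi)
  have e2 := AgreeToOrder.add (contDiff_dotProduct hA0 hu) (contDiff_pairing v u)
    (contDiff_const.mul (contDiff_dotProduct hA1 hu1))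
    (contDiff_const.mul (contDiff_dotProduct hz hu1)) e0 e1
  have e3 := AgreeToOrder.mul ((contDiff_dotProduct hA0 hu).add
      (contDiff_const.mul (contDiff_dotProduct hA1 hu1)))
    ((contDiff_pairing v u).add (contDiff_const.mul (contDiff_dotProduct hz hu1)))
    (contDiff_cexp_I_mul ε) e2 j hj
  simp only [pairing_transition]
  rw [e3]
  simp [pairing]

theorem iteratedDeriv_mul_of_vanishing {e p : ℝ → ℂ} (he : ContDiff ℝ ∞ e) (hp : ContDiff ℝ ∞ p)
    {j : ℕ} (h : ∀ i < j, iteratedDeriv i p 0 = 0) {i : ℕ} (hi : i ≤ j) :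
    iteratedDeriv i (fun ξ => e ξ * p ξ) 0 = e 0 * iteratedDeriv i p 0 := by
  have hi' := natCast_le_infty i
  rw [iteratedDeriv_fun_mul (he.of_le hi').contDiffAt (hp.of_le hi').contDiffAt,
    Finset.sum_eq_single 0]
  · simp
  · intro l hl hl0
    rw [h (i - l) (by rw [Finset.mem_range] at hl; omega), mul_zero]
  · simp

/-- When the lower moments vanish, the Leibniz rule leaves only the term in which the exponential is
not differentiated, so the parity ε no longer matters. -/
theorem HasSumRules.momentL_transition_of_mem {a : ℤ →₀ Matrix (Fin r) (Fin r) ℂ} {k j i : ℕ}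
    {v u : ℤ →₀ (Fin r → ℂ)} (h : HasSumRules a k v) (hu : u ∈ moments j v) (ε : ℤ) (hi : i ≤ j)
    (hik : i < k) : momentL v i (transition a ε u) = (2 ^ i)⁻¹ * momentL v i u := by
  rw [mem_moments_iff] at hu
  rw [eq_inv_mul_iff_mul_eq₀ (pow_ne_zero i two_ne_zero), h.momentL_transition ε u hik,
    iteratedDeriv_mul_of_vanishing (contDiff_cexp_I_mul ε) (contDiff_pairing v u) hu hi]
  simp [momentL_apply]

theorem HasSumRules.transition_mem_moments {a : ℤ →₀ Matrix (Fin r) (Fin r) ℂ} {k j : ℕ}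
    {v u : ℤ →₀ (Fin r → ℂ)} (h : HasSumRules a k v) (hu : u ∈ moments j v) (ε : ℤ) (hj : j ≤ k) :
    transition a ε u ∈ moments j v := by
  rw [mem_moments_iff]
  intro i hi
  rw [h.momentL_transition_of_mem hu ε hi.le (hi.trans_le hj), mem_moments_iff.1 hu i hi, mul_zero]

theorem HasSumRules.transition_sub_mem_moments {a : ℤ →₀ Matrix (Fin r) (Fin r) ℂ} {k j : ℕ}
    {v u : ℤ →₀ (Fin r → ℂ)} (h : HasSumRules a k v) (hu : u ∈ moments j v) (ε : ℤ) (hj : j < k) :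
    transition a ε u - ((2 : ℂ) ^ j)⁻¹ • u ∈ moments (j + 1) v := by
  rw [mem_moments_iff]
  intro i hi
  rw [map_sub, map_smul, smul_eq_mul,
    h.momentL_transition_of_mem hu ε (Nat.lt_succ_iff.1 hi) (by omega)]
  rcases Nat.lt_succ_iff_lt_or_eq.1 hi with hi' | rfl
  · rw [mem_moments_iff.1 hu i hi', mul_zero, mul_zero, sub_zero]
  · rw [sub_self]

theorem pairing_single (v : ℤ →₀ (Fin r → ℂ)) (k : ℤ) (x : Fin r → ℂ) (ξ : ℝ) :
    pairing v (Finsupp.single k x) ξ =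
      Complex.exp (-(Complex.I * k) * ξ) * (symbol v ξ ⬝ᵥ x) := by
  rw [pairing, symbol_single, dotProduct_smul, smul_eq_mul, neg_mul]

/-- On the shifts by k of a unit column, the j-th moment is a polynomial in k with leading
coefficient (-i)^j v̂_i(0). For i with v̂_i(0) ≠ 0 it cannot vanish at all integers. -/
theorem exists_momentL_ne_zero {v : ℤ →₀ (Fin r → ℂ)} (hv : symbol v 0 ≠ 0) (j : ℕ) :
    ∃ u, momentL v j u ≠ 0 := by
  by_contra! hcon
  obtain ⟨i, hi⟩ := Function.ne_iff.1 hv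
  set q : ℝ → ℂ := fun ξ => symbol v ξ ⬝ᵥ Pi.single i 1 with hq
  have hqd : ContDiff ℝ ∞ q := contDiff_dotProduct (contDiff_symbol_apply v) fun _ => contDiff_const
  set P : Polynomial ℂ := ∑ l ∈ Finset.range (j + 1),
    Polynomial.C ((j.choose l : ℂ) * (-Complex.I) ^ l * iteratedDeriv (j - l) q 0) *
      Polynomial.X ^ l with hP
  have hroot : ∀ k : ℤ, P.IsRoot (k : ℂ) := by
    intro k
    have h1 := hcon (Finsupp.single k (Pi.single i 1))
    have hj' := natCast_le_infty j
    rw [momentL_apply, funext (pairing_single v k (Pi.single i 1)),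
      iteratedDeriv_fun_mul ((contDiff_cexp_mul _).of_le hj').contDiffAt
        (hqd.of_le hj').contDiffAt] at h1
    rw [Polynomial.IsRoot.def, hP, Polynomial.eval_finsetSum, ← h1]
    refine Finset.sum_congr rfl fun l _ => ?_
    rw [iteratedDeriv_cexp_mul]
    simp only [Polynomial.eval_mul, Polynomial.eval_C, Polynomial.eval_pow, Polynomial.eval_X,
      Complex.ofReal_zero, mul_zero, Complex.exp_zero, mul_one]
    rw [← neg_mul, mul_pow]
    ring
  have hP0 : P = 0 := by
    refine Polynomial.eq_zero_of_infinite_isRoot P ?_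
    exact (Set.infinite_range_of_injective (Int.cast_injective (α := ℂ))).mono
      (by rintro _ ⟨k, rfl⟩; exact hroot k)
  have hc : P.coeff j = (-Complex.I) ^ j * symbol v 0 i := by
    rw [hP, Polynomial.finsetSum_coeff, Finset.sum_eq_single j]
    · rw [Polynomial.coeff_C_mul_X_pow, if_pos rfl]
      simp [hq]
    · intro l _ hlj
      rw [Polynomial.coeff_C_mul, Polynomial.coeff_X_pow, if_neg (Ne.symm hlj), mul_zero]
    · simp
  rw [hP0, Polynomial.coeff_zero] at hc
  have := mul_ne_zero (pow_ne_zero j (neg_ne_zero.2 Complex.I_ne_zero)) hi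
  exact this hc.symm

/-! ### Supports under transition and finiteness of the sum rule order -/

theorem transition_support {a : ℤ →₀ Matrix (Fin r) (Fin r) ℂ} {N : ℕ}
    (hN : ∀ k, a k ≠ 0 → |k| ≤ N) {ε : ℤ} (hε : ε = 0 ∨ ε = 1) {u : ℤ →₀ (Fin r → ℂ)} {R : ℕ}
    (hu : ∀ k, u k ≠ 0 → |k| ≤ R) {k : ℤ} (hk : transition a ε u k ≠ 0) :
    2 * |k| ≤ R + N + 1 := by
  rw [transition_apply] at hk
  obtain ⟨j, hj, hj'⟩ := Finset.exists_ne_zero_of_sum_ne_zero (right_ne_zero_of_smul hk)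
  have h1 := hN j (Finsupp.mem_support_iff.1 hj)
  have h2 := hu (2 * k + ε - j) fun h => hj' (by rw [h, Matrix.mulVec_zero])
  rw [abs_le] at h1 h2
  rcases abs_cases k with h | h <;> rcases hε with rfl | rfl <;> omega

theorem transition_support_of_le {a : ℤ →₀ Matrix (Fin r) (Fin r) ℂ} {N : ℕ}
    (hN : ∀ k, a k ≠ 0 → |k| ≤ N) {ε : ℤ} (hε : ε = 0 ∨ ε = 1) {u : ℤ →₀ (Fin r → ℂ)} {R : ℕ}
    (hR : N + 1 ≤ R) (hu : ∀ k, u k ≠ 0 → |k| ≤ R) {k : ℤ} (hk : transition a ε u k ≠ 0) :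
    |k| ≤ R := by
  have := transition_support hN hε hu hk
  omega

/-- A transition roughly halves the support radius and adds (N + 1)/2. Beyond the invariant radius N
+ 1 this gains at least one unit, which is what the later inductions use. -/
theorem transition_support_shrink {a : ℤ →₀ Matrix (Fin r) (Fin r) ℂ} {N : ℕ}
    (hN : ∀ k, a k ≠ 0 → |k| ≤ N) {ε : ℤ} (hε : ε = 0 ∨ ε = 1) {u : ℤ →₀ (Fin r → ℂ)} {R : ℕ}
    (hu : ∀ k, u k ≠ 0 → |k| ≤ (N + 1 + (R + 1) : ℕ)) {k : ℤ} (hk : transition a ε u k ≠ 0) :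
    |k| ≤ (N + 1 + R : ℕ) := by
  have := transition_support hN hε hu hk
  push_cast at this ⊢
  omega

/-- The sequences of columns supported in `[-R, R]`. -/
def supportedSubmodule (r R : ℕ) : Submodule ℂ (ℤ →₀ (Fin r → ℂ)) where
  carrier := {u | ∀ k, u k ≠ 0 → |k| ≤ R}
  add_mem' := by
    intro u w hu hw k hk
    by_cases h : u k = 0
    · exact hw k fun h' => hk (by rw [Finsupp.add_apply, h, h', add_zero])
    · exact hu k h
  zero_mem' := fun k hk => absurd rfl hk
  smul_mem' := by
    intro c u hu k hk
    exact hu k fun h => hk (by rw [Finsupp.smul_apply, h, smul_zero])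

theorem exists_iterate_transition_mem {a : ℤ →₀ Matrix (Fin r) (Fin r) ℂ} {N : ℕ}
    (hN : ∀ k, a k ≠ 0 → |k| ≤ N) (u : ℤ →₀ (Fin r → ℂ)) :
    ∃ n, (transition a 0)^[n] u ∈ supportedSubmodule r (N + 1) := by
  obtain ⟨R, hR⟩ := exists_support_bound u
  have hu : ∀ k, u k ≠ 0 → |k| ≤ (N + 1 + R : ℕ) := fun k hk => (hR k hk).trans (by push_cast; omega)
  clear hR
  induction R generalizing u with
  | zero => exact ⟨0, hu⟩
  | succ R ih =>
    obtain ⟨n, hn⟩ := ih (transition a 0 u) fun k hk => transition_support_shrink hN (Or.inl rfl) hu hk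
    exact ⟨n + 1, hn⟩

/-- The restrictions of the L_j would be eigenvectors of the dual of `T` on a finite-dimensional
space, with infinitely many distinct eigenvalues 2^{-j}. -/
theorem not_exists_eigenfunctionals {E F : Type*} [AddCommGroup E] [Module ℂ E]
    [NormedAddCommGroup F] [NormedSpace ℂ F] [FiniteDimensional ℂ F] (W : Submodule ℂ E)
    (res : E →ₗ[ℂ] F) (hinj : ∀ u ∈ W, res u = 0 → u = 0) (T : E →ₗ[ℂ] E) (hT : ∀ u ∈ W, T u ∈ W)
    (L : ℕ → E →ₗ[ℂ] ℂ) (hL : ∀ j, ∀ u ∈ W, 2 ^ j * L j (T u) = L j u)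
    (hne : ∀ j, ∃ u ∈ W, L j u ≠ 0) : False := by
  set res' : W →ₗ[ℂ] F := res ∘ₗ W.subtype with hres'
  have hker : LinearMap.ker res' = ⊥ := by
    rw [LinearMap.ker_eq_bot']
    intro u hu
    ext1
    exact hinj u.1 u.2 hu
  have : FiniteDimensional ℂ W := FiniteDimensional.of_injective res' (LinearMap.ker_eq_bot.1 hker)
  set T' : W →ₗ[ℂ] W := T.restrict hT with hT'
  have hev : ∀ j : ℕ, Module.End.HasEigenvalue (R := ℂ) (M := Module.Dual ℂ W) T'.dualMap
      (((2 : ℂ) ^ j)⁻¹) := by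
    intro j
    refine Module.End.hasEigenvalue_of_hasEigenvector (x := (L j) ∘ₗ W.subtype) ⟨?_, ?_⟩
    · rw [Module.End.mem_eigenspace_iff]
      ext u
      change L j (T u.1) = (2 ^ j)⁻¹ * L j u.1
      rw [eq_inv_mul_iff_mul_eq₀ (pow_ne_zero j two_ne_zero), hL j u.1 u.2]
    · obtain ⟨u, hu, huL⟩ := hne j
      intro h
      exact huL (by simpa using LinearMap.congr_fun h ⟨u, hu⟩)
  have hfin := Module.End.finite_hasEigenvalue (R := ℂ) (M := Module.Dual ℂ W) T'.dualMap
  refine Set.infinite_range_of_injective (f := fun j : ℕ => ((2 : ℂ) ^ j)⁻¹) ?_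
    (hfin.subset (by rintro _ ⟨j, rfl⟩; exact hev j))
  intro i j hij
  have h1 := congrArg (fun z : ℂ => ‖z‖) (inv_injective hij)
  simp only [norm_pow, Complex.norm_ofNat] at h1
  exact Nat.pow_right_injective le_rfl (by exact_mod_cast h1)

/-- Sum rules of order greater than j make the j-th moment an eigenfunctional of the even transition
operator, with eigenvalue 2^{-j}. Iterating that operator moves a sequence with nonzero moment into
the invariant window without destroying the moment. Boundedness makes the `sSup` defining
`sumRuleOrder` a genuine maximum. -/
theorem bddAbove_hasSumRules (a : ℤ →₀ Matrix (Fin r) (Fin r) ℂ) :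
    BddAbove {k : ℕ | ∃ v, HasSumRules a k v} := by
  by_contra hcon
  rw [not_bddAbove_iff] at hcon
  choose k hk hjk using hcon
  choose v hv using hk
  obtain ⟨N, hN⟩ := exists_support_bound a
  let s := Finset.Icc (-((N + 1 : ℕ) : ℤ)) (N + 1 : ℕ)
  let res : (ℤ →₀ (Fin r → ℂ)) →ₗ[ℂ] (s → Fin r → ℂ) := LinearMap.pi fun k => Finsupp.lapply k.1
  have hL : ∀ j u, 2 ^ j * momentL (v j) j (transition a 0 u) = momentL (v j) j u := by
    intro j u
    rw [(hv j).momentL_transition 0 u (hjk j)]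
    simp [momentL_apply]
  refine not_exists_eigenfunctionals (supportedSubmodule r (N + 1)) res ?_ (transition a 0)
    (fun u hu k hk => transition_support_of_le hN (Or.inl rfl) le_rfl hu hk)
    (fun j => momentL (v j) j) (fun j u _ => hL j u) fun j => ?_
  · intro u hu hu0
    ext1 k
    by_contra h
    have hk := hu k h
    rw [abs_le] at hk
    exact h (congrFun hu0 ⟨k, Finset.mem_Icc.2 hk⟩)
  · obtain ⟨u, hu⟩ := exists_momentL_ne_zero (hv j).ne_zero j
    obtain ⟨n, hn⟩ := exists_iterate_transition_mem hN u
    refine ⟨_, hn, ?_⟩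
    clear hn
    induction n with
    | zero => exact hu
    | succ n ih =>
      rw [Function.iterate_succ_apply']
      intro h
      rw [← hL, h, mul_zero] at ih
      exact ih rfl

theorem le_sumRuleOrder {a : ℤ →₀ Matrix (Fin r) (Fin r) ℂ} {k : ℕ} {v : ℤ →₀ (Fin r → ℂ)}
    (h : HasSumRules a k v) : k ≤ sumRuleOrder a :=
  le_csSup (bddAbove_hasSumRules a) ⟨v, h⟩

theorem hasSumRules_one {a : ℤ →₀ Matrix (Fin r) (Fin r) ℂ} {y : Fin r → ℂ} (hy : y ≠ 0)
    (h0 : y ᵥ* symbol a 0 = y) (hpi : y ᵥ* symbol a Real.pi = 0) :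
    HasSumRules a 1 (Finsupp.single 0 y) := by
  have hs : ∀ ξ, symbol (Finsupp.single 0 y) ξ = y := by simp
  refine ⟨by rwa [hs], fun j hj => ?_, fun j hj => ?_⟩ <;> obtain rfl : j = 0 := by omega
  · simpa [hs] using h0
  · simpa [hs] using hpi

/-- The left eigenspace for a simple eigenvalue is one-dimensional. -/
theorem exists_eq_smul_of_vecMul_eq {M : Matrix (Fin r) (Fin r) ℂ}
    (hM : M.charpoly.rootMultiplicity 1 = 1) {y z : Fin r → ℂ} (hy : y ᵥ* M = y) (hz : z ᵥ* M = z)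
    (hy0 : y ≠ 0) : ∃ c : ℂ, z = c • y := by
  have h1 := LinearMap.finrank_eigenspace_le (Matrix.toLin' Mᵀ) 1
  rw [Matrix.charpoly_toLin', Matrix.charpoly_transpose, hM] at h1
  have hmem : ∀ w : Fin r → ℂ, w ᵥ* M = w → w ∈ Module.End.eigenspace (Matrix.toLin' Mᵀ) 1 := by
    intro w hw
    rw [Module.End.mem_eigenspace_iff, Matrix.toLin'_apply, Matrix.mulVec_transpose, hw, one_smul]
  obtain ⟨⟨b, hb⟩, hb'⟩ := finrank_le_one_iff.1 h1
  obtain ⟨c, hc⟩ := hb' ⟨y, hmem y hy⟩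
  obtain ⟨d, hd⟩ := hb' ⟨z, hmem z hz⟩
  have hc' : c • b = y := congrArg Subtype.val hc
  have hd' : d • b = z := congrArg Subtype.val hd
  have hc0 : c ≠ 0 := by
    rintro rfl
    exact hy0 (by rw [← hc', zero_smul])
  exact ⟨d * c⁻¹, by rw [← hd', ← hc', smul_smul, inv_mul_cancel_right₀ hc0]⟩

/-! ### Decay of the iterates and the quantity ρ -/

/-- The sequences `(S_aⁿ (δ I_r)) * u` converge uniformly to `0`. -/
def Decays (a : ℤ →₀ Matrix (Fin r) (Fin r) ℂ) (u : ℤ →₀ (Fin r → ℂ)) : Prop :=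
  ∀ ε > 0, ∃ n₀ : ℕ, ∀ n ≥ n₀, ∀ k, ‖conv (iterMask a n) u k‖ ≤ ε

theorem conv_iterMask_succ_le {a : ℤ →₀ Matrix (Fin r) (Fin r) ℂ} {u : ℤ →₀ (Fin r → ℂ)} {n : ℕ}
    {B : ℝ} (h : ∀ ε : ℤ, ε = 0 ∨ ε = 1 → ∀ k, ‖conv (iterMask a n) (transition a ε u) k‖ ≤ B)
    (k : ℤ) : ‖conv (iterMask a (n + 1)) u k‖ ≤ B := by
  rcases Int.even_or_odd' k with ⟨p, rfl | rfl⟩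
  · have := conv_iterMask_succ a n u p 0
    rw [add_zero] at this
    rw [this]
    exact h 0 (Or.inl rfl) p
  · rw [conv_iterMask_succ a n u p 1]
    exact h 1 (Or.inr rfl) p

/-- If `transition a ε u` is a contracted multiple of `u` up to decaying sequences, `u` decays. -/
theorem Decays.of_transition_sub {a : ℤ →₀ Matrix (Fin r) (Fin r) ℂ} {u : ℤ →₀ (Fin r → ℂ)}
    {c : ℂ} (hc : ‖c‖ ≤ 1 / 2)
    (h : ∀ ε : ℤ, ε = 0 ∨ ε = 1 → Decays a (transition a ε u - c • u)) : Decays a u := by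
  intro δ hδ
  obtain ⟨n₁, h₁⟩ := h 0 (Or.inl rfl) (δ / 4) (by positivity)
  obtain ⟨n₂, h₂⟩ := h 1 (Or.inr rfl) (δ / 4) (by positivity)
  set n₀ := max n₁ n₂ with hn₀
  have h3 : ∀ n ≥ n₀, ∀ ε : ℤ, ε = 0 ∨ ε = 1 → ∀ k,
      ‖conv (iterMask a n) (transition a ε u - c • u) k‖ ≤ δ / 4 := by
    rintro n hn ε (rfl | rfl) k
    · exact h₁ n (le_of_max_le_left hn) k
    · exact h₂ n (le_of_max_le_right hn) k
  obtain ⟨D, hD0, hD⟩ := conv_iterMask_bounded a n₀ u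
  -- The bounds satisfy b_{m+1} ≤ b_m/2 + δ/4, whose fixed point is δ/2.
  have key : ∀ m k, ‖conv (iterMask a (n₀ + m)) u k‖ ≤ (1 / 2) ^ m * D + δ / 2 := by
    intro m
    induction m with
    | zero =>
      intro k
      rw [pow_zero, one_mul, add_zero]
      linarith [hD k]
    | succ m ih =>
      refine conv_iterMask_succ_le fun ε hε k => ?_
      have h4 := h3 (n₀ + m) (Nat.le_add_right _ _) ε hε k
      have h5 := ih k
      rw [← convL_apply, map_sub, map_smul, convL_apply, convL_apply] at h4
      have h6 : ‖c • conv (iterMask a (n₀ + m)) u k‖ ≤ 1 / 2 * ((1 / 2) ^ m * D + δ / 2) := by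
        rw [norm_smul]
        gcongr
      have h7 := norm_sub_norm_le (conv (iterMask a (n₀ + m)) (transition a ε u) k)
        (c • conv (iterMask a (n₀ + m)) u k)
      change ‖conv (iterMask a (n₀ + m)) (transition a ε u) k‖ ≤ _
      rw [pow_succ]
      linarith
  have hlim : Filter.Tendsto (fun m : ℕ => (1 / 2 : ℝ) ^ m * D) Filter.atTop (nhds 0) := by
    simpa using (tendsto_pow_atTop_nhds_zero_of_lt_one (by norm_num : (0 : ℝ) ≤ 1 / 2)
      (by norm_num)).mul_const D
  obtain ⟨m₀, hm₀⟩ := Filter.eventually_atTop.1 (hlim.eventually (gt_mem_nhds (half_pos hδ)))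
  refine ⟨n₀ + m₀, fun n hn k => ?_⟩
  obtain ⟨m, rfl⟩ := Nat.exists_eq_add_of_le (Nat.le_of_add_right_le hn)
  have h8 := hm₀ m (by omega)
  linarith [key m k]

/-- Descends from order k one moment at a time: a transition agrees with multiplication by 2^{-j} up
to a sequence with one more vanishing moment. The descent stops at j = 1, because for j = 0 the
factor is 1 and nothing contracts. -/
theorem decays_of_mem_moments {a : ℤ →₀ Matrix (Fin r) (Fin r) ℂ} {v : ℤ →₀ (Fin r → ℂ)} {k : ℕ}
    (hv : HasSumRules a k v) (hk : ∀ u ∈ moments k v, Decays a u) {j : ℕ} (hj : 1 ≤ j)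
    (hjk : j ≤ k) : ∀ u ∈ moments j v, Decays a u := by
  induction hjk using Nat.decreasingInduction with
  | self => exact hk
  | of_succ j hjk ih =>
    intro u hu
    refine Decays.of_transition_sub (c := (2 ^ j)⁻¹) ?_ fun ε _ =>
      ih (by omega) _ (hv.transition_sub_mem_moments hu ε hjk)
    rw [norm_inv, norm_pow, Complex.norm_ofNat, one_div]
    refine inv_anti₀ two_pos ?_
    calc (2 : ℝ) = 2 ^ 1 := (pow_one _).symm
      _ ≤ 2 ^ j := pow_le_pow_right₀ one_le_two hj

theorem norm_le_of_supNorm_le {w : ℤ → Fin r → ℂ} {B : ℝ} (hB : 0 ≤ B)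
    (h : supNorm w ≤ ENNReal.ofReal B) (k : ℤ) : ‖w k‖ ≤ B := by
  rw [pi_norm_le_iff_of_nonneg hB]
  intro i
  have h1 : ‖w k i‖ₑ ≤ ENNReal.ofReal B :=
    (le_iSup₂ (f := fun (k : ℤ) (i : Fin r) => ‖w k i‖ₑ) k i).trans h
  rw [← ofReal_norm] at h1
  exact (ENNReal.ofReal_le_ofReal_iff hB).1 h1

theorem supNorm_le_ofReal {w : ℤ → Fin r → ℂ} {B : ℝ} (h : ∀ k, ‖w k‖ ≤ B) :
    supNorm w ≤ ENNReal.ofReal B := by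
  refine iSup₂_le fun k i => ?_
  rw [← ofReal_norm]
  exact ENNReal.ofReal_le_ofReal ((norm_le_pi_norm (w k) i).trans (h k))

theorem zero_lt_smMask_iff (a : ℤ →₀ Matrix (Fin r) (Fin r) ℂ) (v : ℤ →₀ (Fin r → ℂ)) :
    0 < smMask a v ↔ rho a (sumRuleOrder a) v < 1 := by
  have h2 : (0 : EReal) < ((Real.log 2 : ℝ) : EReal) := by
    exact_mod_cast Real.log_pos one_lt_two
  rw [smMask, ← EReal.neg_lt_neg_iff, neg_neg, neg_zero, EReal.div_lt_iff h2 (EReal.coe_ne_top _),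
    zero_mul, ← ENNReal.log_one, ENNReal.log_lt_log_iff]

theorem decays_of_rho_lt_one {a : ℤ →₀ Matrix (Fin r) (Fin r) ℂ} {v : ℤ →₀ (Fin r → ℂ)} {k : ℕ}
    (h : rho a k v < 1) : ∀ u ∈ moments k v, Decays a u := by
  intro u hu δ hδ
  obtain ⟨q, hq, hq1⟩ := exists_between h
  have h1 : Filter.limsup (fun n : ℕ => supNorm (conv (iterMask a n) u) ^ ((1 : ℝ) / n))
      Filter.atTop < q := lt_of_le_of_lt (le_iSup₂ (f := fun u (_ : u ∈ moments k v) =>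
        Filter.limsup (fun n : ℕ => supNorm (conv (iterMask a n) u) ^ ((1 : ℝ) / n))
          Filter.atTop) u hu) hq
  have h2 := Filter.eventually_lt_of_limsup_lt h1
  have h3 := ENNReal.tendsto_pow_atTop_nhds_zero_of_lt_one hq1
  have h4 := h3.eventually (gt_mem_nhds (ENNReal.ofReal_pos.2 hδ))
  obtain ⟨n₀, hn₀⟩ := Filter.eventually_atTop.1 (h2.and (h4.and (Filter.eventually_ge_atTop 1)))
  refine ⟨n₀, fun n hn => norm_le_of_supNorm_le hδ.le ?_⟩
  obtain ⟨h5, h6, h7⟩ := hn₀ n hn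
  refine le_trans ?_ h6.le
  have hn0 : (0 : ℝ) < n := by exact_mod_cast h7
  have h8 := ENNReal.rpow_le_rpow h5.le hn0.le
  rwa [← ENNReal.rpow_mul, one_div, inv_mul_cancel₀ hn0.ne', ENNReal.rpow_one,
    ENNReal.rpow_natCast] at h8

/-- The constant may depend on u because C^{1/n} → 1; the rate θ may not, because ρ is a supremum
over u. -/
theorem rho_le_of_bound {a : ℤ →₀ Matrix (Fin r) (Fin r) ℂ} {v : ℤ →₀ (Fin r → ℂ)} {k : ℕ} {θ : ℝ}
    (hθ : 0 ≤ θ) (h : ∀ u ∈ moments k v, ∃ C : ℝ, 0 < C ∧ ∀ n k,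
      ‖conv (iterMask a n) u k‖ ≤ C * θ ^ n) : rho a k v ≤ ENNReal.ofReal θ := by
  refine iSup₂_le fun u hu => ?_
  obtain ⟨C, hC, hCu⟩ := h u hu
  have h1 : Filter.Tendsto (fun n : ℕ => C ^ ((1 : ℝ) / n) * θ) Filter.atTop (nhds (C ^ (0 : ℝ) * θ)) :=
    (((Real.continuousAt_const_rpow hC.ne').tendsto).comp
      tendsto_one_div_atTop_nhds_zero_nat).mul_const θ
  rw [Real.rpow_zero, one_mul] at h1
  rw [← ((ENNReal.continuous_ofReal.tendsto θ).comp h1).limsup_eq]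
  refine Filter.limsup_le_limsup ?_
  filter_upwards [Filter.eventually_ge_atTop 1] with n hn
  have hn0 : (0 : ℝ) < n := by exact_mod_cast hn
  have h2 := ENNReal.rpow_le_rpow (supNorm_le_ofReal (hCu n)) (by positivity : (0 : ℝ) ≤ 1 / n)
  refine h2.trans (le_of_eq ?_)
  rw [ENNReal.ofReal_rpow_of_nonneg (by positivity) (by positivity),
    Real.mul_rpow hC.le (by positivity), ← Real.rpow_natCast, ← Real.rpow_mul hθ,
    mul_one_div_cancel hn0.ne', Real.rpow_one]
  rfl

/-! ### Refinable functions and their Hölder regularity -/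

/-- The refinement equation `G(x) = 2 c ∑ₖ a(k) G(2x - k)`. -/
def Refinable (a : ℤ →₀ Matrix (Fin r) (Fin r) ℂ) (c : ℝ) (G : ℝ → Fin r → ℂ) : Prop :=
  ∀ x, G x = c • (2 : ℂ) • ∑ k ∈ a.support, a k *ᵥ G (2 * x - k)

theorem finite_support_samples {G : ℝ → Fin r → ℂ} (hG : HasCompactSupport G) (t : ℝ) :
    (Function.support fun k : ℤ => G (t + k)).Finite := by
  obtain ⟨R, hR, hGR⟩ := hG.exists_pos_le_norm
  refine (Set.finite_Icc (-⌈R + |t|⌉) ⌈R + |t|⌉).subset fun k hk => ?_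
  have h1 : |t + k| < R := by
    by_contra h
    exact hk (hGR _ (not_lt.1 h))
  have h2 : |(k : ℝ)| ≤ R + |t| := by
    have := abs_sub (t + k) t
    rw [add_sub_cancel_left] at this
    linarith
  have h3 : |(k : ℝ)| ≤ ⌈R + |t|⌉ := h2.trans (Int.le_ceil _)
  rw [abs_le] at h3
  exact ⟨by exact_mod_cast h3.1, by exact_mod_cast h3.2⟩

/-- The sequence `k ↦ G(t + k)`. -/
def samples {G : ℝ → Fin r → ℂ} (hG : HasCompactSupport G) (t : ℝ) : ℤ →₀ (Fin r → ℂ) :=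
  Finsupp.ofSupportFinite (fun k : ℤ => G (t + k)) (finite_support_samples hG t)

theorem samples_apply {G : ℝ → Fin r → ℂ} (hG : HasCompactSupport G) (t : ℝ) (k : ℤ) :
    samples hG t k = G (t + k) := rfl

/-- The refinement equation read on the coset t + ℤ. For t in [0, 1] and ε in {0, 1}, the new offset
(t + ε)/2 is again in [0, 1], the source of the invariance used for decay. -/
theorem Refinable.transition_samples {a : ℤ →₀ Matrix (Fin r) (Fin r) ℂ} {c : ℝ}
    {G : ℝ → Fin r → ℂ} (h : Refinable a c G) (hG : HasCompactSupport G) (t : ℝ) (ε : ℤ) :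
    c • transition a ε (samples hG t) = samples hG ((t + ε) / 2) := by
  ext1 k
  rw [Finsupp.smul_apply, transition_apply, samples_apply, h]
  congr 2
  refine Finset.sum_congr rfl fun j _ => ?_
  have h1 : 2 * ((t + ε) / 2 + k) - (j : ℝ) = t + (2 * k + ε - j : ℤ) := by
    push_cast
    ring
  rw [samples_apply, h1]

theorem conv_real_smul (w : ℤ → Matrix (Fin r) (Fin r) ℂ) (u : ℤ →₀ (Fin r → ℂ)) (c : ℝ) (k : ℤ) :
    conv w (c • u) k = c • conv w u k := by
  have h1 : c • u = (c : ℂ) • u := by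
    ext k i
    simp
  rw [h1, ← convL_apply, map_smul, convL_apply]
  ext i
  simp

/-- The subdivision scheme reproduces a refinable function from its samples. -/
theorem Refinable.conv_iterMask {a : ℤ →₀ Matrix (Fin r) (Fin r) ℂ} {c : ℝ}
    {G : ℝ → Fin r → ℂ} (h : Refinable a c G) (hG : HasCompactSupport G) (n : ℕ) (t : ℝ) (p : ℤ) :
    c ^ n • conv (iterMask a n) (samples hG t) p = G ((t + p) / 2 ^ n) := by
  induction n generalizing t p with
  | zero => rw [pow_zero, one_smul, conv_iterMask_zero, samples_apply, pow_zero, div_one]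
  | succ n ih =>
    obtain ⟨q, ε, hp⟩ : ∃ q ε : ℤ, p = 2 * q + ε := ⟨p / 2, p % 2, by omega⟩
    rw [hp, conv_iterMask_succ, pow_succ, mul_smul, ← conv_real_smul, h.transition_samples hG, ih]
    congr 1
    push_cast
    field_simp
    ring

theorem Refinable.conv_iterMask_one {a : ℤ →₀ Matrix (Fin r) (Fin r) ℂ}
    {G : ℝ → Fin r → ℂ} (h : Refinable a 1 G) (hG : HasCompactSupport G) (n : ℕ) (p : ℤ) :
    conv (iterMask a n) (samples hG 0) p = G (p / 2 ^ n) := by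
  have := h.conv_iterMask hG n 0 p
  rwa [one_pow, one_smul, zero_add] at this

/-- Differences of samples with offsets in [0, 1] span a transition-invariant space with uniformly
bounded supports. Weighted by cⁿ, the iterates on such a difference are differences of G at points
at most 2^{-n} apart, so uniform continuity gives decay to 0, which `conv_iterMask_decay` makes
geometric. -/
theorem Refinable.exists_decay {a : ℤ →₀ Matrix (Fin r) (Fin r) ℂ} {c : ℝ} (hc : 0 < c)
    {G : ℝ → Fin r → ℂ} (h : Refinable a c G) (hGc : Continuous G) (hG : HasCompactSupport G) :
    ∃ C θ : ℝ, 0 ≤ C ∧ 1 / 2 < θ ∧ θ < 1 ∧ ∀ t ∈ Set.Icc (0 : ℝ) 1, ∀ s ∈ Set.Icc (0 : ℝ) 1,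
      ∀ (n : ℕ) (p : ℤ), ‖G ((t + p) / 2 ^ n) - G ((s + p) / 2 ^ n)‖ ≤ C * θ ^ n := by
  obtain ⟨R, hR, hGR⟩ := hG.exists_pos_le_norm
  obtain ⟨B, hB⟩ := hGc.bounded_above_of_compact_support hG
  have hB0 : 0 ≤ B := (norm_nonneg _).trans (hB 0)
  obtain ⟨N, hN⟩ := exists_support_bound a
  set S : Set (ℤ →₀ (Fin r → ℂ)) := {u | ∃ t ∈ Set.Icc (0 : ℝ) 1, ∃ s ∈ Set.Icc (0 : ℝ) 1,
    u = samples hG t - samples hG s} with hS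
  have hdiff : ∀ (t s : ℝ) (n : ℕ) (p : ℤ), c ^ n •
      conv (iterMask a n) (samples hG t - samples hG s) p =
        G ((t + p) / 2 ^ n) - G ((s + p) / 2 ^ n) := by
    intro t s n p
    rw [← convL_apply, map_sub, smul_sub, convL_apply, convL_apply, h.conv_iterMask hG,
      h.conv_iterMask hG]
  have hT : ∀ ε : ℤ, ε = 0 ∨ ε = 1 → ∀ u ∈ Submodule.span ℂ S, transition a ε u ∈ Submodule.span ℂ S := by
    intro ε hε u hu
    induction hu using Submodule.span_induction with
    | zero => rw [map_zero]; exact Submodule.zero_mem _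
    | add u w _ _ hu hw => rw [map_add]; exact Submodule.add_mem _ hu hw
    | smul z u _ hu => rw [map_smul]; exact Submodule.smul_mem _ _ hu
    | mem u hu =>
      obtain ⟨t, ht, s, hs, rfl⟩ := hu
      have h1 : ∀ t, transition a ε (samples hG t) =
          ((c⁻¹ : ℝ) : ℂ) • samples hG ((t + ε) / 2) := by
        intro t
        rw [← h.transition_samples hG]
        ext k i
        simp only [Finsupp.smul_apply, Pi.smul_apply, Complex.real_smul, smul_eq_mul]
        rw [← mul_assoc, ← Complex.ofReal_mul, inv_mul_cancel₀ hc.ne', Complex.ofReal_one, one_mul]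
      rw [map_sub, h1, h1, ← smul_sub]
      refine Submodule.smul_mem _ _ (Submodule.subset_span ⟨_, ?_, _, ?_, rfl⟩)
      · obtain ⟨h0, h1⟩ := ht
        rcases hε with rfl | rfl <;> constructor <;> push_cast <;> linarith
      · obtain ⟨h0, h1⟩ := hs
        rcases hε with rfl | rfl <;> constructor <;> push_cast <;> linarith
  obtain ⟨C, θ, hC, hθ, hθ1, hdecay⟩ := conv_iterMask_decay a (Submodule.span ℂ S) (⌈R⌉₊ + 1) (by
      have : Submodule.span ℂ S ≤ supportedSubmodule r (⌈R⌉₊ + 1) := by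
        rw [Submodule.span_le]
        have h1 : ∀ t ∈ Set.Icc (0 : ℝ) 1, samples hG t ∈ supportedSubmodule r (⌈R⌉₊ + 1) := by
          intro t ht k hk
          have h1 : |t + k| < R := by
            by_contra h
            exact hk (hGR _ (not_lt.1 h))
          have h2 := Nat.le_ceil R
          have h3 : |(k : ℝ)| ≤ ((⌈R⌉₊ + 1 : ℕ) : ℝ) := by
            push_cast
            rw [abs_lt] at h1
            rw [abs_le]
            constructor <;> linarith [ht.1, ht.2]
          exact_mod_cast h3
        rintro _ ⟨t, ht, s, hs, rfl⟩
        exact Submodule.sub_mem _ (h1 t ht) (h1 s hs)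
      exact fun u hu => this hu)
    (hT 0 (Or.inl rfl)) (hT 1 (Or.inr rfl)) c hc (by
      intro u hu
      induction hu using Submodule.span_induction with
      | zero =>
        intro ε hε
        refine ⟨0, fun n _ k => ?_⟩
        rw [← convL_apply, map_zero, norm_zero, mul_zero]
        exact hε.le
      | add u w _ _ hu hw =>
        intro ε hε
        obtain ⟨n₁, h₁⟩ := hu (ε / 2) (half_pos hε)
        obtain ⟨n₂, h₂⟩ := hw (ε / 2) (half_pos hε)
        refine ⟨max n₁ n₂, fun n hn k => ?_⟩
        rw [← convL_apply, map_add, convL_apply, convL_apply]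
        have h3 := norm_add_le (conv (iterMask a n) u k) (conv (iterMask a n) w k)
        have h4 := mul_le_mul_of_nonneg_left h3 (pow_nonneg hc.le n)
        linarith [h₁ n (le_of_max_le_left hn) k, h₂ n (le_of_max_le_right hn) k]
      | smul z u _ hu =>
        intro ε hε
        obtain ⟨n₁, h₁⟩ := hu (ε / (‖z‖ + 1)) (by positivity)
        refine ⟨n₁, fun n hn k => ?_⟩
        rw [← convL_apply, map_smul, convL_apply, norm_smul]
        have h2 := h₁ n hn k
        rw [le_div_iff₀ (by positivity)] at h2
        have h3 : 0 ≤ c ^ n * ‖conv (iterMask a n) u k‖ := by positivity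
        nlinarith [norm_nonneg z]
      | mem u hu =>
        obtain ⟨t, ht, s, hs, rfl⟩ := hu
        intro ε hε
        obtain ⟨δ, hδ, hδ'⟩ := Metric.uniformContinuous_iff.1
          (hG.uniformContinuous_of_continuous hGc) ε hε
        obtain ⟨n₀, hn₀⟩ := exists_pow_lt_of_lt_one hδ (by norm_num : (1 / 2 : ℝ) < 1)
        refine ⟨n₀, fun n hn k => ?_⟩
        have h1 : c ^ n * ‖conv (iterMask a n) (samples hG t - samples hG s) k‖ =
            ‖G ((t + k) / 2 ^ n) - G ((s + k) / 2 ^ n)‖ := by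
          rw [← hdiff, norm_smul, Real.norm_of_nonneg (by positivity)]
        rw [h1, ← dist_eq_norm]
        refine (hδ' ?_).le
        rw [Real.dist_eq, ← sub_div, add_sub_add_right_eq_sub, abs_div,
          abs_of_pos (by positivity : (0 : ℝ) < 2 ^ n), div_eq_mul_one_div]
        have h2 : |t - s| ≤ 1 := by
          rw [abs_le]
          constructor <;> linarith [ht.1, ht.2, hs.1, hs.2]
        have h3 : (1 / 2 : ℝ) ^ n ≤ (1 / 2) ^ n₀ :=
          pow_le_pow_of_le_one (by norm_num) (by norm_num) hn
        rw [one_div_pow, one_div_pow] at h3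
        rw [one_div_pow] at hn₀
        have h4 : (0 : ℝ) < 1 / 2 ^ n := by positivity
        nlinarith)
  refine ⟨C * (2 * B), θ, by positivity, hθ, hθ1, fun t ht s hs n p => ?_⟩
  have h1 := hdecay _ (Submodule.subset_span ⟨t, ht, s, hs, rfl⟩) (2 * B) (fun k => by
    rw [Finsupp.sub_apply, samples_apply, samples_apply]
    exact (norm_sub_le _ _).trans (by linarith [hB (t + k), hB (s + k)])) n p
  rw [← hdiff, norm_smul, Real.norm_of_nonneg (by positivity)]
  linarith

/-- A continuous compactly supported solution of a refinement equation is Hölder continuous. -/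
theorem Refinable.exists_holder {a : ℤ →₀ Matrix (Fin r) (Fin r) ℂ} {c : ℝ} (hc : 0 < c)
    {G : ℝ → Fin r → ℂ} (h : Refinable a c G) (hGc : Continuous G) (hG : HasCompactSupport G) :
    ∃ C τ : ℝ, 0 ≤ C ∧ 0 < τ ∧ τ < 1 ∧ ∀ x y, ‖G x - G y‖ ≤ C * |x - y| ^ τ := by
  obtain ⟨C, θ, hC, hθ, hθ1, hd⟩ := h.exists_decay hc hGc hG
  obtain ⟨B, hB⟩ := hGc.bounded_above_of_compact_support hG
  have hB0 : 0 ≤ B := (norm_nonneg _).trans (hB 0)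
  -- Points at distance at most 2^{-n} lie in the same or in adjacent dyadic cells; in the second
  -- case the common endpoint serves as intermediate point.
  have hlocal : ∀ (n : ℕ) (x y : ℝ), x ≤ y → y - x ≤ (1 / 2) ^ n → ‖G x - G y‖ ≤ 2 * C * θ ^ n := by
    intro n x y hxy hn
    have hθn : 0 ≤ C * θ ^ n := by positivity
    have h2 : (0 : ℝ) < 2 ^ n := by positivity
    have hfl : ∀ z : ℝ, z = (Int.fract (2 ^ n * z) + ⌊2 ^ n * z⌋) / 2 ^ n := fun z => by
      rw [Int.fract_add_floor]
      field_simp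
    have hfm : ∀ z : ℝ, Int.fract (2 ^ n * z) ∈ Set.Icc (0 : ℝ) 1 := fun z =>
      ⟨Int.fract_nonneg _, (Int.fract_lt_one _).le⟩
    set p := ⌊2 ^ n * x⌋ with hp
    set q := ⌊2 ^ n * y⌋ with hq
    have hpq : p ≤ q := Int.floor_mono (by nlinarith)
    have hqp : q ≤ p + 1 := by
      rw [hp, ← Int.floor_add_one]
      refine Int.floor_mono ?_
      rw [one_div_pow, le_div_iff₀ h2] at hn
      linarith
    rw [hfl x, hfl y, ← hp, ← hq]
    rcases (by omega : q = p ∨ q = p + 1) with h1 | h1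
    · rw [h1]
      linarith [hd _ (hfm x) _ (hfm y) n p]
    · have e1 := hd _ (hfm x) 1 (by simp) n p
      have e2 := hd 0 (by simp) _ (hfm y) n q
      have e3 : (1 + (p : ℝ)) / 2 ^ n = (0 + (q : ℝ)) / 2 ^ n := by
        rw [h1]
        push_cast
        ring
      rw [e3] at e1
      linarith [norm_sub_le_norm_sub_add_norm_sub (G ((Int.fract (2 ^ n * x) + p) / 2 ^ n))
        (G ((0 + q) / 2 ^ n)) (G ((Int.fract (2 ^ n * y) + q) / 2 ^ n))]
  have hθ0 : 0 < θ := by linarith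
  -- The exponent is defined by θ = 2^{-τ}, so θ < 1 gives τ > 0 and θ > 1/2 gives τ < 1.
  set τ := -Real.logb 2 θ with hτ
  have hτθ : θ = (1 / 2) ^ τ := by
    rw [hτ, one_div, Real.inv_rpow two_pos.le, Real.rpow_neg two_pos.le, inv_inv,
      Real.rpow_logb two_pos (by norm_num) hθ0]
  have hτ0 : 0 < τ := neg_pos.2 (Real.logb_neg one_lt_two hθ0 hθ1)
  have hτ1 : τ < 1 := by
    have h1 := Real.logb_lt_logb one_lt_two (by norm_num : (0 : ℝ) < 1 / 2) hθ
    have h2 : Real.logb 2 (1 / 2) = -1 := by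
      rw [one_div, Real.logb_inv, Real.logb_self_eq_one one_lt_two]
    linarith
  have hmain : ∀ x y, x < y → ‖G x - G y‖ ≤ (2 * C / θ + 2 * B) * |x - y| ^ τ := by
    intro x y hxy
    rw [abs_sub_comm, abs_of_pos (sub_pos.2 hxy)]
    have hpos : 0 ≤ (y - x) ^ τ := Real.rpow_nonneg (sub_pos.2 hxy).le _
    rcases le_or_gt (y - x) 1 with h1 | h1
    · obtain ⟨n, hn1, hn2⟩ := exists_nat_pow_near_of_lt_one (sub_pos.2 hxy) h1
        (by norm_num : (0 : ℝ) < 1 / 2) (by norm_num)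
      have h3 : θ ^ (n + 1) ≤ (y - x) ^ τ := by
        rw [hτθ, ← Real.rpow_natCast, ← Real.rpow_mul (by norm_num), mul_comm τ,
          Real.rpow_mul (by norm_num), Real.rpow_natCast]
        exact Real.rpow_le_rpow (by positivity) hn1.le hτ0.le
      refine (hlocal n x y hxy.le hn2).trans ?_
      have h4 : 2 * C * θ ^ n = 2 * C / θ * θ ^ (n + 1) := by
        field_simp
        ring
      rw [h4, add_mul]
      have h5 : 2 * C / θ * θ ^ (n + 1) ≤ 2 * C / θ * (y - x) ^ τ :=
        mul_le_mul_of_nonneg_left h3 (by positivity)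
      have h6 : 0 ≤ 2 * B * (y - x) ^ τ := by positivity
      linarith
    · have h2 : 1 ≤ (y - x) ^ τ := Real.one_le_rpow h1.le hτ0.le
      have h3 : ‖G x - G y‖ ≤ 2 * B := (norm_sub_le _ _).trans (by linarith [hB x, hB y])
      have h4 : 0 ≤ 2 * C / θ := by positivity
      nlinarith
  refine ⟨2 * C / θ + 2 * B, τ, by positivity, hτ0, hτ1, fun x y => ?_⟩
  rcases lt_trichotomy x y with hxy | rfl | hxy
  · exact hmain x y hxy
  · rw [sub_self, norm_zero]
    positivity
  · rw [norm_sub_rev, abs_sub_comm]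
    exact hmain y x hxy

/-! ### Sufficiency: smoothness implies convergence -/

/-- The Lagrange scheme converges if the matrices `S_aⁿ (δ I_r)` converge uniformly to the samples
of a compactly supported matrix of `C^m` functions. -/
theorem lagrangeConvergent_of_uniform {a : ℤ →₀ Matrix (Fin r) (Fin r) ℂ} {m : ℕ}
    {F : Fin r → Fin r → ℝ → ℂ} (hF : ∀ i l, ContDiff ℝ m (F i l)) {R : ℕ}
    (hFR : ∀ i l x, (R : ℝ) ≤ |x| → F i l x = 0)
    (hlim : ∀ ε > 0, ∃ n₀ : ℕ, ∀ n ≥ n₀, ∀ k i l, ‖iterMask a n k i l - F i l (k / 2 ^ n)‖ ≤ ε) :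
    LagrangeConvergent a m := by
  obtain ⟨N, hN⟩ := exists_support_bound a
  intro w
  refine ⟨fun l x => ∑ᶠ j : ℤ, ∑ i, w j 0 i * F i l (x - j), fun l => ?_, fun K hK l => ?_⟩
  · rw [← contMDiff_iff_contDiff]
    refine contMDiff_finsum (fun j => ?_) fun x => ?_
    · rw [contMDiff_iff_contDiff]
      exact ContDiff.sum fun i _ => contDiff_const.mul ((hF i l).comp (contDiff_id.sub contDiff_const))
    · refine ⟨Metric.ball x 1, Metric.ball_mem_nhds x one_pos, ?_⟩
      refine (Set.finite_Icc (-⌈|x| + 1 + R⌉) ⌈|x| + 1 + R⌉).subset ?_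
      rintro j ⟨y, hy, hyx⟩
      rw [Metric.mem_ball, Real.dist_eq] at hyx
      have h1 : |y - j| < R := by
        by_contra h
        exact hy (Finset.sum_eq_zero fun i _ => by rw [hFR i l _ (not_lt.1 h), mul_zero])
      have h2 : |(j : ℝ)| ≤ |x| + 1 + R := by
        have e1 := abs_sub_abs_le_abs_sub (j : ℝ) y
        have e2 := abs_sub_abs_le_abs_sub y x
        rw [abs_sub_comm (j : ℝ)] at e1
        linarith
      have h3 := h2.trans (Int.le_ceil _)
      rw [abs_le] at h3
      exact ⟨by exact_mod_cast h3.1, by exact_mod_cast h3.2⟩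
  -- For |2^{-n}k| ≤ K, only data within K + N of the origin reach the iterates and only data within
  -- K + R reach the limit, so one finite window serves every n.
  · obtain ⟨M, hM⟩ := exists_nat_gt (K + N + R)
    set s := Finset.Icc (-(M : ℤ)) M with hs
    have hmem : ∀ j : ℤ, |(j : ℝ)| ≤ K + N + R → j ∈ s := by
      intro j hj
      have h1 := hj.trans hM.le
      rw [abs_le] at h1
      rw [hs, Finset.mem_Icc]
      exact ⟨by exact_mod_cast h1.1, by exact_mod_cast h1.2⟩
    set Q : ℝ := ∑ j ∈ s, ∑ i, ‖w j 0 i‖ with hQ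
    have hQ0 : 0 ≤ Q := by positivity
    rw [ENNReal.tendsto_nhds_zero]
    intro δ hδ
    rcases eq_or_ne δ ⊤ with rfl | hδt
    · simp
    obtain ⟨n₀, hn₀⟩ := hlim (δ.toReal / (Q + 1)) (div_pos (ENNReal.toReal_pos hδ.ne' hδt) (by linarith))
    filter_upwards [Filter.eventually_ge_atTop n₀] with n hn
    refine iSup₂_le fun k hk => ?_
    have h2n : (0 : ℝ) < 2 ^ n := by positivity
    have hk' : |(k : ℝ) / 2 ^ n| ≤ K := by
      rw [abs_div, abs_of_pos h2n, div_le_iff₀ h2n]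
      linarith
    have e1 : (subdivisionOp a)^[n] w k 0 l =
        ∑ j ∈ s, ∑ i, w j 0 i * iterMask a n (k - 2 ^ n * j) i l := by
      rw [iterate_subdivisionOp_eq_sum hN w n k s]
      · rw [Matrix.sum_apply]
        rfl
      · intro j hj
        refine hmem j ?_
        have h1 : |(k : ℝ) - 2 ^ n * j| ≤ (2 ^ n - 1) * N := by exact_mod_cast hj
        have h3 : |(j : ℝ)| * 2 ^ n ≤ (K + N) * 2 ^ n := by
          have e1 := abs_sub_abs_le_abs_sub (2 ^ n * j : ℝ) k
          rw [abs_sub_comm, abs_mul, abs_of_pos h2n] at e1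
          have : (0 : ℝ) ≤ N := by positivity
          nlinarith
        have h4 := le_of_mul_le_mul_right h3 h2n
        have : (0 : ℝ) ≤ R := by positivity
        linarith
    have e2 : ∑ᶠ j : ℤ, ∑ i, w j 0 i * F i l ((k : ℝ) / 2 ^ n - j) =
        ∑ j ∈ s, ∑ i, w j 0 i * F i l ((k : ℝ) / 2 ^ n - j) := by
      refine finsum_eq_sum_of_support_subset _ fun j hj => hmem j ?_
      have h1 : |(k : ℝ) / 2 ^ n - j| < R := by
        by_contra h
        exact hj (Finset.sum_eq_zero fun i _ => by rw [hFR i l _ (not_lt.1 h), mul_zero])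
      have e1 := abs_sub_abs_le_abs_sub (j : ℝ) ((k : ℝ) / 2 ^ n)
      rw [abs_sub_comm] at e1
      have : (0 : ℝ) ≤ N := by positivity
      linarith
    rw [e1, e2, ← Finset.sum_sub_distrib, ← ofReal_norm]
    refine ENNReal.ofReal_le_of_le_toReal ?_
    calc ‖∑ j ∈ s, (∑ i, w j 0 i * iterMask a n (k - 2 ^ n * j) i l -
            ∑ i, w j 0 i * F i l ((k : ℝ) / 2 ^ n - j))‖
        ≤ ∑ j ∈ s, ∑ i, ‖w j 0 i‖ * (δ.toReal / (Q + 1)) := by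
          refine (norm_sum_le _ _).trans (Finset.sum_le_sum fun j _ => ?_)
          rw [← Finset.sum_sub_distrib]
          refine (norm_sum_le _ _).trans (Finset.sum_le_sum fun i _ => ?_)
          rw [← mul_sub, norm_mul]
          refine mul_le_mul_of_nonneg_left ?_ (norm_nonneg _)
          have h5 := hn₀ n hn (k - 2 ^ n * j) i l
          have h6 : (((k - 2 ^ n * j : ℤ) : ℝ)) / 2 ^ n = (k : ℝ) / 2 ^ n - j := by
            push_cast
            field_simp
          rwa [h6] at h5
      _ = Q * (δ.toReal / (Q + 1)) := by simp only [← Finset.sum_mul, hQ]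
      _ ≤ δ.toReal := by
          rw [mul_div_assoc', div_le_iff₀ (by linarith)]
          nlinarith [ENNReal.toReal_nonneg (a := δ)]

theorem integral_cexp_comp (f : ℝ → ℂ) (k : ℤ) (ξ : ℝ) :
    ∫ x : ℝ, Complex.exp (-(Complex.I * x * ξ)) * f (2 * x - k) =
      2⁻¹ * (Complex.exp (-(Complex.I * k * (ξ / 2 : ℝ))) *
        ∫ x : ℝ, Complex.exp (-(Complex.I * x * (ξ / 2 : ℝ))) * f x) := by
  set H : ℝ → ℂ := fun y => Complex.exp (-(Complex.I * k * (ξ / 2 : ℝ))) *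
    (Complex.exp (-(Complex.I * y * (ξ / 2 : ℝ))) * f y) with hH
  have h1 : ∀ x : ℝ, Complex.exp (-(Complex.I * x * ξ)) * f (2 * x - k) = H (2 * x - k) := by
    intro x
    rw [hH]
    simp only
    rw [← mul_assoc, ← Complex.exp_add]
    congr 2
    push_cast
    ring
  simp only [h1]
  rw [Measure.integral_comp_mul_left (fun y => H (y - k)) 2, integral_sub_right_eq_self H,
    abs_of_pos (by norm_num : (0 : ℝ) < 2⁻¹), ← integral_const_mul]
  rw [Complex.real_smul, Complex.ofReal_inv, Complex.ofReal_ofNat]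

theorem integrable_cexp_mul {f : ℝ → ℂ} (hf : Continuous f) (hc : HasCompactSupport f) (ξ : ℝ) :
    Integrable fun x : ℝ => Complex.exp (-(Complex.I * x * ξ)) * f x := by
  refine Continuous.integrable_of_hasCompactSupport ?_ hc.mul_left
  exact (by fun_prop : Continuous fun x : ℝ => Complex.exp (-(Complex.I * x * ξ))).mul hf

theorem hasCompactSupport_comp_two_mul_sub {f : ℝ → ℂ} (hc : HasCompactSupport f) (k : ℤ) :
    HasCompactSupport fun x : ℝ => f (2 * x - k) :=
  hc.comp_homeomorph ((Homeomorph.mulLeft₀ (2 : ℝ) two_ne_zero).trans (Homeomorph.subRight (k : ℝ)))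

/-- The refinement equation in the Fourier domain implies the refinement equation. -/
theorem refinable_of_fourier {a : ℤ →₀ Matrix (Fin r) (Fin r) ℂ} {g : ℝ → Fin r → ℂ}
    (hg : ∀ i, Continuous fun x => g x i) (hc : ∀ i, HasCompactSupport fun x => g x i)
    (h : ∀ ξ : ℝ, (fun i => ∫ x : ℝ, Complex.exp (-(Complex.I * x * (2 * ξ : ℝ))) * g x i) =
      symbol a ξ *ᵥ fun i => ∫ x : ℝ, Complex.exp (-(Complex.I * x * ξ)) * g x i) :
    Refinable a 1 g := by
  -- The difference of the two sides is continuous, compactly supported and has vanishing Fourier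
  -- transform.
  have key : ∀ i, (fun x => g x i - ∑ k ∈ a.support, ∑ j, 2 * a k i j * g (2 * x - k) j) = 0 := by
    intro i
    have hck : ∀ (k : ℤ) (j : Fin r), Continuous fun x : ℝ => g (2 * x - k) j := fun k j =>
      (hg j).comp (by fun_prop : Continuous fun x : ℝ => 2 * x - k)
    have hterm : ∀ (k : ℤ) (j : Fin r) (ξ : ℝ), Integrable fun x : ℝ =>
        2 * a k i j * (Complex.exp (-(Complex.I * x * ξ)) * g (2 * x - k) j) := fun k j ξ =>
      (integrable_cexp_mul (hck k j) (hasCompactSupport_comp_two_mul_sub (hc j) k) ξ).const_mul _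
    refine eq_zero_of_integral_cexp_eq_zero ?_ ?_ fun ξ => ?_
    · exact (hg i).sub (continuous_finsetSum _ fun k _ => continuous_finsetSum _ fun j _ =>
        continuous_const.mul (hck k j))
    · obtain ⟨R, hR0, hR⟩ := (HasCompactSupport.intro' (f := g) (K := ⋃ i, tsupport fun x => g x i)
        (isCompact_iUnion fun i => (hc i)) ((isCompact_iUnion fun i => (hc i)).isClosed) (by
          intro x hx
          ext i
          rw [Set.mem_iUnion, not_exists] at hx
          exact image_eq_zero_of_notMem_tsupport (f := fun x => g x i) (hx i))).exists_pos_le_norm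
      obtain ⟨N, hN⟩ := exists_support_bound a
      refine HasCompactSupport.intro (isCompact_Icc (a := -(R + N)) (b := R + N)) fun x hx => ?_
      have hx' : R + N < |x| := by
        by_contra h
        exact hx (abs_le.1 (not_lt.1 h))
      have hN0 : (0 : ℝ) ≤ N := by positivity
      rw [hR x (by rw [Real.norm_eq_abs]; linarith), Pi.zero_apply, zero_sub, neg_eq_zero]
      refine Finset.sum_eq_zero fun k hk => Finset.sum_eq_zero fun j _ => ?_
      have h1 : |(k : ℝ)| ≤ N := by exact_mod_cast hN k (Finsupp.mem_support_iff.1 hk)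
      have h2 := abs_sub_abs_le_abs_sub (2 * x) (k : ℝ)
      rw [abs_mul, abs_two] at h2
      rw [hR _ (by rw [Real.norm_eq_abs]; linarith), Pi.zero_apply, mul_zero]
    · have e1 : ∀ x : ℝ, Complex.exp (-(Complex.I * x * ξ)) *
          (g x i - ∑ k ∈ a.support, ∑ j, 2 * a k i j * g (2 * x - k) j) =
          Complex.exp (-(Complex.I * x * ξ)) * g x i - ∑ k ∈ a.support, ∑ j,
            2 * a k i j * (Complex.exp (-(Complex.I * x * ξ)) * g (2 * x - k) j) := by
        intro x
        rw [mul_sub, Finset.mul_sum]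
        congr 1
        refine Finset.sum_congr rfl fun k _ => ?_
        rw [Finset.mul_sum]
        exact Finset.sum_congr rfl fun j _ => by ring
      simp only [e1]
      rw [integral_sub (integrable_cexp_mul (hg i) (hc i) ξ) (integrable_finsetSum _ fun k _ =>
        integrable_finsetSum _ fun j _ => hterm k j ξ), integral_finsetSum _ fun k _ =>
        integrable_finsetSum _ fun j _ => hterm k j ξ]
      have e2 := congrFun (h (ξ / 2)) i
      rw [mul_div_cancel₀ ξ two_ne_zero] at e2
      rw [e2, sub_eq_zero, symbol_eq_sum, Matrix.sum_mulVec, Finset.sum_apply]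
      refine Finset.sum_congr rfl fun k _ => ?_
      rw [integral_finsetSum _ fun j _ => hterm k j ξ, Matrix.smul_mulVec, Pi.smul_apply,
        Matrix.mulVec, dotProduct, smul_eq_mul, Finset.mul_sum]
      refine Finset.sum_congr rfl fun j _ => ?_
      rw [integral_const_mul, integral_cexp_comp (fun x => g x j)]
      ring
  intro x
  ext i
  have h1 := congrFun (key i) x
  rw [Pi.zero_apply, sub_eq_zero] at h1
  rw [h1, one_smul, Pi.smul_apply, Finset.sum_apply, smul_eq_mul, Finset.mul_sum]
  refine Finset.sum_congr rfl fun k _ => ?_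
  rw [Matrix.mulVec, dotProduct, Finset.mul_sum]
  exact Finset.sum_congr rfl fun j _ => by ring

theorem tendsto_floor_div (x : ℝ) :
    Filter.Tendsto (fun n : ℕ => ((⌊2 ^ n * x⌋ : ℤ) : ℝ) / 2 ^ n) Filter.atTop (nhds x) := by
  have h1 : Filter.Tendsto (fun n : ℕ => (1 / 2 : ℝ) ^ n) Filter.atTop (nhds 0) :=
    tendsto_pow_atTop_nhds_zero_of_lt_one (by norm_num) (by norm_num)
  rw [tendsto_iff_norm_sub_tendsto_zero]
  refine squeeze_zero (fun _ => norm_nonneg _) (fun n => ?_) h1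
  have h2 : (0 : ℝ) < 2 ^ n := by positivity
  have h3 := Int.floor_le (2 ^ n * x)
  have h4 := Int.lt_floor_add_one (2 ^ n * x)
  rw [Real.norm_eq_abs, one_div_pow, abs_le, div_sub' h2.ne', le_div_iff₀ h2, neg_mul,
    one_div_mul_cancel h2.ne', div_le_div_iff_of_pos_right h2]
  constructor <;> linarith

/-- The iterates on the integer samples are the dyadic values of g, so their decay forces g to
vanish by continuity. -/
theorem Refinable.eq_zero_of_decays {a : ℤ →₀ Matrix (Fin r) (Fin r) ℂ} {g : ℝ → Fin r → ℂ}
    (h : Refinable a 1 g) (hg : Continuous g) (hc : HasCompactSupport g)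
    (hd : Decays a (samples hc 0)) : g = 0 := by
  ext1 x
  have h1 := (hg.tendsto x).comp (tendsto_floor_div x)
  refine tendsto_nhds_unique h1 ?_
  rw [Pi.zero_apply, tendsto_zero_iff_norm_tendsto_zero, Metric.tendsto_atTop]
  intro ε hε
  obtain ⟨n₀, hn₀⟩ := hd (ε / 2) (half_pos hε)
  refine ⟨n₀, fun n hn => ?_⟩
  have h2 := hn₀ n hn ⌊2 ^ n * x⌋
  rw [h.conv_iterMask_one hc] at h2
  rw [Real.dist_eq, sub_zero, abs_of_nonneg (norm_nonneg _)]
  change ‖g _‖ < ε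
  linarith

/-- A contractive mask whose refinable vector is continuous has uniformly converging iterates. -/
theorem exists_uniform_limit {a : ℤ →₀ Matrix (Fin r) (Fin r) ℂ} {v : ℤ →₀ (Fin r → ℂ)}
    (hv : HasSumRules a (sumRuleOrder a) v) (hrho : rho a (sumRuleOrder a) v < 1)
    {g : ℝ → Fin r → ℂ} (hg : Continuous g) (hc : HasCompactSupport g) (hg0 : g ≠ 0)
    (h : Refinable a 1 g) : ∃ y : Fin r → ℂ, ∀ ε > 0, ∃ n₀ : ℕ, ∀ n ≥ n₀, ∀ k i l,
      ‖iterMask a n k i l - g (k / 2 ^ n) i * y l‖ ≤ ε := by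
  have hdec := decays_of_rho_lt_one hrho
  have hnd : ¬ Decays a (samples hc 0) := fun hd => hg0 (h.eq_zero_of_decays hg hc hd)
  -- For order 0 there is no moment condition, so all sequences would decay, including the samples
  -- of g.
  have hsr : 1 ≤ sumRuleOrder a := by
    by_contra hcon
    refine hnd (hdec _ (mem_moments_iff.2 fun j hj => ?_))
    omega
  have hdec1 := decays_of_mem_moments hv hdec le_rfl hsr
  have hU1 : ∀ u, symbol v 0 ⬝ᵥ symbol u 0 = 0 → Decays a u := by
    refine fun u hu => hdec1 u (mem_moments_iff.2 fun j hj => ?_)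
    obtain rfl : j = 0 := by omega
    rw [momentL_zero, hu]
  set c := symbol v 0 ⬝ᵥ symbol (samples hc 0) 0 with hcdef
  have hc0 : c ≠ 0 := fun h0 => hnd (hU1 _ h0)
  refine ⟨fun l => symbol v 0 l / c, fun ε hε => ?_⟩
  -- The coefficient makes the zeroth moment of the difference vanish. The samples reproduce g,
  -- which yields the limit g(x) v̂_l(0)/c for the l-th column.
  have hcol : ∀ l, Decays a (Finsupp.single 0 (Pi.single l 1) -
      (symbol v 0 l / c) • samples hc 0) := by
    intro l
    refine hU1 _ ?_
    rw [← symbolL_apply 0 (_ - _), map_sub, map_smul, symbolL_apply, symbolL_apply, symbol_single,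
      dotProduct_sub, dotProduct_smul, dotProduct_smul, ← hcdef, smul_eq_mul,
      smul_eq_mul, div_mul_cancel₀ _ hc0]
    simp
  choose n₀ hn₀ using fun l => hcol l ε hε
  refine ⟨Finset.univ.sup n₀, fun n hn k i l => ?_⟩
  have h1 := hn₀ l n ((Finset.le_sup (Finset.mem_univ l)).trans hn) k
  rw [← convL_apply, map_sub, map_smul, convL_apply, convL_apply, conv_single,
    h.conv_iterMask_one hc] at h1
  have h2 := (norm_le_pi_norm _ i).trans h1
  simpa [mul_comm] using h2

/-- Transfers the hypotheses on φ to its C^m representative: continuity upgrades the support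
condition to pointwise vanishing, and the Fourier relation becomes a pointwise refinement equation.
-/
theorem lagrangeConvergent_of_smoothness {a : ℤ →₀ Matrix (Fin r) (Fin r) ℂ} {m : ℕ}
    {φ : Fin r → 𝓢'(ℝ, ℂ)} (hφ_supp : ∀ i, IsCompact (Distribution.dsupport (φ i)))
    (hφ_ref : ∀ ξ : ℝ, fourierVec φ (2 * ξ) = symbol a ξ *ᵥ fourierVec φ ξ)
    (hφ_zero : fourierVec φ 0 ≠ 0) {v : ℤ →₀ (Fin r → ℂ)}
    (hv : HasSumRules a (sumRuleOrder a) v) (hsa : 0 < smMask a v)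
    (hsφ : ((m : ℝ) : EReal) < smVec φ) : LagrangeConvergent a m := by
  have h1 : ∀ i, ∃ (g : ℝ → ℂ) (hg : MemLp g ∞ volume), ContDiff ℝ m g ∧
      Lp.toTemperedDistribution (hg.toLp g) = φ i := fun i =>
    exists_contDiff_of_lt_smDist (hsφ.trans_le (iInf_le _ i))
  choose g hgL hgm hgφ using h1
  choose n hn using fun i => exists_vanishesOff (hφ_supp i)
  set M := Finset.univ.sup n with hM
  have hgM : ∀ i x, (M : ℝ) + 1 ≤ |x| → g i x = 0 := by
    intro i x hx
    have h2 := (hn i).mono (Finset.le_sup (Finset.mem_univ i) : n i ≤ M)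
    rw [← hgφ i] at h2
    exact h2.eq_zero_of_continuous (hgL i) (hgm i).continuous hx
  have hgc : ∀ i, HasCompactSupport (g i) := fun i =>
    HasCompactSupport.intro (isCompact_Icc (a := -((M : ℝ) + 1)) (b := M + 1)) fun x hx =>
      hgM i x (le_of_lt (by by_contra h; exact hx (abs_le.1 (not_lt.1 h))))
  have hfour : ∀ ξ i, fourierVec φ ξ i = ∫ x : ℝ, Complex.exp (-(Complex.I * x * ξ)) * g i x := by
    intro ξ i
    rw [fourierVec, ← hgφ i]
    exact distFourier_toTemperedDistribution (hgL i) (hgM i) ξ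
  set G : ℝ → Fin r → ℂ := fun x i => g i x with hG
  have hGc : Continuous G := continuous_pi fun i => (hgm i).continuous
  have hGs : HasCompactSupport G :=
    HasCompactSupport.intro (isCompact_Icc (a := -((M : ℝ) + 1)) (b := M + 1)) fun x hx =>
      funext fun i => hgM i x (le_of_lt (by by_contra h; exact hx (abs_le.1 (not_lt.1 h))))
  have href : Refinable a 1 G := by
    refine refinable_of_fourier (fun i => (hgm i).continuous) hgc fun ξ => ?_
    have h2 := hφ_ref ξ
    rw [funext (hfour (2 * ξ)), funext (hfour ξ)] at h2
    exact h2
  have hG0 : G ≠ 0 := by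
    intro h0
    refine hφ_zero (funext fun i => ?_)
    rw [hfour]
    have h2 : ∀ x, g i x = 0 := fun x => congrFun (congrFun h0 x) i
    simp [h2]
  obtain ⟨y, hy⟩ := exists_uniform_limit hv ((zero_lt_smMask_iff a v).1 hsa) hGc hGs hG0 href
  refine lagrangeConvergent_of_uniform (F := fun i l x => g i x * y l) (R := M + 1)
    (fun i l => (hgm i).mul contDiff_const) (fun i l x hx => ?_) hy
  rw [hgM i x (by exact_mod_cast hx), zero_mul]

/-! ### Necessity: the limit matrix of a convergent scheme -/

/-- The matrices `S_aⁿ (δ I_r)(k)` are uniformly close to `F(2⁻ⁿ k)`. -/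
def IsUniformLimit (a : ℤ →₀ Matrix (Fin r) (Fin r) ℂ) (F : Fin r → Fin r → ℝ → ℂ) : Prop :=
  ∀ ε > 0, ∃ n₀ : ℕ, ∀ n ≥ n₀, ∀ k i l, ‖iterMask a n k i l - F i l (k / 2 ^ n)‖ ≤ ε

theorem iterate_subdivisionOp_single (a : ℤ →₀ Matrix (Fin r) (Fin r) ℂ) (i l : Fin r) (n : ℕ)
    (k : ℤ) : (subdivisionOp a)^[n]
      (Pi.single 0 (Matrix.of fun _ : Fin 1 => Pi.single i 1)) k 0 l = iterMask a n k i l := by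
  obtain ⟨N, hN⟩ := exists_support_bound a
  have hs : ∀ j : ℤ, |k - 2 ^ n * j| ≤ (2 ^ n - 1) * N →
      j ∈ insert 0 (Finset.Icc (-(|k| + N)) (|k| + N)) := by
    intro j hj
    refine Finset.mem_insert_of_mem (Finset.mem_Icc.2 (abs_le.1 ?_))
    have h1 := abs_sub_abs_le_abs_sub (2 ^ n * j) k
    have h2 : (1 : ℤ) ≤ 2 ^ n := one_le_pow₀ (by norm_num)
    rw [abs_sub_comm, abs_mul, abs_of_pos (by positivity : (0 : ℤ) < 2 ^ n)] at h1
    have h3 : 2 ^ n * |j| ≤ 2 ^ n * (|k| + N) := by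
      have : (0 : ℤ) ≤ N := by positivity
      nlinarith [abs_nonneg k]
    exact le_of_mul_le_mul_left h3 (by positivity)
  rw [iterate_subdivisionOp_eq_sum hN _ n k _ hs, Finset.sum_eq_single_of_mem 0 (by simp)]
  · simp [Matrix.mul_apply, Pi.single_apply]
  · intro j _ hj
    rw [Pi.single_eq_of_ne hj, Matrix.zero_mul]

theorem tendsto_of_enorm_iSup {a : ℤ →₀ Matrix (Fin r) (Fin r) ℂ} {f : ℝ → ℂ} {i l : Fin r} {K : ℝ}
    (h : Filter.Tendsto (fun n : ℕ => ⨆ (k : ℤ) (_ : |(k : ℝ)| ≤ 2 ^ n * K),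
      ‖iterMask a n k i l - f ((k : ℝ) / 2 ^ n)‖ₑ) Filter.atTop (nhds 0)) {ε : ℝ} (hε : 0 < ε) :
    ∃ n₀ : ℕ, ∀ n ≥ n₀, ∀ k : ℤ, |(k : ℝ)| ≤ 2 ^ n * K →
      ‖iterMask a n k i l - f ((k : ℝ) / 2 ^ n)‖ ≤ ε := by
  rw [ENNReal.tendsto_nhds_zero] at h
  obtain ⟨n₀, hn₀⟩ := Filter.eventually_atTop.1 (h (ENNReal.ofReal ε) (ENNReal.ofReal_pos.2 hε))
  refine ⟨n₀, fun n hn k hk => ?_⟩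
  have h1 := (le_iSup₂ (f := fun (k : ℤ) (_ : |(k : ℝ)| ≤ 2 ^ n * K) =>
    ‖iterMask a n k i l - f ((k : ℝ) / 2 ^ n)‖ₑ) k hk).trans (hn₀ n hn)
  rw [← ofReal_norm] at h1
  exact (ENNReal.ofReal_le_ofReal_iff hε.le).1 h1

/-- The data δe_i produce the rows of the iterates. After scaling these live in [-N, N], so F
vanishes outside and convergence on the window K = N + 1 is already uniform over all of ℤ. -/
theorem LagrangeConvergent.exists_isUniformLimit {a : ℤ →₀ Matrix (Fin r) (Fin r) ℂ} {m : ℕ}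
    (h : LagrangeConvergent a m) : ∃ F : Fin r → Fin r → ℝ → ℂ, (∀ i l, ContDiff ℝ m (F i l)) ∧
      (∃ R : ℕ, ∀ i l x, (R : ℝ) ≤ |x| → F i l x = 0) ∧ IsUniformLimit a F := by
  choose F hF hlim using fun i : Fin r => h (Pi.single 0 (Matrix.of fun _ : Fin 1 => Pi.single i 1))
  simp only [iterate_subdivisionOp_single] at hlim
  obtain ⟨N, hN⟩ := exists_support_bound a
  have hsupp : ∀ (n : ℕ) (k : ℤ), (N : ℝ) < |(k : ℝ) / 2 ^ n| → iterMask a n k = 0 := by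
    intro n k hk
    by_contra h0
    exact absurd (iterMask_support' hN n k h0) (not_le.2 hk)
  have hzero : ∀ i l x, (N : ℝ) < |x| → F i l x = 0 := by
    intro i l x hx
    have hfl := tendsto_floor_div x
    have h1 := ((hF i l).continuous.tendsto x).comp hfl
    refine tendsto_nhds_unique h1 ?_
    have hK : 0 < |x| + 1 := by positivity
    have ev1 : ∀ᶠ n : ℕ in Filter.atTop, (N : ℝ) < |((⌊2 ^ n * x⌋ : ℤ) : ℝ) / 2 ^ n| :=
      hfl.abs.eventually (lt_mem_nhds hx)
    have ev2 : ∀ᶠ n : ℕ in Filter.atTop, |((⌊2 ^ n * x⌋ : ℤ) : ℝ) / 2 ^ n| < |x| + 1 :=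
      hfl.abs.eventually (gt_mem_nhds (lt_add_one _))
    rw [Metric.tendsto_nhds]
    intro ε hε
    obtain ⟨n₀, hn₀⟩ := tendsto_of_enorm_iSup (hlim i _ hK l) (half_pos hε)
    filter_upwards [ev1, ev2, Filter.eventually_ge_atTop n₀] with n h2 h3 h4
    have h2n : (0 : ℝ) < 2 ^ n := by positivity
    have h5 := hn₀ n h4 ⌊2 ^ n * x⌋ (by
      rw [abs_div, abs_of_pos h2n, div_lt_iff₀ h2n] at h3
      linarith)
    rw [hsupp n _ h2, Matrix.zero_apply, zero_sub, norm_neg] at h5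
    rw [dist_zero_right]
    change ‖F i l _‖ < ε
    linarith
  refine ⟨F, hF, ⟨N + 1, fun i l x hx => hzero i l x ?_⟩, fun ε hε => ?_⟩
  · push_cast at hx
    linarith
  · choose n₀ hn₀ using fun i l => tendsto_of_enorm_iSup
      (hlim i (N + 1) (by positivity) l) hε
    refine ⟨Finset.univ.sup fun i => Finset.univ.sup (n₀ i), fun n hn k i l => ?_⟩
    have h2n : (0 : ℝ) < 2 ^ n := by positivity
    by_cases hk : |(k : ℝ)| ≤ 2 ^ n * (N + 1)
    · refine hn₀ i l n ?_ k hk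
      exact ((Finset.le_sup (f := n₀ i) (Finset.mem_univ l)).trans (Finset.le_sup
        (f := fun i => Finset.univ.sup (n₀ i)) (Finset.mem_univ i))).trans hn
    · have h1 : (N : ℝ) < |(k : ℝ) / 2 ^ n| := by
        rw [abs_div, abs_of_pos h2n, lt_div_iff₀ h2n]
        nlinarith
      rw [hsupp n k h1, hzero i l _ h1, Matrix.zero_apply, sub_zero, norm_zero]
      exact hε.le

theorem IsUniformLimit.tendsto {a : ℤ →₀ Matrix (Fin r) (Fin r) ℂ} {F : Fin r → Fin r → ℝ → ℂ}
    (h : IsUniformLimit a F) (hF : ∀ i l, Continuous (F i l)) {x : ℝ} {k : ℕ → ℤ}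
    (hk : Filter.Tendsto (fun n => (k n : ℝ) / 2 ^ n) Filter.atTop (nhds x)) (i l : Fin r) :
    Filter.Tendsto (fun n => iterMask a n (k n) i l) Filter.atTop (nhds (F i l x)) := by
  have h1 : Filter.Tendsto (fun n => iterMask a n (k n) i l - F i l (k n / 2 ^ n)) Filter.atTop
      (nhds 0) := by
    rw [Metric.tendsto_atTop]
    intro ε hε
    obtain ⟨n₀, hn₀⟩ := h (ε / 2) (half_pos hε)
    refine ⟨n₀, fun n hn => ?_⟩
    rw [dist_zero_right]
    linarith [hn₀ n hn (k n) i l]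
  have h2 := h1.add (((hF i l).tendsto x).comp hk)
  rw [zero_add] at h2
  refine h2.congr fun n => ?_
  simp

theorem tendsto_const_div_two_pow (c : ℝ) :
    Filter.Tendsto (fun n : ℕ => c / 2 ^ n) Filter.atTop (nhds 0) := by
  have h1 : Filter.Tendsto (fun n : ℕ => c * (1 / 2 : ℝ) ^ n) Filter.atTop (nhds (c * 0)) :=
    (tendsto_pow_atTop_nhds_zero_of_lt_one (by norm_num) (by norm_num)).const_mul c
  rw [mul_zero] at h1
  refine h1.congr fun n => ?_
  rw [one_div_pow]
  ring

/-- The limit matrix satisfies the refinement equation. -/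
theorem IsUniformLimit.refinement {a : ℤ →₀ Matrix (Fin r) (Fin r) ℂ} {F : Fin r → Fin r → ℝ → ℂ}
    (h : IsUniformLimit a F) (hF : ∀ i l, Continuous (F i l)) (x : ℝ) (i l : Fin r) :
    F i l x = 2 * ∑ k ∈ a.support, ∑ j, a k i j * F j l (2 * x - k) := by
  have h1 : Filter.Tendsto (fun n : ℕ => iterMask a (n + 1) ⌊2 ^ (n + 1) * x⌋ i l) Filter.atTop
      (nhds (F i l x)) :=
    (h.tendsto hF (tendsto_floor_div x) i l).comp (Filter.tendsto_add_atTop_nat 1)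
  refine tendsto_nhds_unique h1 ?_
  simp only [iterMask_succ', Matrix.smul_apply, Matrix.sum_apply, Matrix.mul_apply, smul_eq_mul]
  refine Filter.Tendsto.const_mul _ (tendsto_finsetSum _ fun k _ => tendsto_finsetSum _ fun j _ =>
    Filter.Tendsto.const_mul _ (h.tendsto hF ?_ j l))
  have h2 : Filter.Tendsto (fun n : ℕ => 2 * (((⌊2 ^ (n + 1) * x⌋ : ℤ) : ℝ) / 2 ^ (n + 1)) - k)
      Filter.atTop (nhds (2 * x - k)) :=
    (((tendsto_floor_div x).comp (Filter.tendsto_add_atTop_nat 1)).const_mul 2).sub_const _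
  refine h2.congr fun n => ?_
  push_cast
  rw [pow_succ]
  field_simp

/-- The rows of the limit matrix are fixed by the even and the odd coset sums of the mask. -/
theorem IsUniformLimit.row_eq {a : ℤ →₀ Matrix (Fin r) (Fin r) ℂ} {F : Fin r → Fin r → ℝ → ℂ}
    (h : IsUniformLimit a F) (hF : ∀ i l, Continuous (F i l)) (x : ℝ) (i l : Fin r) (ε : ℤ) :
    F i l x = 2 * ∑ k ∈ a.support, if 2 ∣ ε - k then ∑ j, F i j x * a k j l else 0 := by
  have hlim : Filter.Tendsto (fun n : ℕ => ((2 * ⌊2 ^ n * x⌋ + ε : ℤ) : ℝ) / 2 ^ (n + 1))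
      Filter.atTop (nhds x) := by
    have h2 := (tendsto_floor_div x).add (tendsto_const_div_two_pow (ε / 2))
    rw [add_zero] at h2
    refine h2.congr fun n => ?_
    push_cast
    rw [pow_succ]
    field_simp
  have h1 : Filter.Tendsto (fun n : ℕ => iterMask a (n + 1) (2 * ⌊2 ^ n * x⌋ + ε) i l) Filter.atTop
      (nhds (F i l x)) := by
    -- Reindexes to level n; the truncated subtraction at n = 0 does not affect the limit.
    have h3 : Filter.Tendsto (fun n : ℕ => ((2 * ⌊2 ^ (n - 1) * x⌋ + ε : ℤ) : ℝ) / 2 ^ n)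
        Filter.atTop (nhds x) := by
      rw [← Filter.tendsto_add_atTop_iff_nat 1]
      simpa using hlim
    have h4 := (h.tendsto hF h3 i l).comp (Filter.tendsto_add_atTop_nat 1)
    refine h4.congr fun n => ?_
    simp
  refine tendsto_nhds_unique h1 ?_
  have h5 : ∀ n : ℕ, iterMask a (n + 1) (2 * ⌊2 ^ n * x⌋ + ε) i l = 2 * ∑ k ∈ a.support,
      if 2 ∣ ε - k then ∑ j, iterMask a n (⌊2 ^ n * x⌋ + (ε - k) / 2) i j * a k j l else 0 := by
    intro n
    rw [iterMask_succ, subdivisionOp_apply, Matrix.smul_apply, Matrix.sum_apply, smul_eq_mul]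
    congr 1
    refine Finset.sum_congr rfl fun k _ => ?_
    by_cases hk : 2 ∣ ε - k
    · have hk' : 2 ∣ 2 * ⌊2 ^ n * x⌋ + ε - k := by omega
      have hk2 : (2 * ⌊2 ^ n * x⌋ + ε - k) / 2 = ⌊2 ^ n * x⌋ + (ε - k) / 2 := by omega
      rw [if_pos hk, if_pos hk', hk2, Matrix.mul_apply]
    · have hk' : ¬ 2 ∣ 2 * ⌊2 ^ n * x⌋ + ε - k := by omega
      rw [if_neg hk, if_neg hk', Matrix.zero_apply]
  simp only [h5]
  refine Filter.Tendsto.const_mul _ (tendsto_finsetSum _ fun k _ => ?_)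
  split_ifs
  · refine tendsto_finsetSum _ fun j _ => Filter.Tendsto.mul_const _ (h.tendsto hF ?_ i j)
    have h2 := (tendsto_floor_div x).add (tendsto_const_div_two_pow ((ε - k) / 2 : ℤ))
    rw [add_zero] at h2
    refine h2.congr fun n => ?_
    push_cast
    rw [add_div]
  · exact tendsto_const_nhds

/-- Neighbouring entries of the iterates share the same limit, so each row reproduces itself on both
cosets. Adding the two identities gives the eigenvector equation for â(0); subtracting them, as in
the next theorem, gives annihilation by â(π). -/
theorem IsUniformLimit.vecMul_symbol_zero {a : ℤ →₀ Matrix (Fin r) (Fin r) ℂ}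
    {F : Fin r → Fin r → ℝ → ℂ} (h : IsUniformLimit a F) (hF : ∀ i l, Continuous (F i l)) (x : ℝ)
    (i : Fin r) : (fun l => F i l x) ᵥ* symbol a 0 = fun l => F i l x := by
  ext l
  have e0 := h.row_eq hF x i l 0
  have e1 := h.row_eq hF x i l 1
  have e2 : ((fun l => F i l x) ᵥ* symbol a 0) l = ∑ k ∈ a.support, ∑ j, F i j x * a k j l := by
    rw [symbol_zero, Matrix.vecMul, dotProduct]
    simp only [Matrix.sum_apply, Finset.mul_sum]
    rw [Finset.sum_comm]
  have e3 : F i l x + F i l x = 2 * ∑ k ∈ a.support, ∑ j, F i j x * a k j l := by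
    nth_rw 1 [e0]
    nth_rw 1 [e1]
    rw [← mul_add, ← Finset.sum_add_distrib]
    congr 1
    refine Finset.sum_congr rfl fun k _ => ?_
    rcases Int.even_or_odd' k with ⟨p, rfl | rfl⟩
    · rw [if_pos (by omega), if_neg (by omega), add_zero]
    · rw [if_neg (by omega), if_pos (by omega), zero_add]
  rw [e2]
  linear_combination -e3 / 2

theorem IsUniformLimit.vecMul_symbol_pi {a : ℤ →₀ Matrix (Fin r) (Fin r) ℂ}
    {F : Fin r → Fin r → ℝ → ℂ} (h : IsUniformLimit a F) (hF : ∀ i l, Continuous (F i l)) (x : ℝ)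
    (i : Fin r) : (fun l => F i l x) ᵥ* symbol a Real.pi = 0 := by
  ext l
  have e0 := h.row_eq hF x i l 0
  have e1 := h.row_eq hF x i l 1
  have e2 : ((fun l => F i l x) ᵥ* symbol a Real.pi) l =
      ∑ k ∈ a.support, (-1) ^ k * ∑ j, F i j x * a k j l := by
    rw [symbol_eq_sum, Matrix.vecMul, dotProduct]
    simp only [Matrix.sum_apply, Finset.mul_sum]
    rw [Finset.sum_comm]
    refine Finset.sum_congr rfl fun k _ => Finset.sum_congr rfl fun j _ => ?_
    rw [Matrix.smul_apply, exp_neg_pi, smul_eq_mul]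
    ring
  have e3 : F i l x - F i l x = 2 * ∑ k ∈ a.support, (-1) ^ k * ∑ j, F i j x * a k j l := by
    nth_rw 1 [e0]
    nth_rw 1 [e1]
    rw [← mul_sub, ← Finset.sum_sub_distrib]
    congr 1
    refine Finset.sum_congr rfl fun k _ => ?_
    rcases Int.even_or_odd' k with ⟨p, rfl | rfl⟩
    · rw [if_pos (by omega), if_neg (by omega), sub_zero, Even.neg_one_zpow (by simp), one_mul]
    · rw [if_neg (by omega), if_pos (by omega), zero_sub, Odd.neg_one_zpow (by simp), neg_one_mul]
  rw [e2, Pi.zero_apply]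
  linear_combination -e3 / 2

theorem finite_support_iterMask (a : ℤ →₀ Matrix (Fin r) (Fin r) ℂ) (n : ℕ) :
    (Function.support (iterMask a n)).Finite := by
  obtain ⟨N, hN⟩ := exists_support_bound a
  exact (Set.finite_Icc _ _).subset fun k hk => abs_le.1 (iterMask_support hN n k hk)

/-! ### Necessity: identifying φ with the limit function -/

/-- Iterating the refinement equation in the Fourier domain. -/
theorem iterate_fourier {a : ℤ →₀ Matrix (Fin r) (Fin r) ℂ} {f : ℝ → Fin r → ℂ}
    (hf : ∀ ξ : ℝ, f (2 * ξ) = symbol a ξ *ᵥ f ξ) (n : ℕ) (ξ : ℝ) :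
    (2 : ℂ) ^ n • f (2 ^ n * ξ) =
      ∑' k : ℤ, Complex.exp (-(Complex.I * k * ξ)) • (iterMask a n k *ᵥ f ξ) := by
  induction n with
  | zero =>
    rw [tsum_eq_single 0]
    · simp [iterMask, diracId]
    · intro k hk
      simp [iterMask, diracId, hk]
  | succ n ih =>
    set h : ℤ → Fin r → ℂ := fun k => Complex.exp (-(Complex.I * k * ξ)) • (iterMask a n k *ᵥ f ξ)
      with hh
    set L : ℤ → (Fin r → ℂ) →L[ℂ] (Fin r → ℂ) := fun j => LinearMap.toContinuousLinearMap
      ((2 * Complex.exp (-(Complex.I * j * (2 ^ n * ξ : ℝ)))) • (a j).mulVecLin) with hL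
    have hLapply : ∀ j w, L j w = (2 * Complex.exp (-(Complex.I * j * (2 ^ n * ξ : ℝ)))) •
        (a j *ᵥ w) := fun j w => rfl
    have hs : Summable h := by
      refine summable_of_hasFiniteSupport ((finite_support_iterMask a n).subset fun k hk => ?_)
      intro h0
      exact hk (by rw [hh]; simp only [h0, Matrix.zero_mulVec, smul_zero])
    have h1 : ∀ k : ℤ, Complex.exp (-(Complex.I * k * ξ)) • (iterMask a (n + 1) k *ᵥ f ξ) =
        ∑ j ∈ a.support, L j (h (k - 2 ^ n * j)) := by
      intro k
      rw [iterMask_succ', Matrix.smul_mulVec, Matrix.sum_mulVec, Finset.smul_sum, Finset.smul_sum]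
      refine Finset.sum_congr rfl fun j _ => ?_
      rw [hLapply, hh]
      simp only
      rw [Matrix.mulVec_smul, smul_smul, smul_smul, ← Matrix.mulVec_mulVec]
      congr 1
      rw [mul_assoc 2, ← Complex.exp_add, mul_comm]
      congr 2
      push_cast
      ring
    have hs' : ∀ j : ℤ, Summable fun k : ℤ => h (k - 2 ^ n * j) := fun j =>
      (Equiv.subRight (2 ^ n * j)).summable_iff.2 hs
    simp only [h1]
    rw [Summable.tsum_finsetSum (f := fun j k => L j (h (k - 2 ^ n * j))) fun j _ =>
      (hs' j).map (L j) (L j).continuous]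
    have h2 : ∀ j ∈ a.support, ∑' k : ℤ, L j (h (k - 2 ^ n * j)) =
        L j ((2 : ℂ) ^ n • f (2 ^ n * ξ)) := by
      intro j _
      rw [← (L j).map_tsum (hs' j), ih]
      congr 1
      exact (Equiv.subRight (2 ^ n * j)).tsum_eq h
    rw [Finset.sum_congr rfl h2, pow_succ' (2 : ℝ), mul_assoc, hf, symbol_eq_sum, Matrix.sum_mulVec,
      Finset.smul_sum]
    refine Finset.sum_congr rfl fun j _ => ?_
    rw [hLapply, Matrix.smul_mulVec, smul_smul, Matrix.mulVec_smul, smul_smul]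
    congr 1
    push_cast
    ring

theorem integral_floor {h : ℤ → ℂ} (hh : (Function.support h).Finite) :
    ∫ t : ℝ, h ⌊t⌋ = ∑' k, h k := by
  have h1 : ∀ t : ℝ, h ⌊t⌋ = ∑ k ∈ hh.toFinset,
      (Set.Ico (k : ℝ) (k + 1)).indicator (fun _ => h k) t := by
    intro t
    rw [Finset.sum_eq_single ⌊t⌋]
    · rw [Set.indicator_of_mem]
      exact ⟨Int.floor_le t, Int.lt_floor_add_one t⟩
    · intro k _ hk
      rw [Set.indicator_of_notMem]
      intro hmem
      exact hk (Int.floor_eq_iff.2 hmem).symm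
    · intro hk
      rw [Set.Finite.mem_toFinset, Function.notMem_support] at hk
      rw [hk]
      simp
  simp only [h1]
  rw [integral_finsetSum]
  · rw [tsum_eq_sum (s := hh.toFinset) fun k hk => by simpa using hk]
    refine Finset.sum_congr rfl fun k _ => ?_
    rw [integral_indicator measurableSet_Ico]
    simp
  · intro k _
    exact (integrable_indicator_iff measurableSet_Ico).2 (by simp)

theorem integral_floor_two_pow {h : ℤ → ℂ} (hh : (Function.support h).Finite) (n : ℕ) :
    (2 : ℂ) ^ n * ∫ t : ℝ, h ⌊2 ^ n * t⌋ = ∑' k, h k := by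
  rw [Measure.integral_comp_mul_left (fun t => h ⌊t⌋) (2 ^ n), integral_floor hh,
    abs_of_pos (by positivity), Complex.real_smul]
  push_cast
  rw [mul_inv_cancel_left₀ (pow_ne_zero n two_ne_zero)]

/-- The Fourier transform of the refinable distribution is the one of the limit function. -/
theorem IsUniformLimit.fourier_eq {a : ℤ →₀ Matrix (Fin r) (Fin r) ℂ} {F : Fin r → Fin r → ℝ → ℂ}
    (h : IsUniformLimit a F) (hF : ∀ i l, Continuous (F i l))
    (hc : ∀ i l, HasCompactSupport (F i l)) {f : ℝ → Fin r → ℂ}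
    (hf : ∀ ξ : ℝ, f (2 * ξ) = symbol a ξ *ᵥ f ξ)
    (hf0 : Filter.Tendsto f (nhds 0) (nhds (f 0))) (ξ : ℝ) (i : Fin r) :
    f ξ i = ∫ t : ℝ, Complex.exp (-(Complex.I * t * ξ)) * ∑ l, F i l t * f 0 l := by
  obtain ⟨N, hN⟩ := exists_support_bound a
  -- A step function on the dyadic cells of length 2^{-n} whose integral is exactly f(ξ) for every
  -- n, by iterating the refinement relation. Pointwise it converges to the integrand on the right,
  -- since f(ξ/2ⁿ) → f(0).
  set S : ℕ → ℝ → ℂ := fun n t => Complex.exp (-(Complex.I * ⌊2 ^ n * t⌋ * (ξ / 2 ^ n : ℝ))) *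
    ∑ l, iterMask a n ⌊2 ^ n * t⌋ i l * f (ξ / 2 ^ n) l with hS
  have hSint : ∀ n, ∫ t, S n t = f ξ i := by
    intro n
    set hn : ℤ → ℂ := fun k => Complex.exp (-(Complex.I * k * (ξ / 2 ^ n : ℝ))) *
      ∑ l, iterMask a n k i l * f (ξ / 2 ^ n) l with hhn
    have hfin : (Function.support hn).Finite := by
      refine (finite_support_iterMask a n).subset fun k hk h0 => hk ?_
      rw [hhn]
      simp only [h0, Matrix.zero_apply, zero_mul, Finset.sum_const_zero, mul_zero]
    have h1 := integral_floor_two_pow hfin n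
    have h2 := congrFun (iterate_fourier hf n (ξ / 2 ^ n)) i
    have hs : Summable fun k : ℤ => Complex.exp (-(Complex.I * k * (ξ / 2 ^ n : ℝ))) •
        (iterMask a n k *ᵥ f (ξ / 2 ^ n)) := by
      refine summable_of_hasFiniteSupport ((finite_support_iterMask a n).subset fun k hk h0 => hk ?_)
      simp only [h0, Matrix.zero_mulVec, smul_zero]
    rw [tsum_apply hs, Pi.smul_apply, mul_div_cancel₀ ξ (by positivity), smul_eq_mul] at h2
    have h3 : ∑' k, hn k = (2 : ℂ) ^ n * f ξ i := h2.symm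
    rw [h3] at h1
    exact mul_left_cancel₀ (pow_ne_zero n two_ne_zero) h1
  obtain ⟨n₀, hn₀⟩ := h 1 one_pos
  choose B hB using fun i l => (hF i l).bounded_above_of_compact_support (hc i l)
  have hf0' : Filter.Tendsto (fun n : ℕ => f (ξ / 2 ^ n)) Filter.atTop (nhds (f 0)) :=
    hf0.comp (tendsto_const_div_two_pow ξ)
  have hexp : ∀ k : ℤ, ∀ y : ℝ, ‖Complex.exp (-(Complex.I * k * y))‖ = 1 := by
    intro k y
    have : -(Complex.I * k * y) = ((-(k * y) : ℝ) : ℂ) * Complex.I := by push_cast; ring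
    rw [this, Complex.norm_exp_ofReal_mul_I]
  have hlim : Filter.Tendsto (fun n => ∫ t, S n t) Filter.atTop (nhds
      (∫ t : ℝ, Complex.exp (-(Complex.I * t * ξ)) * ∑ l, F i l t * f 0 l)) := by
    -- Rounding down moves t by at most 2^{-n} ≤ 1, so all step functions vanish outside [-(N + 1),
    -- N + 1].
    refine tendsto_integral_filter_of_dominated_convergence
      ((Set.Icc (-((N : ℝ) + 1)) (N + 1)).indicator fun _ =>
        ∑ l, (B i l + 1) * (‖f 0‖ + 1)) ?_ ?_ ?_ ?_
    · refine Filter.Eventually.of_forall fun n => Measurable.aestronglyMeasurable ?_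
      exact (measurable_from_top (f := fun k : ℤ =>
        Complex.exp (-(Complex.I * k * (ξ / 2 ^ n : ℝ))) *
          ∑ l, iterMask a n k i l * f (ξ / 2 ^ n) l)).comp
        (Int.measurable_floor.comp (measurable_const_mul (2 ^ n)))
    · filter_upwards [Filter.eventually_ge_atTop n₀,
        hf0'.norm.eventually (gt_mem_nhds (lt_add_one _))] with n hn hfn
      refine Filter.Eventually.of_forall fun t => ?_
      by_cases ht : t ∈ Set.Icc (-((N : ℝ) + 1)) (N + 1)
      · rw [Set.indicator_of_mem ht, hS]
        simp only
        rw [norm_mul, hexp, one_mul]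
        refine (norm_sum_le _ _).trans (Finset.sum_le_sum fun l _ => ?_)
        rw [norm_mul]
        have h1 := hn₀ n hn ⌊2 ^ n * t⌋ i l
        have h2 := hB i l ((⌊2 ^ n * t⌋ : ℤ) / 2 ^ n)
        have h3 := norm_sub_norm_le (iterMask a n ⌊2 ^ n * t⌋ i l)
          (F i l ((⌊2 ^ n * t⌋ : ℤ) / 2 ^ n))
        have h4 := norm_nonneg (iterMask a n ⌊2 ^ n * t⌋ i l)
        refine mul_le_mul (by linarith) ((norm_le_pi_norm _ l).trans hfn.le) (norm_nonneg _)
          (by linarith)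
      · rw [Set.indicator_of_notMem ht, hS]
        simp only
        have h0 : iterMask a n ⌊2 ^ n * t⌋ = 0 := by
          by_contra h0
          have h1 := iterMask_support' hN n _ h0
          have h2n : (0 : ℝ) < 2 ^ n := by positivity
          have h2n' : (1 : ℝ) ≤ 2 ^ n := one_le_pow₀ (by norm_num)
          rw [abs_div, abs_of_pos h2n, div_le_iff₀ h2n, abs_le] at h1
          have h3 := Int.floor_le (2 ^ n * t)
          have h4 := Int.lt_floor_add_one (2 ^ n * t)
          refine ht ⟨?_, ?_⟩
          · by_contra hlt
            rw [not_le] at hlt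
            nlinarith
          · by_contra hlt
            rw [not_le] at hlt
            nlinarith
        simp [h0]
    · exact (integrable_indicator_iff measurableSet_Icc).2 (by simp)
    · refine Filter.Eventually.of_forall fun t => ?_
      refine Filter.Tendsto.mul ?_ (tendsto_finsetSum _ fun l _ =>
        (h.tendsto hF (tendsto_floor_div t) i l).mul ((tendsto_pi_nhds.1 hf0') l))
      have h1 : Filter.Tendsto (fun n : ℕ => Complex.exp
          (-(Complex.I * (((⌊2 ^ n * t⌋ : ℤ) : ℝ) / 2 ^ n : ℝ) * ξ))) Filter.atTop
          (nhds (Complex.exp (-(Complex.I * t * ξ)))) := by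
        have hcont : Continuous fun y : ℝ => Complex.exp (-(Complex.I * y * ξ)) := by fun_prop
        exact (hcont.tendsto t).comp (tendsto_floor_div t)
      refine h1.congr fun n => ?_
      congr 1
      push_cast
      ring
  simp only [hSint] at hlim
  exact tendsto_nhds_unique tendsto_const_nhds hlim

theorem tendsto_fourierVec {φ : Fin r → 𝓢'(ℝ, ℂ)}
    (hφ : ∀ i, IsCompact (Distribution.dsupport (φ i))) :
    Filter.Tendsto (fourierVec φ) (nhds 0) (nhds (fourierVec φ 0)) := by
  rw [tendsto_pi_nhds]
  intro i
  obtain ⟨n, hn⟩ := exists_vanishesOff (hφ i)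
  exact hn.tendsto_distFourier

/-- A compactly supported distribution whose Fourier transform is the one of a continuous function
is given by this function. -/
theorem toTemperedDistribution_eq_of_fourier {T : 𝓢'(ℝ, ℂ)}
    (hT : IsCompact (Distribution.dsupport T)) {f : ℝ → ℂ} (hf : MemLp f ∞ volume)
    (hc : HasCompactSupport f)
    (h : ∀ ξ, distFourier T ξ = ∫ x : ℝ, Complex.exp (-(Complex.I * x * ξ)) * f x) :
    Lp.toTemperedDistribution (hf.toLp f) = T := by
  obtain ⟨n, hn⟩ := exists_vanishesOff hT
  obtain ⟨R, hR0, hR⟩ := hc.exists_pos_le_norm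
  set M := max n ⌈R⌉₊ with hM
  have hfM : ∀ x : ℝ, (M : ℝ) + 1 ≤ |x| → f x = 0 := by
    intro x hx
    refine hR x ?_
    have h1 : (⌈R⌉₊ : ℝ) ≤ M := by exact_mod_cast le_max_right _ _
    rw [Real.norm_eq_abs]
    linarith [Nat.le_ceil R]
  have h1 := vanishesOff_toTemperedDistribution hf hfM
  have h2 := hn.mono (le_max_left n ⌈R⌉₊)
  rw [← sub_eq_zero]
  refine (h1.sub h2).eq_zero fun ξ => ?_
  rw [distFourier_sub h1 h2, h, distFourier_toTemperedDistribution hf hfM, sub_self]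

/-! ### Necessity: smoothness of φ and of the mask -/

/-- The derivatives of a refinable function are refinable. -/
theorem Refinable.iteratedDeriv {a : ℤ →₀ Matrix (Fin r) (Fin r) ℂ} {g : ℝ → Fin r → ℂ} {m : ℕ}
    (h : Refinable a 1 g) (hg : ∀ i, ContDiff ℝ m fun x => g x i) :
    Refinable a (2 ^ m) fun x i => iteratedDeriv m (fun y => g y i) x := by
  intro x
  ext i
  have h1 : (fun y => g y i) = fun y => 2 * ∑ k ∈ a.support, ∑ j, a k i j * g (2 * y - k) j := by
    funext y
    have := congrFun (h y) i
    rw [this, one_smul, Pi.smul_apply, Finset.sum_apply, smul_eq_mul]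
    rfl
  have hd : ∀ (k : ℤ) (j : Fin r), ContDiff ℝ m fun y : ℝ => g (2 * y - k) j := fun k j =>
    (hg j).comp ((contDiff_const.mul contDiff_id).sub contDiff_const)
  have h2 : ∀ (k : ℤ) (j : Fin r), _root_.iteratedDeriv m (fun y : ℝ => g (2 * y - k) j) x =
      2 ^ m * _root_.iteratedDeriv m (fun y => g y j) (2 * x - k) := by
    intro k j
    have h3 : ContDiff ℝ m fun z : ℝ => g (z - k) j := (hg j).comp (contDiff_id.sub contDiff_const)
    have h4 := congrFun (iteratedDeriv_comp_const_smul h3 (2 : ℝ)) x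
    rw [iteratedDeriv_comp_sub_const m (fun z => g z j) (k : ℝ)] at h4
    rw [h4, Complex.real_smul]
    push_cast
    rfl
  simp only
  rw [h1, iteratedDeriv_const_mul_field, iteratedDeriv_fun_sum fun k _ =>
    (ContDiff.sum fun j _ => contDiff_const.mul (hd k j)).contDiffAt]
  simp only [Pi.smul_apply, Finset.sum_apply, Complex.real_smul, smul_eq_mul, Finset.mul_sum]
  refine Finset.sum_congr rfl fun k _ => ?_
  rw [iteratedDeriv_fun_sum fun j _ => (contDiff_const.mul (hd k j)).contDiffAt]
  simp only [Matrix.mulVec, dotProduct, Finset.mul_sum, iteratedDeriv_const_mul_field, h2]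
  refine Finset.sum_congr rfl fun j _ => ?_
  push_cast
  ring

/-- A refinable vector of `C^m` functions with compact support has smoothness greater than `m`. -/
theorem Refinable.lt_smVec {a : ℤ →₀ Matrix (Fin r) (Fin r) ℂ} {g : ℝ → Fin r → ℂ} {m : ℕ}
    (hr : 0 < r) (h : Refinable a 1 g) (hg : ∀ i, ContDiff ℝ m fun x => g x i)
    (hc : ∀ i, HasCompactSupport fun x => g x i) {φ : Fin r → 𝓢'(ℝ, ℂ)}
    (hφ : ∀ i, Lp.toTemperedDistribution
      ((memLp_top_of_hasCompactSupport (hg i).continuous (hc i)).toLp fun x => g x i) = φ i) :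
    ((m : ℝ) : EReal) < smVec φ := by
  have hGc : Continuous fun x i => _root_.iteratedDeriv m (fun y => g y i) x :=
    continuous_pi fun i => (hg i).continuous_iteratedDeriv m le_rfl
  have hGs : HasCompactSupport fun x i => _root_.iteratedDeriv m (fun y => g y i) x := by
    refine HasCompactSupport.intro' (K := ⋃ i, tsupport (_root_.iteratedDeriv m fun y => g y i))
      (isCompact_iUnion fun i => hasCompactSupport_iteratedDeriv (hc i) m)
      (isCompact_iUnion fun i => hasCompactSupport_iteratedDeriv (hc i) m).isClosed ?_
    intro x hx
    ext i
    rw [Set.mem_iUnion, not_exists] at hx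
    exact image_eq_zero_of_notMem_tsupport (hx i)
  obtain ⟨C, τ, hC, hτ0, hτ1, hH⟩ := (h.iteratedDeriv hg).exists_holder (by positivity) hGc hGs
  have : Nonempty (Fin r) := ⟨⟨0, hr⟩⟩
  -- The infimum over finitely many entries is attained, so strictness for each entry suffices.
  obtain ⟨i, hi⟩ := exists_eq_ciInf_of_finite (f := fun i => smDist (φ i))
  rw [smVec, ← hi, ← hφ i]
  exact lt_smDist_of_holder (hg i) (hc i) hτ0 hτ1 hC fun x y =>
    (norm_le_pi_norm ((fun i => _root_.iteratedDeriv m (fun y => g y i) x) -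
      fun i => _root_.iteratedDeriv m (fun z => g z i) y) i).trans (hH x y)

/-- Over the fixed window of u, the iterate at level n is uniformly close to the single value
F(2^{-n}k), by uniform continuity. Thus the convolution is close to F(2^{-n}k)û(0), which is 0. -/
theorem IsUniformLimit.decays {a : ℤ →₀ Matrix (Fin r) (Fin r) ℂ} {F : Fin r → Fin r → ℝ → ℂ}
    (h : IsUniformLimit a F) (hF : ∀ i l, Continuous (F i l))
    (hc : ∀ i l, HasCompactSupport (F i l)) {u : ℤ →₀ (Fin r → ℂ)}
    (hu : ∀ i x, (fun l => F i l x) ⬝ᵥ symbol u 0 = 0) : Decays a u := by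
  intro ε hε
  obtain ⟨N, hN⟩ := exists_support_bound u
  set Q : ℝ := ∑ j ∈ u.support, ∑ l, ‖u j l‖ with hQ
  have hQ0 : 0 ≤ Q := by positivity
  set δ : ℝ := ε / (2 * (Q + 1)) with hδ
  have hδ0 : 0 < δ := by positivity
  obtain ⟨n₁, hn₁⟩ := h δ hδ0
  choose η hη hη' using fun i l => Metric.uniformContinuous_iff.1
    ((hc i l).uniformContinuous_of_continuous (hF i l)) δ hδ0
  have ev : ∀ᶠ n : ℕ in Filter.atTop, ∀ i l, (N : ℝ) / 2 ^ n < η i l := by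
    rw [Filter.eventually_all]
    intro i
    rw [Filter.eventually_all]
    exact fun l => (tendsto_const_div_two_pow N).eventually (gt_mem_nhds (hη i l))
  obtain ⟨n₂, hn₂⟩ := Filter.eventually_atTop.1 ev
  refine ⟨max n₁ n₂, fun n hn k => ?_⟩
  rw [pi_norm_le_iff_of_nonneg hε.le]
  intro i
  have h1 : ∀ j ∈ u.support, ∀ l, ‖iterMask a n (k - j) i l - F i l (k / 2 ^ n)‖ ≤ 2 * δ := by
    intro j hj l
    have e1 := hn₁ n (le_of_max_le_left hn) (k - j) i l
    have h2n : (0 : ℝ) < 2 ^ n := by positivity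
    have e2 : dist (((k - j : ℤ) : ℝ) / 2 ^ n) ((k : ℝ) / 2 ^ n) < η i l := by
      refine lt_of_le_of_lt ?_ (hn₂ n (le_of_max_le_right hn) i l)
      rw [Real.dist_eq, ← sub_div, abs_div, abs_of_pos h2n]
      push_cast
      rw [sub_sub_cancel_left, abs_neg, div_le_div_iff_of_pos_right h2n]
      exact_mod_cast hN j (Finsupp.mem_support_iff.1 hj)
    have e3 := hη' i l e2
    rw [dist_eq_norm] at e3
    have e4 := norm_sub_le_norm_sub_add_norm_sub (iterMask a n (k - j) i l)
      (F i l (((k - j : ℤ) : ℝ) / 2 ^ n)) (F i l (k / 2 ^ n))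
    linarith
  have h2 : conv (iterMask a n) u k i =
      ∑ j ∈ u.support, ∑ l, (iterMask a n (k - j) i l - F i l (k / 2 ^ n)) * u j l := by
    have e1 : ∑ j ∈ u.support, ∑ l, F i l (k / 2 ^ n) * u j l = 0 := by
      rw [← hu i (k / 2 ^ n), symbol_zero, dotProduct]
      simp only [Finset.sum_apply, Finset.mul_sum]
      rw [Finset.sum_comm]
    rw [← sub_zero (conv (iterMask a n) u k i), ← e1, conv, Finsupp.sum, Finset.sum_apply,
      ← Finset.sum_sub_distrib]
    refine Finset.sum_congr rfl fun j _ => ?_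
    rw [Matrix.mulVec, dotProduct, ← Finset.sum_sub_distrib]
    exact Finset.sum_congr rfl fun l _ => (sub_mul _ _ _).symm
  rw [h2]
  calc ‖∑ j ∈ u.support, ∑ l, (iterMask a n (k - j) i l - F i l (k / 2 ^ n)) * u j l‖
      ≤ ∑ j ∈ u.support, ∑ l, 2 * δ * ‖u j l‖ := by
        refine (norm_sum_le _ _).trans (Finset.sum_le_sum fun j hj => ?_)
        refine (norm_sum_le _ _).trans (Finset.sum_le_sum fun l _ => ?_)
        rw [norm_mul]
        exact mul_le_mul_of_nonneg_right (h1 j hj l) (norm_nonneg _)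
    _ = 2 * δ * Q := by simp only [← Finset.mul_sum, hQ]
    _ ≤ ε := by
        have e1 : 2 * δ * (Q + 1) = ε := by
          rw [hδ]
          field_simp
        nlinarith

/-- Decay on all sequences with one vanishing moment implies geometric decay. -/
theorem exists_geometric_decay {a : ℤ →₀ Matrix (Fin r) (Fin r) ℂ} {v : ℤ →₀ (Fin r → ℂ)} {k : ℕ}
    (hv : HasSumRules a k v) (hk : 1 ≤ k) (hd : ∀ u ∈ moments 1 v, Decays a u) :
    ∃ θ : ℝ, 0 < θ ∧ θ < 1 ∧ ∀ u ∈ moments 1 v, ∃ C : ℝ, 0 < C ∧ ∀ n p,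
      ‖conv (iterMask a n) u p‖ ≤ C * θ ^ n := by
  obtain ⟨N, hN⟩ := exists_support_bound a
  -- On the invariant window, a vanishing zeroth moment defines a finite-dimensional space stable
  -- under both transitions, since the sum rules have order at least 1.
  set W : Submodule ℂ (ℤ →₀ (Fin r → ℂ)) := supportedSubmodule r (N + 1) ⊓
    LinearMap.ker (momentL v 0) with hW
  have hmem : ∀ u, u ∈ moments 1 v ↔ momentL v 0 u = 0 := by
    intro u
    rw [mem_moments_iff]
    refine ⟨fun h => h 0 one_pos, fun h j hj => ?_⟩
    obtain rfl : j = 0 := by omega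
    exact h
  have hT : ∀ ε : ℤ, ε = 0 ∨ ε = 1 → ∀ u ∈ W, transition a ε u ∈ W := by
    intro ε hε u hu
    refine ⟨fun k hk => transition_support_of_le hN hε le_rfl hu.1 hk, ?_⟩
    rw [SetLike.mem_coe, LinearMap.mem_ker, ← hmem]
    exact hv.transition_mem_moments ((hmem u).2 hu.2) ε hk
  obtain ⟨C, θ, hC, hθ, hθ1, hdec⟩ := conv_iterMask_decay a W (N + 1) (fun u hu => hu.1)
    (hT 0 (Or.inl rfl)) (hT 1 (Or.inr rfl)) 1 one_pos (fun u hu ε hε => by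
      obtain ⟨n₀, hn₀⟩ := hd u ((hmem u).2 hu.2) ε hε
      refine ⟨n₀, fun n hn k => ?_⟩
      rw [one_pow, one_mul]
      exact hn₀ n hn k)
  have hθ0 : 0 < θ := by linarith
  -- Wider supports lose one unit per transition. Each such level shifts n by one, which accounts
  -- for the division by θ in the new constant.
  have key : ∀ (R : ℕ) (u : ℤ →₀ (Fin r → ℂ)), (∀ k, u k ≠ 0 → |k| ≤ (N + 1 + R : ℕ)) →
      u ∈ moments 1 v → ∃ C : ℝ, 0 < C ∧ ∀ n p, ‖conv (iterMask a n) u p‖ ≤ C * θ ^ n := by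
    intro R
    induction R with
    | zero =>
      intro u hu hum
      obtain ⟨M, hM0, hM⟩ := conv_iterMask_bounded a 0 u
      simp only [conv_iterMask_zero] at hM
      refine ⟨C * M + 1, by positivity, fun n p => ?_⟩
      have h1 := hdec u ⟨hu, (hmem u).1 hum⟩ M hM n p
      rw [one_pow, one_mul] at h1
      have : 0 < θ ^ n := by positivity
      nlinarith
    | succ R ih =>
      intro u hu hum
      have hT' : ∀ ε : ℤ, ε = 0 ∨ ε = 1 → ∃ C : ℝ, 0 < C ∧ ∀ n p,
          ‖conv (iterMask a n) (transition a ε u) p‖ ≤ C * θ ^ n := fun ε hε =>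
        ih _ (fun k hk => transition_support_shrink hN hε hu hk)
          (hv.transition_mem_moments hum ε hk)
      obtain ⟨C₀, hC₀, h₀⟩ := hT' 0 (Or.inl rfl)
      obtain ⟨C₁, hC₁, h₁⟩ := hT' 1 (Or.inr rfl)
      obtain ⟨D, hD0, hD⟩ := conv_iterMask_bounded a 0 u
      refine ⟨D + (C₀ + C₁) / θ, by positivity, fun n p => ?_⟩
      rcases n with _ | n
      · have h2 : 0 < (C₀ + C₁) / θ := by positivity
        rw [pow_zero, mul_one]
        linarith [hD p]
      · refine conv_iterMask_succ_le (fun ε hε p => ?_) p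
        have h2 : (D + (C₀ + C₁) / θ) * θ ^ (n + 1) = D * θ ^ (n + 1) + (C₀ + C₁) * θ ^ n := by
          field_simp
          ring
        have h3 : 0 ≤ D * θ ^ (n + 1) := by positivity
        have h4 : 0 < C₀ * θ ^ n := by positivity
        have h5 : 0 < C₁ * θ ^ n := by positivity
        rw [h2]
        rcases hε with rfl | rfl
        · linarith [h₀ n p]
        · linarith [h₁ n p]
  refine ⟨θ, hθ0, hθ1, fun u hu => ?_⟩
  obtain ⟨R, hR⟩ := exists_support_bound u
  exact key R u (fun k hk => (hR k hk).trans (by push_cast; omega)) hu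

/-- A nonzero row of F is a matching filter of order 1, so sr(a) ≥ 1. Simplicity of the eigenvalue 1
makes every row a multiple of v̂(0), so a single vanishing moment already yields geometric decay;
the moment space for sr(a) lies inside that one. -/
theorem IsUniformLimit.rho_lt_one {a : ℤ →₀ Matrix (Fin r) (Fin r) ℂ}
    {F : Fin r → Fin r → ℝ → ℂ} (h : IsUniformLimit a F) (hF : ∀ i l, Continuous (F i l))
    (hc : ∀ i l, HasCompactSupport (F i l)) (hF0 : ∃ i l x, F i l x ≠ 0)
    (ha : (symbol a 0).charpoly.rootMultiplicity 1 = 1) {v : ℤ →₀ (Fin r → ℂ)}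
    (hv : HasSumRules a (sumRuleOrder a) v) : rho a (sumRuleOrder a) v < 1 := by
  have hrow := h.vecMul_symbol_zero hF
  obtain ⟨i, l, x, hx⟩ := hF0
  have hsr : 1 ≤ sumRuleOrder a := le_sumRuleOrder
    (hasSumRules_one (fun h0 => hx (congrFun h0 l)) (hrow x i) (h.vecMul_symbol_pi hF x i))
  have hv0 : symbol v 0 ᵥ* symbol a 0 = symbol v 0 := by
    have := hv.at_zero 0 hsr
    simpa using this
  have hd : ∀ u ∈ moments 1 v, Decays a u := by
    intro u hu
    refine h.decays hF hc fun i x => ?_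
    obtain ⟨c, hcv⟩ := exists_eq_smul_of_vecMul_eq ha hv0 (hrow x i) hv.ne_zero
    have h1 := mem_moments_iff.1 hu 0 one_pos
    rw [momentL_zero] at h1
    rw [hcv, smul_dotProduct, h1, smul_zero]
  obtain ⟨θ, hθ0, hθ1, hθ⟩ := exists_geometric_decay hv hsr hd
  refine lt_of_le_of_lt (rho_le_of_bound hθ0.le fun u hu => hθ u ?_)
    (ENNReal.ofReal_lt_one.2 hθ1)
  rw [mem_moments_iff] at hu ⊢
  exact fun j hj => hu j (hj.trans_le hsr)

/-- The bridge between the two conclusions is g = F φ̂(0): it inherits smoothness and the refinement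
equation from F and represents φ. Because φ̂(0) ≠ 0, F cannot vanish identically. -/
theorem LagrangeConvergent.smoothness {a : ℤ →₀ Matrix (Fin r) (Fin r) ℂ} {m : ℕ}
    (hconv : LagrangeConvergent a m) (ha : (symbol a 0).charpoly.rootMultiplicity 1 = 1)
    {φ : Fin r → 𝓢'(ℝ, ℂ)} (hφ_supp : ∀ i, IsCompact (Distribution.dsupport (φ i)))
    (hφ_ref : ∀ ξ : ℝ, fourierVec φ (2 * ξ) = symbol a ξ *ᵥ fourierVec φ ξ)
    (hφ_zero : fourierVec φ 0 ≠ 0) {v : ℤ →₀ (Fin r → ℂ)}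
    (hv : HasSumRules a (sumRuleOrder a) v) :
    0 < smMask a v ∧ ((m : ℝ) : EReal) < smVec φ := by
  obtain ⟨F, hFm, ⟨R, hR⟩, hlim⟩ := hconv.exists_isUniformLimit
  have hF : ∀ i l, Continuous (F i l) := fun i l => (hFm i l).continuous
  have hout : ∀ x : ℝ, x ∉ Set.Icc (-(R : ℝ)) R → (R : ℝ) ≤ |x| := fun x hx =>
    le_of_lt (by by_contra h; exact hx (abs_le.1 (not_lt.1 h)))
  have hc : ∀ i l, HasCompactSupport (F i l) := fun i l =>
    HasCompactSupport.intro isCompact_Icc fun x hx => hR i l x (hout x hx)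
  have hfour := hlim.fourier_eq hF hc hφ_ref (tendsto_fourierVec hφ_supp)
  set g : ℝ → Fin r → ℂ := fun x i => ∑ l, F i l x * fourierVec φ 0 l with hg
  have hgm : ∀ i, ContDiff ℝ m fun x => g x i := fun i =>
    ContDiff.sum fun l _ => (hFm i l).mul contDiff_const
  have hgc : ∀ i, HasCompactSupport fun x => g x i := fun i =>
    HasCompactSupport.intro isCompact_Icc fun x hx =>
      Finset.sum_eq_zero fun l _ => by rw [hR i l x (hout x hx), zero_mul]
  have hF0 : ∃ i l x, F i l x ≠ 0 := by
    by_contra! hcon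
    refine hφ_zero (funext fun i => ?_)
    rw [hfour]
    simp [hcon]
  have href : Refinable a 1 g := by
    intro x
    ext i
    rw [one_smul, Pi.smul_apply, Finset.sum_apply, smul_eq_mul, hg]
    simp only
    simp only [hlim.refinement hF x, Matrix.mulVec, dotProduct, Finset.mul_sum, Finset.sum_mul]
    rw [Finset.sum_comm]
    refine Finset.sum_congr rfl fun k _ => ?_
    rw [Finset.sum_comm]
    refine Finset.sum_congr rfl fun j _ => Finset.sum_congr rfl fun l _ => ?_
    ring
  refine ⟨(zero_lt_smMask_iff a v).2 (hlim.rho_lt_one hF hc hF0 ha hv), ?_⟩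
  obtain ⟨i₀, -⟩ := hF0
  refine href.lt_smVec (Fin.pos_iff_nonempty.2 ⟨i₀⟩) hgm hgc fun i => ?_
  exact toTemperedDistribution_eq_of_fourier (hφ_supp i) _ (hgc i) fun ξ => hfour ξ i

end VectorSubdivision

end

theorem mainTheorem7 (r m : ℕ) (a : ℤ →₀ Matrix (Fin r) (Fin r) ℂ)
    (ha : VectorSubdivision.EigenvalueCondition a)
    (φ : Fin r → 𝓢'(ℝ, ℂ))
    (hφ_supp : ∀ i, IsCompact (Distribution.dsupport (φ i)))
    (hφ_ref : ∀ ξ : ℝ, VectorSubdivision.fourierVec φ (2 * ξ) =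
      VectorSubdivision.symbol a ξ *ᵥ VectorSubdivision.fourierVec φ ξ)
    (hφ_zero : VectorSubdivision.fourierVec φ 0 ≠ 0)
    (v : ℤ →₀ (Fin r → ℂ))
    (hv : VectorSubdivision.HasSumRules a (VectorSubdivision.sumRuleOrder a) v) :
    VectorSubdivision.LagrangeConvergent a m ↔
      0 < VectorSubdivision.smMask a v ∧ ((m : ℝ) : EReal) < VectorSubdivision.smVec φ :=
  ⟨fun h => h.smoothness ha.1 hφ_supp hφ_ref hφ_zero hv, fun h =>
    VectorSubdivision.lagrangeConvergent_of_smoothness hφ_supp hφ_ref hφ_zero hv h.1 h.2⟩
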